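/- **Setting.** Let $T=\operatorname{Hom}(\Lambda,\mathbb C^*)\cong(\mathbb C^*)^d$ be a complex torus with character lattice $\Lambda$, $V=\operatorname{Hom}(\Lambda,\mathbb R)$, $\exp\colon V\to T$, $v\mapsto e^{2\pi i v}$, the universal covering of the compact torus. Let $\mathcal A$ be a (complexified) toric arrangement: a finite family of level sets $H=\chi^{-1}(a)$ with $\chi\in\Lambda\setminus\{0\}$, $|a|=1$. A *layer* is a connected component of an intersection of members ($T$ included). $\mathcal A$ is *essential* if all layers that are minimal under inclusion have dimension $0$. To $H$ corresponds the hyperplane $X_H=\ker\chi\subset V$; $\mathcal A_0=\{X_H\}$; for a layer $L$, $X_L=\bigcap_{H\supseteq L}X_H$, and $\dim L=\dim X_L$. Faces of real arrangements are given by sign vectors and ordered by inclusion of closures; for faces $F,G$, the face $F_G$ has the sign of $F$ on the hyperplanes containing $G$ and the sign of $G$ on the others; chambers are the faces lying on no hyperplane. *Face category.* Let $\mathcal A^\upharpoonright$ be the lift of $\mathcal A$ to $V$. The objects of $\mathcal F(\mathcal A)$ are the images in the compact torus of the faces of $\mathcal A^\upharpoonright$; the morphisms $F\to G$ are the orbits,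 under deck transformations, of pairs $\tilde F\le\tilde G$ of lifts. The support $\operatorname{supp}(F)$ is the smallest layer containing $F$. For a face $F$ put $\mathcal A[F]=\{X_H: H\supseteq F\}$; for a face $K$ of $\mathcal A_0$ let $\langle K:F\rangle$ be the face of $\mathcal A[F]$ containing it. A morphism $m\colon F\to G$ defines the face $F_m$ of $\mathcal A[F]$ of directions leading from $\tilde F$ into $\tilde G$, and a map $i_m$ from faces of $\mathcal A[G]$ to faces of $\mathcal A[F]$: $i_m(K)$ has the sign of $K$ on $\mathcal A[G]$ and the sign of $F_m$ on $\mathcal A[F]\setminus\mathcal A[G]$. *Salvetti category.* For a real arrangement, $\mathcal S$ is the poset of pairs $[G,C]$, $C$ a chamber, $G\le C$, with $[G',C']\le[G,C]$ iff $G\le G'$ and $C_{G'}=C'$. $\mathcal S(\mathcal A)$ is the Grothendieck construction of $\mathcal F(\mathcal A)^{op}\to\mathrm{Posets}$, $F\mapsto\mathcal S(\mathcal A[F])$, $m\mapsto([K,C]\mapsto[i_m(K),i_m(C)])$, and $\operatorname{Sal}(\mathcal A)$ is its nerve. For a layer $Y$ and a face $F_0$ of $\mathcal A_0$, $\mathcal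 S_{Y,F_0}$ is the full subcategory on all $(F,[G,K])$ with $F\subseteq Y$ and $K=C_G$ for some chamber $C\ge\langle F_0:F\rangle$ of $\mathcal A[F]$. *Quotients.* For a layer $L$, a coset of the subtorus $L_0$, let $\overline{\mathcal A}_L=\{H/L_0: H\in\mathcal A, H\supseteq L\}$ in $T/L_0$. The maps $\pi_L$ send a face of $\mathcal A$ (of $\mathcal A_0$, of $\mathcal A[F]$) to the face of $\overline{\mathcal A}_L$ (of $(\overline{\mathcal A}_L)_0$, of $\overline{\mathcal A}_L[\pi_L(F)]$) containing its image, and a layer to the smallest layer of $\overline{\mathcal A}_L$ containing its image. They induce the functor $\Phi_L\colon\mathcal S(\mathcal A)\to\mathcal S(\overline{\mathcal A}_L)$, $(F,[K,C])\mapsto(\pi_L(F),[\pi_L(K),\pi_L(C)])$, and $(\Phi_L)_*$ on $H_1(\operatorname{Sal};\mathbb Z)$. *The classes $\widehat\lambda$.* For a layer $M$ of dimension $1$ choose a chamber $R_M$ of $\mathcal A_0$ adjacent to $X_M$ (it has a face with linear hull $X_M$) and a gallery of minimal length $R_M=C_0,\dots,C_k$ in $\mathcal A_0$ ending at the chamber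 opposite to $-R_M$ with respect to $X_M$ (same closure on $X_M$, separated from $-R_M$ exactly by the hyperplanes containing $X_M$). For a chamber $B$ of $\mathcal A_0$, $\Lambda^M_B$ is the full subcategory of $\mathcal S(\mathcal A)$ on the objects $(F,v)$ and $(F,e)$ with $F\subseteq M$, $v=[\langle C_j:F\rangle,\langle C_j:F\rangle]$, $e=[W,\langle B:F\rangle_W]$, where $W$ is the wall between $\langle C_j:F\rangle\ne\langle C_{j+1}:F\rangle$. Its morphisms between distinct objects that do not factor through a third object form a cycle graph, and $\widehat\lambda^M_B$ is the class of the $1$-cycle supported on these morphisms in which, over a chosen point face $P_0\subseteq M$, the arrow from the first vertex $v_0$ (given by $C_0$) to the first $e_0$ has coefficient $1$. *The classes $\widehat\omega$.* For $H\in\mathcal A$ choose a chamber $R_H$ of $\mathcal A_0$. For $m\colon F\to G$ with $\operatorname{supp}(G)=H$ put $C_1=\langle R_H:F\rangle_{F_m}$, $C_2=\langle -R_H:F\rangle_{F_m}$; $\Omega^{(m)}$ consists of $(F,[C_1,C_1])$, $(F,[F_m,C_1])$, $(F,[C_2,C_2])$, $(F,[F_m,C_2])$, and $[\Omega^{(m)}]$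 is the $1$-cycle on it in which $[C_1,C_1]\to[F_m,C_1]$ has coefficient $1$. Its class does not depend on $m$ and is $\widehat\omega_H$. **Lemma.** Let $\mathcal A$ be an essential toric arrangement in a torus $T$ of dimension $d$ and let $L$ be a layer. 1. For every layer $M$ of dimension $1$ with $X_M\subseteq X_L$ and every chamber $B$ of $\mathcal A_0$, $\Phi_L(\Lambda^M_B)$ is a single vertex (one object, all morphisms going to its identity). In particular $(\Phi_L)_*(\widehat\lambda^M_B)=0$. 2. Let $H\in\mathcal A$. If $H\supseteq L$ and $R_{\pi_L(H)}$ is chosen on the same side of $\pi_L(H)=H/L_0$ as $R_H$ (for example $R_{\pi_L(H)}=\pi_L(R_H)$), then for every face $G$ with $\operatorname{supp}(G)=H$ we have $\operatorname{supp}(\pi_L(G))=\pi_L(H)$ and $\Phi_L(\Omega^{(\mathrm{id}_G)})=\Omega^{(\mathrm{id}_{\pi_L(G)})}$, and moreover $(\Phi_L)_*(\widehat\omega_H)=\widehat\omega_{\pi_L(H)}$. If $H\not\supseteq L$ and $H$ is not properly contained in another member of $\mathcal A$ (which is automatic if all members are connected), then $(\Phi_L)_*(\widehat\omega_H)=0$.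 3. For every layer $Y$ and every face $F_0$ of $\mathcal A_0$ (in particular whenever the linear hull of $F_0$ is $X_Y$), $\Phi_L(\mathcal S_{Y,F_0})\subseteq\mathcal S_{\pi_L(Y),\pi_L(F_0)}$. -/

import Mathlib

open CategoryTheory Opposite
open scoped Simplicial

noncomputable section

/-! ### Real arrangements of hyperplanes, sign vectors, faces, Salvetti posets -/

/-- An arrangement of affine hyperplanes `{v | form k v = level k}` in a real vector space,
together with the choice of positive sides. Repetitions in the family are harmless: they change
neither the faces nor their order. -/
structure RealArr (κ V : Type) [AddCommGroup V] [Module ℝ V] where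
  form : κ → V →ₗ[ℝ] ℝ
  level : κ → ℝ

namespace RealArr

variable {κ κ' V V' : Type} [AddCommGroup V] [Module ℝ V] [AddCommGroup V'] [Module ℝ V']

/-- The central arrangement with given linear forms. -/
def central (f : κ → V →ₗ[ℝ] ℝ) : RealArr κ V := ⟨f, fun _ => 0⟩

/-- The sign vector of a point. -/
def sgn (A : RealArr κ V) (v : V) (k : κ) : SignType := SignType.sign (A.form k v - A.level k)

/-- A face, encoded by its sign vector (which has to be the sign vector of some point). -/
@[ext] structure Face (A : RealArr κ V) where
  sgn : κ → SignType
  realized : ∃ v, A.sgn v = sgn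

namespace Face

variable {A : RealArr κ V} {B : RealArr κ' V'}

/-- The face as a set of points. -/
def carrier (F : A.Face) : Set V := {v | A.sgn v = F.sgn}

/-- The face that contains a given point. -/
def ofPoint (A : RealArr κ V) (v : V) : A.Face := ⟨A.sgn v, v, rfl⟩

/-- The face order, on sign vectors; by `Face.le_iff_closure` below this is inclusion of
topological closures. -/
instance : PartialOrder A.Face where
  le F G := ∀ k, F.sgn k = 0 ∨ F.sgn k = G.sgn k
  le_refl _ _ := Or.inr rfl
  le_trans F G K h₁ h₂ k := by
    rcases h₁ k with h | h
    · exact Or.inl h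
    · rcases h₂ k with h' | h'
      · exact Or.inl (h.trans h')
      · exact Or.inr (h.trans h')
  le_antisymm F G h₁ h₂ := by
    ext k
    rcases h₁ k with h | h
    · rcases h₂ k with h' | h'
      · rw [h, h']
      · rw [h']
    · rw [h]

theorem le_def {F G : A.Face} : F ≤ G ↔ ∀ k, F.sgn k = 0 ∨ F.sgn k = G.sgn k := Iff.rfl

/-- Chambers are the faces that lie on no hyperplane. -/
def IsChamber (C : A.Face) : Prop := ∀ k, C.sgn k ≠ 0

/-- `W` is a wall of `C`: a face of `C` of codimension one. The dimension is that of the linear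
hull; this is used for central arrangements only. -/
def IsWall (W C : A.Face) : Prop :=
  W ≤ C ∧ Module.finrank ℝ (Submodule.span ℝ W.carrier) + 1 = Module.finrank ℝ V

end Face

theorem perturb [Finite κ] (a b : κ → ℝ) : ∃ ε : ℝ, 0 < ε ∧ ε < 1 ∧
    ∀ k, SignType.sign ((1 - ε) * a k + ε * b k) =
      if a k = 0 then SignType.sign (b k) else SignType.sign (a k) := by
  have key : ∀ᶠ ε in nhdsWithin (0 : ℝ) (Set.Ioi 0), ∀ k,
      SignType.sign ((1 - ε) * a k + ε * b k) =
        if a k = 0 then SignType.sign (b k) else SignType.sign (a k) := by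
    rw [Filter.eventually_all]
    intro k
    have hc : Filter.Tendsto (fun ε : ℝ => (1 - ε) * a k + ε * b k)
        (nhdsWithin (0 : ℝ) (Set.Ioi 0)) (nhds (a k)) := by
      have : Continuous (fun ε : ℝ => (1 - ε) * a k + ε * b k) := by fun_prop
      have h := this.tendsto 0
      simp only [sub_zero, one_mul, zero_mul, add_zero] at h
      exact h.mono_left nhdsWithin_le_nhds
    rcases lt_trichotomy (a k) 0 with h | h | h
    · filter_upwards [hc.eventually_lt_const h] with ε hε
      rw [if_neg h.ne, sign_neg hε, sign_neg h]
    · filter_upwards [self_mem_nhdsWithin] with ε hε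
      rw [if_pos h, h, mul_zero, zero_add, sign_mul, sign_pos hε, one_mul]
    · filter_upwards [hc.eventually_const_lt h] with ε hε
      rw [if_neg h.ne', sign_pos hε, sign_pos h]
  have h1 : ∀ᶠ ε in nhdsWithin (0 : ℝ) (Set.Ioi 0), ε < 1 :=
    (eventually_lt_nhds zero_lt_one).filter_mono nhdsWithin_le_nhds
  have h0 : ∀ᶠ ε in nhdsWithin (0 : ℝ) (Set.Ioi 0), 0 < ε := self_mem_nhdsWithin
  obtain ⟨ε, h⟩ := (h0.and (h1.and key)).exists
  exact ⟨ε, h⟩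

namespace Face

variable {A : RealArr κ V} {B : RealArr κ' V'}

/-- The face order is inclusion of topological closures. -/
theorem le_iff_closure [TopologicalSpace V] [IsTopologicalAddGroup V] [ContinuousSMul ℝ V]
    (hA : ∀ k, Continuous (A.form k)) (F G : A.Face) :
    F ≤ G ↔ closure F.carrier ⊆ closure G.carrier := by
  obtain ⟨f, hf⟩ := F.realized
  obtain ⟨g, hg⟩ := G.realized
  constructor
  · intro h
    refine closure_minimal (fun x hx => ?_) isClosed_closure
    have hc : Continuous (fun t : ℝ => (1 - t) • x + t • g) := by fun_prop
    have ht : Filter.Tendsto (fun t : ℝ => (1 - t) • x + t • g)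
        (nhdsWithin (0 : ℝ) (Set.Ioo 0 1)) (nhds x) := by
      have h := hc.tendsto 0
      simp only [sub_zero, one_smul, zero_smul, add_zero] at h
      exact h.mono_left nhdsWithin_le_nhds
    have : (nhdsWithin (0 : ℝ) (Set.Ioo 0 1)).NeBot := by
      rw [nhdsWithin_Ioo_eq_nhdsGT zero_lt_one]; infer_instance
    refine mem_closure_of_tendsto ht ?_
    filter_upwards [self_mem_nhdsWithin] with t ht
    change A.sgn _ = G.sgn
    funext k
    have hx' := congrFun (show A.sgn x = F.sgn from hx) k
    have hg' := congrFun hg k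
    have e : A.form k ((1 - t) • x + t • g) - A.level k =
        (1 - t) * (A.form k x - A.level k) + t * (A.form k g - A.level k) := by
      simp only [map_add, map_smul, smul_eq_mul]; ring
    have h1 : 0 < 1 - t := sub_pos.2 ht.2
    have h2 := ht.1
    unfold RealArr.sgn at hx' hg' ⊢
    rw [e, ← hg']
    rcases h k with h0 | h0
    · rw [h0] at hx'
      rw [sign_eq_zero_iff.1 hx', mul_zero, zero_add, sign_mul, sign_pos h2, one_mul]
    · rw [h0, ← hg'] at hx'
      rcases lt_trichotomy (A.form k g - A.level k) 0 with hh | hh | hh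
      · rw [sign_neg hh] at hx' ⊢
        have := sign_eq_neg_one_iff.1 hx'
        exact sign_neg (by nlinarith)
      · rw [hh, sign_zero] at hx'
        rw [hh, sign_eq_zero_iff.1 hx']; simp
      · rw [sign_pos hh] at hx' ⊢
        have := sign_eq_one_iff.1 hx'
        exact sign_pos (by nlinarith)
  · intro h k
    have hf' : f ∈ closure G.carrier := h (subset_closure hf)
    rcases lt_trichotomy (A.form k g) (A.level k) with hh | hh | hh
    · have hs : closure G.carrier ⊆ {v | A.form k v ≤ A.level k} := by
        refine closure_minimal (fun v hv => ?_) (isClosed_le (hA k) continuous_const)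
        have hv' : A.sgn v k = A.sgn g k := by rw [show A.sgn v = G.sgn from hv, hg]
        unfold RealArr.sgn at hv'
        rw [sign_neg (sub_neg.2 hh), sign_eq_neg_one_iff] at hv'
        exact (sub_neg.1 hv').le
      rw [← hf, ← hg]
      unfold RealArr.sgn
      rcases (show A.form k f ≤ A.level k from hs hf').lt_or_eq with h' | h'
      · right; rw [sign_neg (sub_neg.2 hh), sign_neg (sub_neg.2 h')]
      · left; rw [h']; simp
    · have hs : closure G.carrier ⊆ {v | A.form k v = A.level k} := by
        refine closure_minimal (fun v hv => ?_) (isClosed_eq (hA k) continuous_const)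
        have hv' : A.sgn v k = A.sgn g k := by rw [show A.sgn v = G.sgn from hv, hg]
        unfold RealArr.sgn at hv'
        rw [hh, sub_self, sign_zero, sign_eq_zero_iff] at hv'
        exact sub_eq_zero.1 hv'
      left
      rw [← hf]
      unfold RealArr.sgn
      rw [show A.form k f = A.level k from hs hf']; simp
    · have hs : closure G.carrier ⊆ {v | A.level k ≤ A.form k v} := by
        refine closure_minimal (fun v hv => ?_) (isClosed_le continuous_const (hA k))
        have hv' : A.sgn v k = A.sgn g k := by rw [show A.sgn v = G.sgn from hv, hg]
        unfold RealArr.sgn at hv'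
        rw [sign_pos (sub_pos.2 hh), sign_eq_one_iff] at hv'
        exact (sub_pos.1 hv').le
      rw [← hf, ← hg]
      unfold RealArr.sgn
      rcases (show A.level k ≤ A.form k f from hs hf').lt_or_eq with h' | h'
      · right; rw [sign_pos (sub_pos.2 hh), sign_pos (sub_pos.2 h')]
      · left; rw [h']; simp

/-- The face `F_G`: its sign on a hyperplane is that of `F` if `G` lies on the hyperplane, and that
of `G` otherwise. -/
def proj [Finite κ] (F G : A.Face) : A.Face where
  sgn k := if G.sgn k = 0 then F.sgn k else G.sgn k
  realized := by
    obtain ⟨f, hf⟩ := F.realized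
    obtain ⟨g, hg⟩ := G.realized
    obtain ⟨ε, -, -, h⟩ := perturb (fun k => A.form k g - A.level k)
      (fun k => A.form k f - A.level k)
    refine ⟨(1 - ε) • g + ε • f, funext fun k => ?_⟩
    have e : A.form k ((1 - ε) • g + ε • f) - A.level k =
        (1 - ε) * (A.form k g - A.level k) + ε * (A.form k f - A.level k) := by
      simp only [map_add, map_smul, smul_eq_mul]; ring
    rw [← hf, ← hg]
    unfold RealArr.sgn
    rw [e, h k]
    simp only [sign_eq_zero_iff]

/-- The negative of a face of a central arrangement. -/
def neg {f : κ → V →ₗ[ℝ] ℝ} (F : (central f).Face) : (central f).Face where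
  sgn k := - F.sgn k
  realized := by
    obtain ⟨v, hv⟩ := F.realized
    refine ⟨-v, funext fun k => ?_⟩
    rw [← hv]
    simp [RealArr.sgn, central, Left.sign_neg]

/-- Forgetting hyperplanes and dividing by a subspace that is contained in all remaining ones:
`K` is sent to the face that contains the image of `K`. -/
def pull (e : κ' → κ) (p : V → V') (h : ∀ v k, B.sgn (p v) k = A.sgn v (e k)) (K : A.Face) :
    B.Face where
  sgn k := K.sgn (e k)
  realized := by
    obtain ⟨v, hv⟩ := K.realized
    exact ⟨p v, funext fun k => by rw [h, hv]⟩

end Face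

/-- The elements `[G, C]` of the Salvetti poset: a face `G` and a chamber `C ≥ G`. -/
@[ext] structure SalPoset (A : RealArr κ V) where
  face : A.Face
  chamber : A.Face
  isChamber : chamber.IsChamber
  le : face ≤ chamber

namespace SalPoset

variable [Finite κ] [Finite κ'] {A : RealArr κ V} {B : RealArr κ' V'}

/-- `[G', C'] ≤ [G, C]` if `G ≤ G'` and `C_{G'} = C'`. -/
instance : PartialOrder A.SalPoset where
  le x y := y.face ≤ x.face ∧ y.chamber.proj x.face = x.chamber
  le_refl x := ⟨le_rfl, by
    ext k
    change (if x.face.sgn k = 0 then x.chamber.sgn k else x.face.sgn k) = x.chamber.sgn k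
    split_ifs with h
    · rfl
    · exact (x.le k).resolve_left h⟩
  le_trans x y z h₁ h₂ := ⟨h₂.1.trans h₁.1, by
    rw [← h₁.2, ← h₂.2]
    ext k
    change (if x.face.sgn k = 0 then z.chamber.sgn k else x.face.sgn k) =
      (if x.face.sgn k = 0 then (if y.face.sgn k = 0 then z.chamber.sgn k else y.face.sgn k)
        else x.face.sgn k)
    split_ifs with h h'
    · rfl
    · rcases h₁.1 k with h0 | h0
      · exact absurd h0 h'
      · exact absurd (h0.trans h) h'
    · rfl⟩
  le_antisymm x y h₁ h₂ := by
    have hf : x.face = y.face := le_antisymm h₂.1 h₁.1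
    refine SalPoset.ext hf ?_
    rw [← h₁.2, hf]
    ext k
    change (if y.face.sgn k = 0 then y.chamber.sgn k else y.face.sgn k) = y.chamber.sgn k
    split_ifs with h
    · rfl
    · exact (y.le k).resolve_left h

theorem le_def {x y : A.SalPoset} :
    x ≤ y ↔ y.face ≤ x.face ∧ y.chamber.proj x.face = x.chamber := Iff.rfl

/-- A map of faces that respects chambers, the order and the operation `F_G` induces a map of
Salvetti posets. -/
def map (φ : A.Face → B.Face) (h₁ : ∀ C, C.IsChamber → (φ C).IsChamber)
    (h₂ : ∀ F G, F ≤ G → φ F ≤ φ G) (h₃ : ∀ F G, φ (F.proj G) = (φ F).proj (φ G)) :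
    A.SalPoset →o B.SalPoset where
  toFun x := ⟨φ x.face, φ x.chamber, h₁ _ x.isChamber, h₂ _ _ x.le⟩
  monotone' x y h := ⟨h₂ _ _ h.1, by
    change (φ y.chamber).proj (φ x.face) = φ x.chamber
    rw [← h₃, h.2]⟩

/-- The map of Salvetti posets induced by `Face.pull`. -/
def pull (e : κ' → κ) (p : V → V') (h : ∀ v k, B.sgn (p v) k = A.sgn v (e k)) :
    A.SalPoset →o B.SalPoset :=
  map (Face.pull e p h) (fun _ hC k => hC (e k)) (fun _ _ hF k => hF (e k))
    (fun _ _ => rfl)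

/-- The element `[C, C]`. -/
def vertex (C : A.Face) (hC : C.IsChamber) : A.SalPoset := ⟨C, C, hC, le_rfl⟩

/-- The element `[G, C_G]`. -/
def ofProj (G C : A.Face) (hC : C.IsChamber) : A.SalPoset where
  face := G
  chamber := C.proj G
  isChamber k := by
    change (if G.sgn k = 0 then C.sgn k else G.sgn k) ≠ 0
    split_ifs with h
    · exact hC k
    · exact h
  le k := by
    change _ ∨ _ = (if G.sgn k = 0 then C.sgn k else G.sgn k)
    split_ifs with h
    · exact Or.inl h
    · exact Or.inr rfl

end SalPoset

/-- A gallery `C 0, ..., C k`: a sequence of chambers in which consecutive ones share a wall. -/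
def IsGallery (A : RealArr κ V) (k : ℕ) (C : Fin (k + 1) → A.Face) : Prop :=
  (∀ i, (C i).IsChamber) ∧
    ∀ i : Fin k, ∃ W : A.Face, W.IsWall (C i.castSucc) ∧ W.IsWall (C i.succ)

/-- A gallery of minimal length among those with the same ends. -/
def IsMinimalGallery (A : RealArr κ V) (k : ℕ) (C : Fin (k + 1) → A.Face) : Prop :=
  A.IsGallery k C ∧ ∀ (k' : ℕ) (C' : Fin (k' + 1) → A.Face), A.IsGallery k' C' →
    C' 0 = C 0 → C' (Fin.last k') = C (Fin.last k) → k ≤ k'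

/-- `D` is the chamber opposite to the chamber `C` with respect to the subspace `X`. -/
def IsOpposite [TopologicalSpace V] (A : RealArr κ V) (X : Submodule ℝ V) (C D : A.Face) : Prop :=
  C.IsChamber ∧ D.IsChamber ∧
    closure C.carrier ∩ (X : Set V) = closure D.carrier ∩ (X : Set V) ∧
    ∀ k, C.sgn k ≠ D.sgn k ↔ X ≤ LinearMap.ker (A.form k)

end RealArr

/-! ### Tori -/

/-- The complex torus `T = Hom(Λ, ℂˣ)` with character lattice `Λ`, as a topological subgroup of
the product `Λ → ℂˣ`. For `Λ` free of rank `d` it is isomorphic to `(ℂˣ) ^ d`. -/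
def torusSubgroup (Λ : Type) [AddCommGroup Λ] : Subgroup (Λ → ℂˣ) where
  carrier := {t | ∀ χ ψ, t (χ + ψ) = t χ * t ψ}
  mul_mem' {s t} hs ht χ ψ := by
    simp only [Pi.mul_apply, hs χ ψ, ht χ ψ]
    exact mul_mul_mul_comm _ _ _ _
  one_mem' χ ψ := by simp
  inv_mem' {s} hs χ ψ := by
    simp only [Pi.inv_apply, hs χ ψ, mul_inv]

/-- The complex torus with character lattice `Λ`. -/
abbrev Torus (Λ : Type) [AddCommGroup Λ] : Type := torusSubgroup Λ

/-- The universal cover `Hom(Λ, ℝ)` of the compact torus `Hom(Λ, S¹)`, which is also the tangent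
space at each of its points, as a topological subspace of `Λ → ℝ`. -/
def realSubmodule (Λ : Type) [AddCommGroup Λ] : Submodule ℝ (Λ → ℝ) where
  carrier := {v | ∀ χ ψ, v (χ + ψ) = v χ + v ψ}
  add_mem' {v w} hv hw χ ψ := by
    simp only [Pi.add_apply, hv χ ψ, hw χ ψ]; ring
  zero_mem' χ ψ := by simp
  smul_mem' c v hv χ ψ := by
    simp only [Pi.smul_apply, hv χ ψ, smul_add]

/-- The universal cover of the compact torus. -/
abbrev RealSpace (Λ : Type) [AddCommGroup Λ] : Type := realSubmodule Λ

section Tori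

variable {Λ : Type} [AddCommGroup Λ]

/-- The linear form on `Hom(Λ, ℝ)` defined by a character. -/
def evalForm (χ : Λ) : RealSpace Λ →ₗ[ℝ] ℝ := LinearMap.proj χ ∘ₗ (realSubmodule Λ).subtype

@[simp] theorem evalForm_apply (χ : Λ) (v : RealSpace Λ) : evalForm χ v = v.1 χ := rfl

/-- `x ↦ exp (2 π i x)`. -/
def circ (x : ℝ) : Circle := Circle.exp (2 * Real.pi * x)

theorem circ_add (x y : ℝ) : circ (x + y) = circ x * circ y := by
  simp [circ, mul_add]

theorem circ_sub (x y : ℝ) : circ (x - y) = circ x / circ y := by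
  simp [circ, mul_sub]

theorem circ_eq_one {x : ℝ} (h : circ x = 1) : ∃ n : ℤ, x = n := by
  obtain ⟨n, hn⟩ := Circle.exp_eq_one.1 h
  refine ⟨n, ?_⟩
  have : (2 * Real.pi) ≠ 0 := by positivity
  apply mul_left_cancel₀ this
  rw [hn]; ring

theorem circ_int (n : ℤ) : circ n = 1 := by
  simp only [circ]
  exact Circle.exp_two_pi_mul_int n

theorem toUnits_injective : Function.Injective Circle.toUnits := unitSphereToUnits_injective

/-- The covering `Hom(Λ, ℝ) → Hom(Λ, S¹) ⊆ T`, `v ↦ exp (2 π i v)`. -/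
def expMap (v : RealSpace Λ) : Torus Λ :=
  ⟨fun χ => Circle.toUnits (circ (v.1 χ)), fun χ ψ => by
    dsimp only
    rw [v.2 χ ψ, circ_add, map_mul]⟩

/-- The group of deck transformations (translations) of the covering `expMap`. -/
def deck (Λ : Type) [AddCommGroup Λ] : AddSubgroup (RealSpace Λ) where
  carrier := {l | ∀ χ, circ (l.1 χ) = 1}
  add_mem' {l l'} h h' χ := by
    rw [Submodule.coe_add, Pi.add_apply, circ_add, h, h', mul_one]
  zero_mem' χ := by simp [circ]
  neg_mem' {l} h χ := by
    have h1 := h χ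
    rw [Submodule.coe_neg, Pi.neg_apply, ← zero_sub, circ_sub, h1]
    simp [circ]

theorem expMap_add_deck (v : RealSpace Λ) (l : deck Λ) : expMap (v + l.1) = expMap v := by
  ext χ
  have h : circ (v.1 χ + l.1.1 χ) = circ (v.1 χ) := by rw [circ_add, l.2 χ, mul_one]
  change ((Circle.toUnits (circ (v.1 χ + l.1.1 χ)) : ℂˣ) : ℂ) = (Circle.toUnits (circ (v.1 χ)) : ℂˣ)
  rw [h]

theorem sub_mem_deck {v w : RealSpace Λ} (h : expMap v = expMap w) : v - w ∈ deck Λ := by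
  intro χ
  have h1 : Circle.toUnits (circ (v.1 χ)) = Circle.toUnits (circ (w.1 χ)) :=
    congrFun (congrArg Subtype.val h) χ
  have h2 := toUnits_injective h1
  rw [AddSubgroupClass.coe_sub, Pi.sub_apply, circ_sub, h2, div_self']

/-- Restriction of characters to a subgroup, on universal covers. -/
def resReal (S : AddSubgroup Λ) (v : RealSpace Λ) : RealSpace S :=
  ⟨fun χ => v.1 χ, fun χ ψ => v.2 χ ψ⟩

/-- Restriction of characters to a subgroup, on tori. -/
def resTorus (S : AddSubgroup Λ) (t : Torus Λ) : Torus S :=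
  ⟨fun χ => t.1 χ, fun χ ψ => t.2 χ ψ⟩

theorem resTorus_expMap (S : AddSubgroup Λ) (v : RealSpace Λ) :
    resTorus S (expMap v) = expMap (resReal S v) := rfl

/-- Restriction of characters to a subgroup, on deck transformations. -/
def resDeck (S : AddSubgroup Λ) (l : deck Λ) : deck S := ⟨resReal S l.1, fun χ => l.2 χ⟩

end Tori

/-! ### Toric arrangements, layers, faces -/

/-- A complexified toric arrangement in the torus with character lattice `Λ`: a family of level
sets `{t | t (char i) = val i}` of nontrivial characters, at values of modulus one. -/
structure ToricArr (Λ ι : Type) [AddCommGroup Λ] where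
  char : ι → Λ
  char_ne : ∀ i, char i ≠ 0
  val : ι → Circle

namespace ToricArr

variable {Λ ι : Type} [AddCommGroup Λ] (A : ToricArr Λ ι)

/-- The members of the arrangement. -/
def hyp (i : ι) : Set (Torus Λ) := {t | t.1 (A.char i) = Circle.toUnits (A.val i)}

/-- A layer is a connected component of an intersection of members (the empty intersection being
the whole torus). -/
def IsLayer (S : Set (Torus Λ)) : Prop :=
  ∃ (s : Set ι) (t : Torus Λ), t ∈ ⋂ i ∈ s, A.hyp i ∧
    S = connectedComponentIn (⋂ i ∈ s, A.hyp i) t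

/-- The type of layers. -/
structure Layer where
  carrier : Set (Torus Λ)
  isLayer : A.IsLayer carrier

variable {A} in
theorem Layer.nonempty (L : A.Layer) : L.carrier.Nonempty := by
  obtain ⟨s, t, ht, h⟩ := L.isLayer
  exact ⟨t, h ▸ mem_connectedComponentIn ht⟩

/-- The arrangement `A₀` of linear hyperplanes in the tangent space. -/
def zero : RealArr ι (RealSpace Λ) := RealArr.central fun i => evalForm (A.char i)

/-- The linear subspace `X_L`: the intersection of the hyperplanes of `A₀` that are associated to
members containing `L`. Its dimension is the dimension of the layer `L`. -/
def tangent (L : Set (Torus Λ)) : Submodule ℝ (RealSpace Λ) :=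
  ⨅ i : {i // L ⊆ A.hyp i}, LinearMap.ker (A.zero.form i)

/-- The arrangement is essential if all layers that are minimal under inclusion have
dimension 0. -/
def IsEssential : Prop :=
  ∀ L : A.Layer, (∀ L' : A.Layer, L'.carrier ⊆ L.carrier → L'.carrier = L.carrier) →
    Module.finrank ℝ (A.tangent L.carrier) = 0

/-- The hyperplanes `v (char i) = θ`, with `exp (2 π i θ) = val i`, of the lifted arrangement. -/
abbrev LiftIdx : Type := {p : ι × ℝ // circ p.2 = A.val p.1}

/-- The lift of the arrangement to the universal cover of the compact torus. -/
def lifted : RealArr A.LiftIdx (RealSpace Λ) :=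
  ⟨fun p => evalForm (A.char p.1.1), fun p => p.1.2⟩

/-- Faces of the lifted arrangement. -/
abbrev LFace : Type := A.lifted.Face

variable {A} in
/-- Translation by deck transformations on faces of the lifted arrangement. -/
instance : AddAction (deck Λ) A.LFace where
  vadd l F :=
    { sgn := fun p => F.sgn ⟨(p.1.1, p.1.2 - l.1.1 (A.char p.1.1)), by
        rw [circ_sub, l.2, div_one]; exact p.2⟩
      realized := by
        obtain ⟨v, hv⟩ := F.realized
        refine ⟨v + l.1, funext fun p => ?_⟩
        rw [← hv]
        simp only [RealArr.sgn, lifted, evalForm_apply, Submodule.coe_add, Pi.add_apply]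
        congr 1; ring }
  zero_vadd F := by
    ext p
    change F.sgn ⟨(p.1.1, p.1.2 - 0), _⟩ = F.sgn p
    congr 1
    ext <;> simp
  add_vadd l l' F := by
    ext p
    change F.sgn ⟨(p.1.1, p.1.2 - (l.1.1 _ + l'.1.1 _)), _⟩ =
      F.sgn ⟨(p.1.1, p.1.2 - l.1.1 _ - l'.1.1 _), _⟩
    congr 1
    ext
    · rfl
    · dsimp only; ring

variable {A}

theorem mem_vadd {l : deck Λ} {F : A.LFace} {v : RealSpace Λ} (hv : v ∈ F.carrier) :
    v + l.1 ∈ (l +ᵥ F).carrier := by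
  change A.lifted.sgn (v + l.1) = _
  funext p
  change _ = F.sgn _
  rw [← (show A.lifted.sgn v = F.sgn from hv)]
  simp only [RealArr.sgn, lifted, evalForm_apply, Submodule.coe_add, Pi.add_apply]
  congr 1; ring

theorem eq_of_mem {F G : A.LFace} {v : RealSpace Λ} (h : v ∈ F.carrier) (h' : v ∈ G.carrier) :
    F = G := RealArr.Face.ext ((show A.lifted.sgn v = F.sgn from h).symm.trans h')

theorem exists_level (i : ι) : ∃ θ : ℝ, circ θ = A.val i := by
  obtain ⟨x, hx⟩ := Circle.exp_surjective (A.val i)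
  refine ⟨x / (2 * Real.pi), ?_⟩
  rw [← hx, circ]
  congr 1
  have : Real.pi ≠ 0 := Real.pi_ne_zero
  field_simp

theorem stab_aux {l : deck Λ} {F : A.LFace} (h : l +ᵥ F = F) (i : ι) :
    ¬ 0 < l.1.1 (A.char i) := by
  intro hpos
  obtain ⟨n, hn⟩ := circ_eq_one (l.2 (A.char i))
  have hn1 : (1 : ℝ) ≤ l.1.1 (A.char i) := by
    rw [hn] at hpos ⊢
    have : 0 < n := by exact_mod_cast hpos
    exact_mod_cast this
  obtain ⟨θ, hθ⟩ := A.exists_level i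
  obtain ⟨x, hx⟩ := F.realized
  have hxl : A.lifted.sgn (x + l.1) = F.sgn := by
    have := mem_vadd (l := l) (show x ∈ F.carrier from hx)
    rw [h] at this
    exact this
  have hth : circ (θ + ⌈x.1 (A.char i) - θ⌉) = A.val i := by
    rw [circ_add, circ_int, mul_one, hθ]
  have e := congrFun (hxl.trans hx.symm) ⟨(i, θ + ⌈x.1 (A.char i) - θ⌉), hth⟩
  simp only [RealArr.sgn, lifted, evalForm_apply, Submodule.coe_add, Pi.add_apply] at e
  have h1 := Int.le_ceil (x.1 (A.char i) - θ)
  have h2 := Int.ceil_lt_add_one (x.1 (A.char i) - θ)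
  rw [sign_pos (by linarith)] at e
  have := sign_eq_one_iff.1 e.symm
  linarith

/-- A deck transformation that fixes one face fixes all faces. -/
theorem stab {l : deck Λ} {F : A.LFace} (h : l +ᵥ F = F) (G : A.LFace) : l +ᵥ G = G := by
  have h' : (-l) +ᵥ F = F := by
    rw [neg_vadd_eq_iff, h]
  have hz : ∀ i, l.1.1 (A.char i) = 0 := fun i => by
    have h1 := stab_aux h i
    have h2 := stab_aux h' i
    have h3 : (-l).1.1 (A.char i) = - l.1.1 (A.char i) := rfl
    rw [h3] at h2
    linarith
  ext p
  change G.sgn ⟨(p.1.1, p.1.2 - l.1.1 _), _⟩ = G.sgn p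
  congr 1
  ext
  · rfl
  · dsimp only; rw [hz, sub_zero]

/-- The image in the (compact) torus of a face of the lifted arrangement. -/
def LFace.image (F : A.LFace) : Set (Torus Λ) := expMap '' RealArr.Face.carrier F

theorem image_vadd (l : deck Λ) (F : A.LFace) : LFace.image (l +ᵥ F) = LFace.image F := by
  have key : ∀ (l : deck Λ) (F : A.LFace), LFace.image F ⊆ LFace.image (l +ᵥ F) := by
    rintro l F _ ⟨v, hv, rfl⟩
    exact ⟨v + l.1, mem_vadd hv, expMap_add_deck v l⟩
  refine Set.Subset.antisymm ?_ (key l F)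
  have := key (-l) (l +ᵥ F)
  rwa [neg_vadd_vadd] at this

theorem exists_vadd {F G : A.LFace} (h : LFace.image F = LFace.image G) :
    ∃ l : deck Λ, l +ᵥ F = G := by
  obtain ⟨v, hv⟩ := F.realized
  have : expMap v ∈ LFace.image G := h ▸ ⟨v, hv, rfl⟩
  obtain ⟨w, hw, e⟩ := this
  refine ⟨⟨w - v, sub_mem_deck e⟩, eq_of_mem (v := w) ?_ hw⟩
  have := mem_vadd (l := ⟨w - v, sub_mem_deck e⟩) (show v ∈ F.carrier from hv)
  simpa using this

variable (A)

/-- The faces of the induced cellularization of the compact torus: objects of the face category. -/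
@[ext] structure TFace where
  carrier : Set (Torus Λ)
  exists_lift : ∃ F : A.LFace, LFace.image F = carrier

variable {A}

/-- Morphisms `F ⟶ G` of the face category: orbits, under deck transformations, of pairs `a ≤ b`
of lifts of `F` and `G`. -/
@[ext] structure FaceHom (F G : A.TFace) where
  rel : Set (A.LFace × A.LFace)
  exists_rep : ∃ a b : A.LFace, LFace.image a = F.carrier ∧ LFace.image b = G.carrier ∧ a ≤ b ∧
    rel = AddAction.orbit (deck Λ) (a, b)

theorem mem_orbit_pair {a b c d : A.LFace} :
    (c, d) ∈ AddAction.orbit (deck Λ) (a, b) ↔ ∃ l : deck Λ, l +ᵥ a = c ∧ l +ᵥ b = d := by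
  constructor
  · rintro ⟨l, hl⟩
    exact ⟨l, congrArg Prod.fst hl, congrArg Prod.snd hl⟩
  · rintro ⟨l, rfl, rfl⟩
    exact ⟨l, rfl⟩

theorem vadd_le (l : deck Λ) {a b : A.LFace} (h : a ≤ b) : l +ᵥ a ≤ l +ᵥ b := fun _ => h _

theorem orbit_comp {a b b' c : A.LFace} (h : LFace.image b = LFace.image b') :
    ∃ l : deck Λ, l +ᵥ b' = b ∧
    ({p | ∃ q, (p.1, q) ∈ AddAction.orbit (deck Λ) (a, b) ∧
      (q, p.2) ∈ AddAction.orbit (deck Λ) (b', c)} : Set (A.LFace × A.LFace)) = AddAction.orbit (deck Λ) (a, l +ᵥ c) := by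
  obtain ⟨l, hl⟩ := exists_vadd h.symm
  refine ⟨l, hl, ?_⟩
  ext ⟨x, z⟩
  simp only [Set.mem_ofPred_eq, mem_orbit_pair]
  constructor
  · rintro ⟨q, ⟨g, rfl, rfl⟩, ⟨g', h1, rfl⟩⟩
    refine ⟨g, rfl, ?_⟩
    rw [← hl] at h1
    have h2 : (-g' + g + l) +ᵥ b' = b' := by
      rw [add_vadd, add_vadd, ← h1, neg_vadd_vadd]
    have h3 := stab h2 c
    rw [add_vadd, add_vadd, neg_vadd_eq_iff] at h3
    exact h3
  · rintro ⟨g, rfl, rfl⟩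
    exact ⟨g +ᵥ b, ⟨g, rfl, rfl⟩, ⟨g + l, by rw [add_vadd, hl], by rw [add_vadd]⟩⟩

/-- The face category: the quotient of the poset of faces of the lifted arrangement by the group of
deck transformations. -/
instance : Category A.TFace where
  Hom F G := FaceHom F G
  id F := ⟨AddAction.orbit (deck Λ) (F.exists_lift.choose, F.exists_lift.choose),
    _, _, F.exists_lift.choose_spec, F.exists_lift.choose_spec, le_rfl, rfl⟩
  comp {F G K} m n := ⟨{p | ∃ q, (p.1, q) ∈ m.rel ∧ (q, p.2) ∈ n.rel}, by
    obtain ⟨a, b, ha, hb, hab, hm⟩ := m.exists_rep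
    obtain ⟨b', c, hb', hc, hbc, hn⟩ := n.exists_rep
    obtain ⟨l, hl, h⟩ := orbit_comp (a := a) (c := c) (hb.trans hb'.symm)
    refine ⟨a, l +ᵥ c, ha, (image_vadd l c).trans hc, hab.trans (hl ▸ vadd_le l hbc), ?_⟩
    rw [hm, hn, h]⟩
  id_comp {F G} m := by
    obtain ⟨a, b, ha, hb, hab, hm⟩ := m.exists_rep
    apply FaceHom.ext
    change ({p | ∃ q, (p.1, q) ∈ AddAction.orbit (deck Λ) _ ∧
      (q, p.2) ∈ m.rel} : Set (A.LFace × A.LFace)) = m.rel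
    rw [hm]
    obtain ⟨l, hl, h⟩ := orbit_comp (a := F.exists_lift.choose) (b := F.exists_lift.choose)
      (c := b) (F.exists_lift.choose_spec.trans ha.symm)
    rw [h, ← hl]
    exact AddAction.orbit_eq_iff.2 ⟨l, rfl⟩
  comp_id {F G} m := by
    obtain ⟨a, b, ha, hb, hab, hm⟩ := m.exists_rep
    apply FaceHom.ext
    change ({p | ∃ q, (p.1, q) ∈ m.rel ∧
      (q, p.2) ∈ AddAction.orbit (deck Λ) _} : Set (A.LFace × A.LFace)) = m.rel
    rw [hm]
    obtain ⟨l, hl, h⟩ := orbit_comp (a := a) (b := b) (b' := G.exists_lift.choose)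
      (c := G.exists_lift.choose) (hb.trans G.exists_lift.choose_spec.symm)
    rw [h, hl]
  assoc m n o := by
    apply FaceHom.ext
    ext ⟨x, z⟩
    constructor
    · rintro ⟨q, ⟨q', h1, h2⟩, h3⟩
      exact ⟨q', h1, q, h2, h3⟩
    · rintro ⟨q', h1, q, h2, h3⟩
      exact ⟨q, ⟨q', h1, h2⟩, h3⟩

theorem comp_rel {F G K : A.TFace} (m : F ⟶ G) (n : G ⟶ K) :
    (m ≫ n).rel = {p | ∃ q, (p.1, q) ∈ m.rel ∧ (q, p.2) ∈ n.rel} := rfl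

theorem rel_spec {F G : A.TFace} (m : F ⟶ G) {a b : A.LFace} (h : (a, b) ∈ m.rel) :
    LFace.image a = F.carrier ∧ LFace.image b = G.carrier ∧ a ≤ b ∧
      m.rel = AddAction.orbit (deck Λ) (a, b) := by
  obtain ⟨a', b', ha, hb, hab, hm⟩ := m.exists_rep
  rw [hm] at h
  have e := AddAction.orbit_eq_iff.2 h
  obtain ⟨l, rfl, rfl⟩ := mem_orbit_pair.1 h
  exact ⟨(image_vadd _ _).trans ha, (image_vadd _ _).trans hb, vadd_le l hab, hm.trans e.symm⟩

theorem exists_mem_rel {F G : A.TFace} (m : F ⟶ G) : ∃ a b, (a, b) ∈ m.rel := by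
  obtain ⟨a, b, -, -, -, hm⟩ := m.exists_rep
  exact ⟨a, b, hm ▸ AddAction.mem_orbit_self _⟩

theorem id_rel {F : A.TFace} {a b : A.LFace} (h : (a, b) ∈ FaceHom.rel (𝟙 F)) : a = b := by
  obtain ⟨l, h1, h2⟩ := mem_orbit_pair.1
    (show (a, b) ∈ AddAction.orbit (deck Λ) (F.exists_lift.choose, F.exists_lift.choose) from h)
  exact h1.symm.trans h2

end ToricArr

namespace ToricArr

variable {Λ ι : Type} [AddCommGroup Λ] {A : ToricArr Λ ι}

/-! ### Local arrangements and the toric Salvetti category -/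

/-- Indices of the members that contain the face `F`. -/
abbrev LocIdx (F : A.TFace) : Type := {i // F.carrier ⊆ A.hyp i}

/-- The arrangement `A[F]` of linear hyperplanes in the tangent space at a point of `F`. -/
def loc (F : A.TFace) : RealArr (LocIdx F) (RealSpace Λ) :=
  RealArr.central fun i => evalForm (A.char i.1)

theorem level_of_mem {a : A.LFace} {S : Set (Torus Λ)} (ha : LFace.image a = S)
    {x : RealSpace Λ} (hx : x ∈ a.carrier) {i : ι} (hi : S ⊆ A.hyp i) :
    circ (x.1 (A.char i)) = A.val i :=
  toUnits_injective (hi (ha ▸ ⟨x, hx, rfl⟩ : expMap x ∈ S))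

theorem sgn_of_mem {a : A.LFace} {x : RealSpace Λ} (hx : x ∈ a.carrier) (p : A.LiftIdx) :
    a.sgn p = SignType.sign (x.1 (A.char p.1.1) - p.1.2) :=
  (congrFun (show A.lifted.sgn x = a.sgn from hx) p).symm

theorem eq_of_sgn_zero {a : A.LFace} {x : RealSpace Λ} (hx : x ∈ a.carrier) (p : A.LiftIdx)
    (h : a.sgn p = 0) : x.1 (A.char p.1.1) = p.1.2 := by
  rw [sgn_of_mem hx, sign_eq_zero_iff] at h
  exact sub_eq_zero.1 h

theorem subset_hyp_of_sgn_zero {a : A.LFace} {S : Set (Torus Λ)} (ha : LFace.image a = S)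
    (p : A.LiftIdx) (h : a.sgn p = 0) : S ⊆ A.hyp p.1.1 := by
  rw [← ha]
  rintro _ ⟨x, hx, rfl⟩
  change Circle.toUnits (circ (x.1 (A.char p.1.1))) = _
  rw [eq_of_sgn_zero hx p h, p.2]

/-- The sign with which a morphism leaves a hyperplane does not depend on choices. -/
theorem sign_sub_eq {F G : A.TFace} (m : F ⟶ G) {a b a' b' : A.LFace} (h : (a, b) ∈ m.rel)
    (h' : (a', b') ∈ m.rel) {x y x' y' : RealSpace Λ} (hx : x ∈ a.carrier) (hy : y ∈ b.carrier)
    (hx' : x' ∈ a'.carrier) (hy' : y' ∈ b'.carrier) (i : LocIdx F) :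
    SignType.sign (y.1 (A.char i.1) - x.1 (A.char i.1)) =
      SignType.sign (y'.1 (A.char i.1) - x'.1 (A.char i.1)) := by
  obtain ⟨ha, -, -, hm⟩ := rel_spec m h
  obtain ⟨ha', -, -, -⟩ := rel_spec m h'
  rw [hm] at h'
  obtain ⟨l, rfl, rfl⟩ := mem_orbit_pair.1 h'
  have hp' := level_of_mem ha' hx' i.2
  let p' : A.LiftIdx := ⟨(i.1, x'.1 (A.char i.1)), hp'⟩
  have e2 := sgn_of_mem hy' p'
  have e1 := sgn_of_mem (mem_vadd (l := l) hy) p'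
  have z : (l +ᵥ a).sgn p' = 0 := by rw [sgn_of_mem hx' p']; simp [p']
  have e0 := eq_of_sgn_zero (mem_vadd (l := l) hx) p' z
  have e0' : x.1 (A.char i.1) + l.1.1 (A.char i.1) = x'.1 (A.char i.1) := e0
  rw [e2] at e1
  have e1' : SignType.sign (y'.1 (A.char i.1) - x'.1 (A.char i.1)) =
    SignType.sign (y.1 (A.char i.1) + l.1.1 (A.char i.1) - x'.1 (A.char i.1)) := e1
  rw [e1', ← e0']
  congr 1
  ring

theorem exists_points {F G : A.TFace} (m : F ⟶ G) :
    ∃ (p : A.LFace × A.LFace) (x y : RealSpace Λ),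
      p ∈ m.rel ∧ x ∈ p.1.carrier ∧ y ∈ p.2.carrier := by
  obtain ⟨a, b, h⟩ := exists_mem_rel m
  obtain ⟨x, hx⟩ := a.realized
  obtain ⟨y, hy⟩ := b.realized
  exact ⟨(a, b), x, y, h, hx, hy⟩

/-- The face `F_m` of `A[F]` attached to a morphism `m : F ⟶ G`: the direction in which one leaves
`F` when entering `G` through `m`. -/
def dir {F G : A.TFace} (m : F ⟶ G) : (loc F).Face :=
  RealArr.Face.ofPoint (loc F)
    ((exists_points m).choose_spec.choose_spec.choose - (exists_points m).choose_spec.choose)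

theorem dir_sgn {F G : A.TFace} (m : F ⟶ G) {a b : A.LFace} (h : (a, b) ∈ m.rel)
    {x y : RealSpace Λ} (hx : x ∈ a.carrier) (hy : y ∈ b.carrier) (i : LocIdx F) :
    (dir m).sgn i = SignType.sign (y.1 (A.char i.1) - x.1 (A.char i.1)) := by
  obtain ⟨h1, h2, h3⟩ := (exists_points m).choose_spec.choose_spec.choose_spec
  rw [← sign_sub_eq m h1 h h2 h3 hx hy i]
  simp [dir, RealArr.Face.ofPoint, RealArr.sgn, loc, RealArr.central]

theorem subset_of_hom {F G : A.TFace} (m : F ⟶ G) {i : ι} (h : G.carrier ⊆ A.hyp i) :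
    F.carrier ⊆ A.hyp i := by
  obtain ⟨⟨a, b⟩, x, y, hm, hx, hy⟩ := exists_points m
  obtain ⟨ha, hb, hab, -⟩ := rel_spec m hm
  have hp := level_of_mem hb hy h
  let p : A.LiftIdx := ⟨(i, y.1 (A.char i)), hp⟩
  have z : b.sgn p = 0 := by rw [sgn_of_mem hy p]; simp [p]
  have z' : a.sgn p = 0 := by
    rcases hab p with h | h
    · exact h
    · exact h.trans z
  exact subset_hyp_of_sgn_zero ha p z'

theorem dir_eq_zero {F G : A.TFace} (m : F ⟶ G) (i : LocIdx F) :
    (dir m).sgn i = 0 ↔ G.carrier ⊆ A.hyp i.1 := by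
  obtain ⟨⟨a, b⟩, x, y, hm, hx, hy⟩ := exists_points m
  obtain ⟨ha, hb, hab, -⟩ := rel_spec m hm
  have hp := level_of_mem ha hx i.2
  let p : A.LiftIdx := ⟨(i.1, x.1 (A.char i.1)), hp⟩
  have e : (dir m).sgn i = b.sgn p := by rw [dir_sgn m hm hx hy, sgn_of_mem hy p]
  rw [e]
  constructor
  · exact fun h => subset_hyp_of_sgn_zero hb p h
  · intro h
    have hq := level_of_mem hb hy h
    let q : A.LiftIdx := ⟨(i.1, y.1 (A.char i.1)), hq⟩
    have z : b.sgn q = 0 := by rw [sgn_of_mem hy q]; simp [q]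
    have z' : a.sgn q = 0 := by
      rcases hab q with h | h
      · exact h
      · exact h.trans z
    have : x.1 (A.char i.1) = y.1 (A.char i.1) := eq_of_sgn_zero hx q z'
    rw [sgn_of_mem hy p]
    simp [p, this]

variable [Finite ι]

open Classical in
/-- The inclusion `i_m : F(A[G]) → F(A[F])` defined by a morphism `m : F ⟶ G`. -/
def iMap {F G : A.TFace} (m : F ⟶ G) (K : (loc G).Face) : (loc F).Face where
  sgn i := if h : G.carrier ⊆ A.hyp i.1 then K.sgn ⟨i.1, h⟩ else (dir m).sgn i
  realized := by
    obtain ⟨u, hu⟩ := (dir m).realized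
    obtain ⟨k, hk⟩ := K.realized
    obtain ⟨ε, -, -, h⟩ := RealArr.perturb (fun i : LocIdx F => (loc F).form i u)
      (fun i => (loc F).form i k)
    refine ⟨(1 - ε) • u + ε • k, funext fun i => ?_⟩
    have e : (loc F).form i ((1 - ε) • u + ε • k) - (loc F).level i =
        (1 - ε) * (loc F).form i u + ε * (loc F).form i k := by
      simp [loc, RealArr.central]
    have hz : (loc F).form i u = 0 ↔ G.carrier ⊆ A.hyp i.1 := by
      rw [← dir_eq_zero m i, ← hu]
      simp [RealArr.sgn, loc, RealArr.central]
    unfold RealArr.sgn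
    rw [e, h i]
    by_cases hG : G.carrier ⊆ A.hyp i.1
    · rw [if_pos (hz.2 hG), dif_pos hG, ← hk]
      simp [RealArr.sgn, loc, RealArr.central]
    · rw [if_neg (fun h => hG (hz.1 h)), dif_neg hG, ← hu]
      simp [RealArr.sgn, loc, RealArr.central]

theorem iMap_sgn_pos {F G : A.TFace} (m : F ⟶ G) (K : (loc G).Face) (i : LocIdx F)
    (h : G.carrier ⊆ A.hyp i.1) : (iMap m K).sgn i = K.sgn ⟨i.1, h⟩ := dif_pos h

theorem iMap_sgn_neg {F G : A.TFace} (m : F ⟶ G) (K : (loc G).Face) (i : LocIdx F)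
    (h : ¬ G.carrier ⊆ A.hyp i.1) : (iMap m K).sgn i = (dir m).sgn i := dif_neg h

theorem iMap_id (F : A.TFace) (K : (loc F).Face) : iMap (𝟙 F) K = K := by
  ext i
  rw [iMap_sgn_pos _ _ _ i.2]

theorem iMap_comp {F G H : A.TFace} (m : F ⟶ G) (n : G ⟶ H) (K : (loc H).Face) :
    iMap (m ≫ n) K = iMap m (iMap n K) := by
  ext i
  by_cases hH : H.carrier ⊆ A.hyp i.1
  · rw [iMap_sgn_pos _ _ _ hH, iMap_sgn_pos _ _ _ (subset_of_hom n hH),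
      iMap_sgn_pos n K ⟨i.1, subset_of_hom n hH⟩ hH]
  · obtain ⟨⟨a, c⟩, x, z, hmn, hx, hz⟩ := exists_points (m ≫ n)
    obtain ⟨b, hab, hbc⟩ := hmn
    obtain ⟨y, hy⟩ := b.realized
    have hmn : (a, c) ∈ FaceHom.rel (m ≫ n) := ⟨b, hab, hbc⟩
    obtain ⟨ha, hb, hle, -⟩ := rel_spec m hab
    obtain ⟨-, hc, hle', -⟩ := rel_spec n hbc
    rw [iMap_sgn_neg _ _ _ hH, dir_sgn _ hmn hx hz]
    have hp := level_of_mem ha hx i.2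
    let p : A.LiftIdx := ⟨(i.1, x.1 (A.char i.1)), hp⟩
    by_cases hG : G.carrier ⊆ A.hyp i.1
    · rw [iMap_sgn_pos _ _ _ hG, iMap_sgn_neg n K ⟨i.1, hG⟩ hH, dir_sgn n hbc hy hz]
      have : y.1 (A.char i.1) = x.1 (A.char i.1) := by
        have h0 := (dir_eq_zero m i).2 hG
        rw [dir_sgn m hab hx hy, sign_eq_zero_iff] at h0
        exact sub_eq_zero.1 h0
      simp [this]
    · rw [iMap_sgn_neg _ _ _ hG, dir_sgn m hab hx hy]
      have hb0 : b.sgn p ≠ 0 := fun h => hG (subset_hyp_of_sgn_zero hb p h)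
      have h1 : b.sgn p = c.sgn p := (hle' p).resolve_left hb0
      rw [sgn_of_mem hy p, sgn_of_mem hz p] at h1
      exact h1.symm

/-- The map of Salvetti posets `S(A[G]) → S(A[F])` defined by a morphism `m : F ⟶ G`. -/
def salMap {F G : A.TFace} (m : F ⟶ G) : (loc G).SalPoset →o (loc F).SalPoset :=
  RealArr.SalPoset.map (iMap m)
    (fun C hC i => by
      by_cases h : G.carrier ⊆ A.hyp i.1
      · rw [iMap_sgn_pos _ _ _ h]; exact hC _
      · rw [iMap_sgn_neg _ _ _ h]; exact fun h0 => h ((dir_eq_zero m i).1 h0))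
    (fun K K' hK i => by
      by_cases h : G.carrier ⊆ A.hyp i.1
      · rw [iMap_sgn_pos _ _ _ h, iMap_sgn_pos _ _ _ h]; exact hK _
      · rw [iMap_sgn_neg _ _ _ h, iMap_sgn_neg _ _ _ h]; exact Or.inr rfl)
    (fun K K' => by
      ext i
      change _ = if (iMap m K').sgn i = 0 then (iMap m K).sgn i else (iMap m K').sgn i
      by_cases h : G.carrier ⊆ A.hyp i.1
      · simp only [iMap_sgn_pos _ _ _ h]; rfl
      · simp only [iMap_sgn_neg _ _ _ h, ite_self])

theorem salMap_id (F : A.TFace) (x : (loc F).SalPoset) : salMap (𝟙 F) x = x :=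
  RealArr.SalPoset.ext (iMap_id _ _) (iMap_id _ _)

theorem salMap_comp {F G H : A.TFace} (m : F ⟶ G) (n : G ⟶ H) (x : (loc H).SalPoset) :
    salMap (m ≫ n) x = salMap m (salMap n x) :=
  RealArr.SalPoset.ext (iMap_comp _ _ _) (iMap_comp _ _ _)

variable (A)

/-- The diagram `D` of Salvetti posets over the opposite of the face category. -/
def diagram : A.TFaceᵒᵖ ⥤ Preord.{0} where
  obj F := Preord.of (loc F.unop).SalPoset
  map m := Preord.ofHom (salMap m.unop)
  map_id F := by
    refine Preord.ext fun x => ?_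
    exact salMap_id F.unop x
  map_comp m n := by
    refine Preord.ext fun x => ?_
    exact salMap_comp n.unop m.unop x

/-- The toric Salvetti category: the Grothendieck construction of the diagram `D`. -/
abbrev Sal : Type := Grothendieck (A.diagram ⋙ preordToCat)

variable {A}

namespace Sal

/-- The face underlying an object of the Salvetti category. -/
def base (x : A.Sal) : A.TFace := x.1.unop

/-- The element `[G, C]` of the local Salvetti poset underlying an object. -/
def elt (x : A.Sal) : (loc (base x)).SalPoset := x.2

/-- The object `(F, x)`. -/
def mk (F : A.TFace) (x : (loc F).SalPoset) : A.Sal := ⟨op F, x⟩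

/-- The morphism `(F, x) ⟶ (F, y)` defined by `x ≤ y`. -/
def homOfLE (F : A.TFace) {x y : (loc F).SalPoset} (h : x ≤ y) : mk F x ⟶ mk F y where
  base := 𝟙 (op F)
  fiber := CategoryTheory.homOfLE (X := (loc F).SalPoset) (by
    change salMap (𝟙 F) x ≤ y
    rwa [salMap_id])

end Sal

end ToricArr

namespace ToricArr

variable {Λ ι : Type} [AddCommGroup Λ] {A : ToricArr Λ ι}

/-! ### The quotient arrangement and the map of Salvetti categories -/

/-- The characters that are constant on `L`, i.e. trivial on the subtorus `L₀` of which `L` is a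
coset. This is the character lattice of `T / L₀`. -/
def chars (L : Set (Torus Λ)) : AddSubgroup Λ where
  carrier := {χ | ∀ s ∈ L, ∀ t ∈ L, s.1 χ = t.1 χ}
  add_mem' {χ ψ} h h' s hs t ht := by
    rw [s.2 χ ψ, t.2 χ ψ, h s hs t ht, h' s hs t ht]
  zero_mem' s _ t _ := by
    have key : ∀ s : Torus Λ, s.1 0 = 1 := fun s => by
      have := s.2 0 0
      rw [add_zero] at this
      exact left_eq_mul.1 this
    rw [key s, key t]
  neg_mem' {χ} h s hs t ht := by
    have key : ∀ s : Torus Λ, s.1 (-χ) * s.1 χ = 1 := fun s => by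
      have h1 := s.2 (-χ) χ
      have h2 := s.2 0 0
      rw [neg_add_cancel] at h1
      rw [add_zero] at h2
      rw [← h1]
      exact left_eq_mul.1 h2
    rw [eq_inv_of_mul_eq_one_left (key s), eq_inv_of_mul_eq_one_left (key t), h s hs t ht]

/-- Indices of the members that contain `L`, i.e. of the arrangement `A_L`. -/
abbrev QIdx (A : ToricArr Λ ι) (L : A.Layer) : Type := {i // L.carrier ⊆ A.hyp i}

/-- The arrangement `A_L / L₀` in the torus `T / L₀ = Hom(chars L, ℂˣ)`. The quotient map
`T → T / L₀` is `resTorus (chars L)`. -/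
def quot (A : ToricArr Λ ι) (L : A.Layer) : ToricArr (chars L.carrier) (A.QIdx L) where
  char i := ⟨A.char i.1, fun _ hs _ ht => (i.2 hs).trans (i.2 ht).symm⟩
  char_ne i h := A.char_ne i.1 (congrArg Subtype.val h)
  val i := A.val i.1

variable (L : A.Layer)

/-- The map from faces of the lift of `A` to faces of the lift of `A_L / L₀`: a face is sent to the
one that contains its image. -/
def projL (a : A.LFace) : (A.quot L).LFace :=
  RealArr.Face.pull (B := (A.quot L).lifted) (fun p => ⟨(p.1.1.1, p.1.2), p.2⟩)
    (resReal (chars L.carrier)) (fun _ _ => rfl) a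

theorem projL_vadd (l : deck Λ) (a : A.LFace) :
    projL L (l +ᵥ a) = resDeck (chars L.carrier) l +ᵥ projL L a := rfl

theorem mem_projL {a : A.LFace} {x : RealSpace Λ} (hx : x ∈ a.carrier) :
    resReal (chars L.carrier) x ∈ (projL L a).carrier :=
  funext fun p => congrFun (show A.lifted.sgn x = a.sgn from hx) ⟨(p.1.1.1, p.1.2), p.2⟩

theorem projL_mono {a b : A.LFace} (h : a ≤ b) : projL L a ≤ projL L b := fun _ => h _

/-- The map `π_L` on faces of the compact tori: a face is sent to the one that contains its
image under the quotient map (see `resTorus_mem_piFace`). -/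
def piFace (F : A.TFace) : (A.quot L).TFace :=
  ⟨LFace.image (projL L F.exists_lift.choose), _, rfl⟩

theorem image_projL {F : A.TFace} {a : A.LFace} (ha : LFace.image a = F.carrier) :
    LFace.image (projL L a) = (piFace L F).carrier := by
  obtain ⟨l, hl⟩ := exists_vadd (F.exists_lift.choose_spec.trans ha.symm)
  rw [← hl, projL_vadd, image_vadd]
  rfl

theorem resTorus_mem_piFace {F : A.TFace} {t : Torus Λ} (ht : t ∈ F.carrier) :
    resTorus (chars L.carrier) t ∈ (piFace L F).carrier := by
  obtain ⟨a, ha⟩ := F.exists_lift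
  rw [← ha] at ht
  obtain ⟨x, hx, rfl⟩ := ht
  rw [← image_projL L ha]
  exact ⟨_, mem_projL L hx, rfl⟩

theorem subset_of_piFace {F : A.TFace} {i : A.QIdx L}
    (h : (piFace L F).carrier ⊆ (A.quot L).hyp i) : F.carrier ⊆ A.hyp i.1 :=
  fun _ ht => h (resTorus_mem_piFace L ht)

theorem piFace_subset {F : A.TFace} {i : A.QIdx L} (h : F.carrier ⊆ A.hyp i.1) :
    (piFace L F).carrier ⊆ (A.quot L).hyp i := by
  obtain ⟨a, ha⟩ := F.exists_lift
  obtain ⟨x, hx⟩ := a.realized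
  have hp := level_of_mem ha hx h
  refine subset_hyp_of_sgn_zero (A := A.quot L) (image_projL L ha)
    ⟨(i, x.1 (A.char i.1)), hp⟩ ?_
  change a.sgn ⟨(i.1, x.1 (A.char i.1)), hp⟩ = 0
  rw [sgn_of_mem hx]
  simp

/-- The image of an orbit of pairs of lifted faces. -/
def piRel (R : Set (A.LFace × A.LFace)) : Set ((A.quot L).LFace × (A.quot L).LFace) :=
  {q | ∃ p ∈ R, q ∈ AddAction.orbit (deck (chars L.carrier)) (projL L p.1, projL L p.2)}

theorem piRel_orbit (a b : A.LFace) :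
    piRel L (AddAction.orbit (deck Λ) (a, b)) =
      AddAction.orbit (deck (chars L.carrier)) (projL L a, projL L b) := by
  ext q
  constructor
  · rintro ⟨⟨c, d⟩, hp, hq⟩
    obtain ⟨l, rfl, rfl⟩ := mem_orbit_pair.1 hp
    have e : AddAction.orbit (deck (chars L.carrier)) (projL L (l +ᵥ a), projL L (l +ᵥ b)) =
        AddAction.orbit (deck (chars L.carrier)) (projL L a, projL L b) :=
      AddAction.orbit_eq_iff.2 ⟨resDeck _ l, rfl⟩
    exact e ▸ hq
  · exact fun hq => ⟨(a, b), AddAction.mem_orbit_self _, hq⟩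

/-- The map `π_L` on morphisms of the face categories. -/
def piHom {F G : A.TFace} (m : F ⟶ G) : piFace L F ⟶ piFace L G :=
  FaceHom.mk (piRel L m.rel) (by
    obtain ⟨a, b, ha, hb, hab, hm⟩ := m.exists_rep
    exact ⟨projL L a, projL L b, image_projL L ha, image_projL L hb, projL_mono L hab, by
      rw [hm, piRel_orbit]⟩)

theorem mem_piHom {F G : A.TFace} (m : F ⟶ G) {a b : A.LFace} (h : (a, b) ∈ m.rel) :
    (projL L a, projL L b) ∈ (piHom L m).rel := ⟨(a, b), h, AddAction.mem_orbit_self _⟩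

theorem hom_ext_of_mem {F G : A.TFace} {m n : F ⟶ G} {a b : A.LFace} (h : (a, b) ∈ m.rel)
    (h' : (a, b) ∈ n.rel) : m = n :=
  FaceHom.ext ((rel_spec m h).2.2.2.trans (rel_spec n h').2.2.2.symm)

theorem mem_id_rel {F : A.TFace} {a : A.LFace} (h : LFace.image a = F.carrier) :
    (a, a) ∈ FaceHom.rel (𝟙 F) := by
  obtain ⟨l, hl⟩ := exists_vadd (F.exists_lift.choose_spec.trans h.symm)
  exact mem_orbit_pair.2 ⟨l, hl, hl⟩

/-- The functor `π_L` between face categories. -/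
def piFunctor : A.TFace ⥤ (A.quot L).TFace where
  obj := piFace L
  map := piHom L
  map_id F := by
    obtain ⟨a, ha⟩ := F.exists_lift
    exact hom_ext_of_mem (mem_piHom L (𝟙 F) (mem_id_rel ha)) (mem_id_rel (image_projL L ha))
  map_comp {F G H} m n := by
    obtain ⟨a, c, b, h, h'⟩ := exists_mem_rel (m ≫ n)
    exact hom_ext_of_mem (mem_piHom L (m ≫ n) ⟨b, h, h'⟩)
      ⟨projL L b, mem_piHom L m h, mem_piHom L n h'⟩

/-- The map `π_L` from faces of `A₀` to faces of `(A_L / L₀)₀`: a face is sent to the one that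
contains its image. -/
def piZero (K : A.zero.Face) : (A.quot L).zero.Face :=
  RealArr.Face.pull (B := (A.quot L).zero) (fun i => i.1) (resReal (chars L.carrier))
    (fun _ _ => rfl) K

/-- The index map used for the local arrangements. -/
def locIdx (F : A.TFace) (i : LocIdx (piFace L F)) : LocIdx F :=
  ⟨i.1.1, subset_of_piFace L i.2⟩

/-- The map `π_L^F` from faces of `A[F]` to faces of `(A_L / L₀)[π_L F]`: a face is sent to the one
that contains its image. -/
def piLoc (F : A.TFace) (K : (loc F).Face) : (loc (piFace L F)).Face :=
  RealArr.Face.pull (B := loc (piFace L F)) (locIdx L F) (resReal (chars L.carrier))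
    (fun _ _ => rfl) K

theorem piLoc_dir {F G : A.TFace} (m : F ⟶ G) : piLoc L F (dir m) = dir (piHom L m) := by
  obtain ⟨⟨a, b⟩, x, y, hm, hx, hy⟩ := exists_points m
  ext i
  rw [dir_sgn (piHom L m) (mem_piHom L m hm) (mem_projL L hx) (mem_projL L hy)]
  exact dir_sgn m hm hx hy (locIdx L F i)

section

variable [Finite ι]

theorem piLoc_iMap {F G : A.TFace} (m : F ⟶ G) (K : (loc G).Face) :
    piLoc L F (iMap m K) = iMap (piHom L m) (piLoc L G K) := by
  ext i
  by_cases h : (piFace L G).carrier ⊆ (A.quot L).hyp i.1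
  · rw [iMap_sgn_pos _ _ _ h]
    exact iMap_sgn_pos m K (locIdx L F i) (subset_of_piFace L h)
  · rw [iMap_sgn_neg _ _ _ h, ← piLoc_dir]
    exact iMap_sgn_neg m K (locIdx L F i) (fun h' => h (piFace_subset L h'))

/-- The map `[K, C] ↦ [π_L^F K, π_L^F C]` of local Salvetti posets. -/
def bMap (F : A.TFace) : (loc F).SalPoset →o (loc (piFace L F)).SalPoset :=
  RealArr.SalPoset.pull (B := loc (piFace L F)) (locIdx L F) (resReal (chars L.carrier))
    (fun _ _ => rfl)

theorem bMap_salMap {F G : A.TFace} (m : F ⟶ G) (x : (loc G).SalPoset) :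
    bMap L F (salMap m x) = salMap (piHom L m) (bMap L G x) :=
  RealArr.SalPoset.ext (piLoc_iMap L m _) (piLoc_iMap L m _)

/-- The natural transformation of diagrams of posets given by the maps `bMap`. -/
def bTrans : A.diagram ⟶ (piFunctor L).op ⋙ (A.quot L).diagram where
  app F := Preord.ofHom (bMap L F.unop)
  naturality F G m := by
    refine Preord.ext fun x => ?_
    exact bMap_salMap L m.unop x

/-- The functor `Φ_L` of Salvetti categories induced by `π_L` and the natural transformation
`bTrans`. -/
def Phi : A.Sal ⥤ (A.quot L).Sal :=
  Grothendieck.map (F := A.diagram ⋙ preordToCat)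
      (G := (piFunctor L).op ⋙ ((A.quot L).diagram ⋙ preordToCat))
      (Functor.whiskerRight (bTrans L) preordToCat) ⋙
    Grothendieck.pre ((A.quot L).diagram ⋙ preordToCat) (piFunctor L).op

theorem Phi_obj_mk (F : A.TFace) (x : (loc F).SalPoset) :
    (Phi L).obj (Sal.mk F x) = Sal.mk (piFace L F) (bMap L F x) := rfl

end

end ToricArr

/-! ### First homology of nerves -/

/-- First simplicial homology, with integer coefficients, of the nerve of a category. -/
abbrev NerveH1 (C : Type) [Category.{0} C] : ModuleCat.{0} ℤ :=
  (nerve C).homology (ModuleCat.of ℤ ℤ) 1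

/-- The map on first homology of nerves induced by a functor. -/
abbrev nerveH1Map {C D : Type} [Category.{0} C] [Category.{0} D] (Φ : C ⥤ D) :
    NerveH1 C ⟶ NerveH1 D :=
  SSet.homologyMap (nerveMap Φ) (ModuleCat.of ℤ ℤ) 1

/-- The edge of the nerve given by a morphism. -/
def nerveEdge {C : Type} [Category.{0} C] {x y : C} (f : x ⟶ y) : (nerve C) _⦋1⦌ :=
  ComposableArrows.mk₁ f

/-- The simplicial 1-chain with given coefficients. -/
def nerveChain {C : Type} [Category.{0} C] (c : (nerve C) _⦋1⦌ →₀ ℤ) :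
    ((nerve C).chainComplex (ModuleCat.of ℤ ℤ)).X 1 :=
  c.sum fun e n => ((nerve C).ιChainComplex (R := ModuleCat.of ℤ ℤ) e).hom n

/-- `w` is the homology class of the 1-chain `c`; in particular `c` is a cycle. -/
def IsClassOf {C : Type} [Category.{0} C] (c : (nerve C) _⦋1⦌ →₀ ℤ) (w : NerveH1 C) : Prop :=
  ∃ z : ((nerve C).chainComplex (ModuleCat.of ℤ ℤ)).cycles 1,
    (((nerve C).chainComplex (ModuleCat.of ℤ ℤ)).iCycles 1).hom z = nerveChain c ∧
    (((nerve C).chainComplex (ModuleCat.of ℤ ℤ)).homologyπ 1).hom z = w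

namespace ToricArr

variable {Λ ι : Type} [AddCommGroup Λ] {A : ToricArr Λ ι}

/-! ### Layers in the quotient, supports, subcategories `S_{Y,F₀}` -/

/-- The map `π_L` on layers: `Y` is sent to the smallest layer of `A_L / L₀` that contains the image
of `Y` in `T / L₀`, i.e. to the component containing this image of the intersection of all members
containing it. -/
def piLayer (L Y : A.Layer) : (A.quot L).Layer where
  carrier := connectedComponentIn
    (⋂ i ∈ {i | resTorus (chars L.carrier) '' Y.carrier ⊆ (A.quot L).hyp i}, (A.quot L).hyp i)
    (resTorus (chars L.carrier) Y.nonempty.some)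
  isLayer := ⟨{i | resTorus (chars L.carrier) '' Y.carrier ⊆ (A.quot L).hyp i},
    resTorus (chars L.carrier) Y.nonempty.some, Set.mem_iInter₂.2 fun i hi => by
      have hi' : resTorus (chars L.carrier) '' Y.carrier ⊆ (A.quot L).hyp i := hi
      exact hi' ⟨_, Y.nonempty.some_mem, rfl⟩, rfl⟩

/-- `S` is the support of the face `F`: the smallest layer containing `F`. -/
def IsSupport (F : A.TFace) (S : Set (Torus Λ)) : Prop :=
  A.IsLayer S ∧ F.carrier ⊆ S ∧ ∀ S', A.IsLayer S' → F.carrier ⊆ S' → S ⊆ S'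

/-- The face of `A[F]` that contains a given face of `A₀`; on chambers this is `⟨C : F⟩`. -/
def restr (F : A.TFace) (K : A.zero.Face) : (loc F).Face :=
  RealArr.Face.pull (A := A.zero) (B := loc F) (fun i => i.1) id (fun _ _ => rfl) K

theorem restr_isChamber (F : A.TFace) {C : A.zero.Face} (hC : C.IsChamber) :
    (restr F C).IsChamber := fun i => hC i.1

/-- The negative of a face of `A₀`. -/
def negZero (K : A.zero.Face) : A.zero.Face :=
  RealArr.Face.neg (f := fun i => evalForm (A.char i)) K

theorem negZero_isChamber {C : A.zero.Face} (hC : C.IsChamber) : (negZero C).IsChamber :=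
  fun i h => hC i (by
    have h' : - C.sgn i = 0 := h
    revert h'
    cases C.sgn i <;> decide)

variable [Finite ι]

/-- The object set of the full subcategory `S_{Y,F₀}` of the Salvetti category: the objects
`(F, [G, K])` with `F ⊆ Y` and `K = C_G` for some chamber `C` of `A[F]` adjacent to `F₀`. -/
def subSal (Y : A.Layer) (F₀ : A.zero.Face) : Set A.Sal :=
  {x | (Sal.base x).carrier ⊆ Y.carrier ∧
    ∃ C : (loc (Sal.base x)).Face, C.IsChamber ∧ restr (Sal.base x) F₀ ≤ C ∧
      (Sal.elt x).chamber = C.proj (Sal.elt x).face}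

/-! ### The classes `ω̂_H` -/

/-- The element `[F_m, C]` with `C = ⟨R : F⟩_{F_m}`. -/
def omegaE {F G : A.TFace} (m : F ⟶ G) (R : A.zero.Face) (hR : R.IsChamber) :
    (loc F).SalPoset :=
  RealArr.SalPoset.ofProj (dir m) (restr F R) (restr_isChamber F hR)

/-- The element `[C, C]` with `C = ⟨R : F⟩_{F_m}`. -/
def omegaV {F G : A.TFace} (m : F ⟶ G) (R : A.zero.Face) (hR : R.IsChamber) :
    (loc F).SalPoset :=
  RealArr.SalPoset.vertex (omegaE m R hR).chamber (omegaE m R hR).isChamber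

theorem omega_le {F G : A.TFace} (m : F ⟶ G) (R R' : A.zero.Face) (hR : R.IsChamber)
    (hR' : R'.IsChamber) : omegaV m R hR ≤ omegaE m R' hR' :=
  ⟨(omegaE m R hR).le, by
    ext i
    change (if (omegaE m R hR).chamber.sgn i = 0 then (omegaE m R' hR').chamber.sgn i
      else (omegaE m R hR).chamber.sgn i) = (omegaE m R hR).chamber.sgn i
    rw [if_neg ((omegaE m R hR).isChamber i)]⟩

/-- The object set of the subcategory `Ω^(m)`, with reference chamber `R`. -/
def omegaSet {F G : A.TFace} (m : F ⟶ G) (R : A.zero.Face) (hR : R.IsChamber) : Set A.Sal :=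
  {Sal.mk F (omegaV m R hR), Sal.mk F (omegaE m R hR),
    Sal.mk F (omegaV m (negZero R) (negZero_isChamber hR)),
    Sal.mk F (omegaE m (negZero R) (negZero_isChamber hR))}

/-- The 1-cycle `[Ω^(m)]` supported on `Ω^(m)`, in which `[C₁, C₁] → [F_m, C₁]` has
coefficient 1. -/
def omegaChain {F G : A.TFace} (m : F ⟶ G) (R : A.zero.Face) (hR : R.IsChamber) :
    (nerve A.Sal) _⦋1⦌ →₀ ℤ :=
  Finsupp.single (nerveEdge (Sal.homOfLE F (omega_le m R R hR hR))) 1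
  - Finsupp.single (nerveEdge (Sal.homOfLE F
      (omega_le m (negZero R) R (negZero_isChamber hR) hR))) 1
  + Finsupp.single (nerveEdge (Sal.homOfLE F
      (omega_le m (negZero R) (negZero R) (negZero_isChamber hR) (negZero_isChamber hR)))) 1
  - Finsupp.single (nerveEdge (Sal.homOfLE F
      (omega_le m R (negZero R) hR (negZero_isChamber hR)))) 1

/-- `w` is the class `ω̂_H` of the member `H = A.hyp i`, with reference chamber `R_H = R`: the
homology class of some `[Ω^(m)]`, where `m : F ⟶ G` and `G` has support `H`. -/
def IsOmegaHat (i : ι) (R : A.zero.Face) (hR : R.IsChamber) (w : NerveH1 A.Sal) : Prop :=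
  ∃ (F G : A.TFace) (m : F ⟶ G), IsSupport G (A.hyp i) ∧ IsClassOf (omegaChain m R hR) w

/-! ### The classes `λ̂^M_B` -/

/-- The choices made for a one-dimensional layer `M`: a chamber `R_M` of `A₀` adjacent to `X_M`, and
a minimal gallery from `R_M` to the chamber opposite to `-R_M` with respect to `X_M`. -/
structure GalleryChoice (M : A.Layer) where
  length : ℕ
  gallery : Fin (length + 1) → A.zero.Face
  adjacent : ∃ K : A.zero.Face, K ≤ gallery 0 ∧
    Submodule.span ℝ K.carrier = A.tangent M.carrier
  last : A.zero.IsOpposite (A.tangent M.carrier) (negZero (gallery 0)) (gallery (Fin.last length))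
  minimal : A.zero.IsMinimalGallery length gallery

/-- The vertices `[C, C]` of `Path(M; B, F)`, for the chambers `C` of the gallery in `A[F]`. -/
def pathV {M : A.Layer} (γ : GalleryChoice M) (F : A.TFace) : Set (loc F).SalPoset :=
  {x | ∃ j, x.face = restr F (γ.gallery j) ∧ x.chamber = restr F (γ.gallery j)}

/-- `W` is the wall crossed by the gallery of `A[F]` in step `j` (in particular, the two chambers
are different). -/
def IsCrossing {M : A.Layer} (γ : GalleryChoice M) (F : A.TFace) (j : Fin γ.length)
    (W : (loc F).Face) : Prop :=
  restr F (γ.gallery j.castSucc) ≠ restr F (γ.gallery j.succ) ∧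
    W.IsWall (restr F (γ.gallery j.castSucc)) ∧ W.IsWall (restr F (γ.gallery j.succ))

/-- The elements `[W, ⟨B : F⟩_W]` of `Path(M; B, F)`, for the walls `W` crossed by the gallery
in `A[F]`. -/
def pathE {M : A.Layer} (γ : GalleryChoice M) (B : A.zero.Face) (F : A.TFace) :
    Set (loc F).SalPoset :=
  {x | ∃ j, IsCrossing γ F j x.face ∧ x.chamber = (restr F B).proj x.face}

/-- The object set of the full subcategory `Λ^M_B` of the Salvetti category. -/
def lambdaSet {M : A.Layer} (γ : GalleryChoice M) (B : A.zero.Face) : Set A.Sal :=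
  {x | (Sal.base x).carrier ⊆ M.carrier ∧
    (Sal.elt x ∈ pathV γ (Sal.base x) ∨ Sal.elt x ∈ pathE γ B (Sal.base x))}

/-- The arrows of the cyclic diagram of `Λ^M_B`: the morphisms between distinct objects that do not
factor through a third object of `Λ^M_B`. -/
def IsLambdaArrow {M : A.Layer} (γ : GalleryChoice M) (B : A.zero.Face) {x y : A.Sal}
    (f : x ⟶ y) : Prop :=
  x ∈ lambdaSet γ B ∧ y ∈ lambdaSet γ B ∧ x ≠ y ∧
    ∀ z ∈ lambdaSet γ B, ∀ (g : x ⟶ z) (h : z ⟶ y), g ≫ h = f → z = x ∨ z = y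

/-- `w` is the class `λ̂^M_B`: the homology class of the 1-cycle supported on the arrows of the
cyclic diagram of `Λ^M_B` in which the arrow `v₀ → e₀` over some (chosen) vertex `P₀` of `M` has
coefficient 1. Here `v₀` belongs to the initial chamber of the gallery and `e₀` to the first wall
that the gallery crosses in `A[P₀]`. -/
def IsLambdaHat {M : A.Layer} (γ : GalleryChoice M) (B : A.zero.Face) (w : NerveH1 A.Sal) : Prop :=
  ∃ c : (nerve A.Sal) _⦋1⦌ →₀ ℤ,
    (∀ e ∈ c.support, ∃ (x y : A.Sal) (f : x ⟶ y), IsLambdaArrow γ B f ∧ e = nerveEdge f) ∧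
    (∃ (P₀ : A.TFace) (t : Torus Λ) (v₀ e₀ : (loc P₀).SalPoset) (j : Fin γ.length)
        (h : v₀ ≤ e₀),
      P₀.carrier = {t} ∧ t ∈ M.carrier ∧
      v₀.face = restr P₀ (γ.gallery 0) ∧ v₀.chamber = restr P₀ (γ.gallery 0) ∧
      restr P₀ (γ.gallery j.castSucc) = restr P₀ (γ.gallery 0) ∧
      IsCrossing γ P₀ j e₀.face ∧ e₀.chamber = (restr P₀ B).proj e₀.face ∧
      c (nerveEdge (Sal.homOfLE P₀ h)) = 1) ∧
    IsClassOf c w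

end ToricArr

end

noncomputable section

/-! The functor Φ_L remembers, of a face of A[F], only its signs on the members that contain L, and
a 1-cycle dies when all its arrows become identities.

Homology. H₁ of a nerve embeds in the 1-chains modulo boundaries. So two classes agree once every
function on arrows that is additive under composition takes the same value on their cycles
(`IsClassOf.eq_of_additive`). The face category has only trivial endomorphisms and the fibres are
posets, hence an arrow with equal ends is an identity (`Sal.eq_eqToHom`) and additive functions
vanish on it.

One-dimensional layers. If X_M ⊆ X_L, the characters constant on L are constant on M
(`Layer.chars_le`), so M goes to one point of T/L₀. The members containing L have hyperplanes
containing X_M. On these the two ends of the gallery agree, and a minimal gallery never crosses a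
hyperplane that does not separate its ends (`IsMinimalGallery.sgn_eq`). Hence all objects of Λ^M_B
have one image (`Phi_obj_eq`).

Members. If G has support H, then F_m lies exactly on the hyperplanes of the members containing H.
Only there do the reference chambers matter, and there their signs are determined by the side of H.
So for H ⊇ L the cycle [Ω^(m)] goes to the corresponding cycle (`mapDomain_omegaChain`). If H does
not contain L and is maximal, F_m becomes a chamber and the four objects coincide
(`IsOmegaHat.map_eq_zero`).

Independence of m (`IsOmegaHat.unique`) is needed to identify the image with the class of the
quotient. The natural arrows (G, x) → (F, i_m x) reduce m to id_G (`omegaVal_eq_id`). Within one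
fibre, a loop at K depends only on the hyperplanes containing K, by comparison along a segment
(`loop_eq_loop`). Finally, two faces with support H are joined by a segment in one lift of H, along
which the value is locally constant (`omegaVal_id_eq`). Here connectedness of H enters: its
character is primitive (`exists_dual_char_eq_one`).

Subcategories. Forgetting signs commutes with F_G, and the image of Y is connected. -/

/-- A function on the edges of a nerve that is additive under composition. -/
def IsAdditiveEdge {C : Type} [Category.{0} C] {Q : Type} [AddCommGroup Q]
    (q : (nerve C) _⦋1⦌ → Q) : Prop :=
  ∀ {x y z : C} (f : x ⟶ y) (g : y ⟶ z),
    q (nerveEdge (f ≫ g)) = q (nerveEdge f) + q (nerveEdge g)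

namespace IsAdditiveEdge

variable {C : Type} [Category.{0} C] {Q : Type} [AddCommGroup Q] {q : (nerve C) _⦋1⦌ → Q}

theorem map_id (hq : IsAdditiveEdge q) (x : C) : q (nerveEdge (𝟙 x)) = 0 := by
  have := hq (𝟙 x) (𝟙 x)
  rw [Category.comp_id] at this
  exact left_eq_add.1 this

theorem map_eqToHom (hq : IsAdditiveEdge q) {x y : C} (h : x = y) :
    q (nerveEdge (eqToHom h)) = 0 := by
  subst h
  exact hq.map_id x

end IsAdditiveEdge

/-! ### First homology classes of nerves, tested by additive functions on edges -/

section Homology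

variable {C : Type} [Category.{0} C]

theorem exists_nerve_triangle {x y z : C} (f : x ⟶ y) (g : y ⟶ z) : ∃ s : (nerve C) _⦋2⦌,
    (nerve C).δ (0 : Fin 3) s = nerveEdge g ∧ (nerve C).δ (1 : Fin 3) s = nerveEdge (f ≫ g) ∧
      (nerve C).δ (2 : Fin 3) s = nerveEdge f :=
  ⟨ComposableArrows.mk₂ f g, nerve.δ₀_mk₂_eq .., nerve.δ₁_mk₂_eq .., nerve.δ₂_mk₂_eq ..⟩

/-- The class of an edge modulo boundaries. -/
def edgeClass (e : (nerve C) _⦋1⦌) : ((nerve C).chainComplex (ModuleCat.of ℤ ℤ)).opcycles 1 :=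
  (((nerve C).chainComplex (ModuleCat.of ℤ ℤ)).pOpcycles 1).hom
    (((nerve C).ιChainComplex (R := ModuleCat.of ℤ ℤ) e).hom (1 : ℤ))

/-- The boundary g − fg + f of the 2-simplex (f, g) vanishes in the chains modulo boundaries. -/
theorem isAdditiveEdge_edgeClass : IsAdditiveEdge (edgeClass (C := C)) := by
  intro x y z f g
  obtain ⟨s, h0, h1, h2⟩ := exists_nerve_triangle f g
  have h := congrArg (fun φ => φ ≫ ((nerve C).chainComplex (ModuleCat.of ℤ ℤ)).pOpcycles 1)
    (SSet.ιChainComplex_d (R := ModuleCat.of ℤ ℤ) _ s)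
  dsimp only at h
  rw [Fin.sum_univ_three, h0, h1, h2, Category.assoc, HomologicalComplex.d_pOpcycles,
    Limits.comp_zero] at h
  have h' := congrArg (fun φ : ModuleCat.of ℤ ℤ ⟶ _ => φ.hom (1 : ℤ)) h
  simp only [Fin.val_zero, pow_zero, one_smul, Fin.val_one, pow_one, neg_smul, Fin.val_two,
    Preadditive.add_comp, Preadditive.neg_comp, ModuleCat.hom_add, ModuleCat.hom_neg,
    ModuleCat.hom_comp, ModuleCat.hom_zero, LinearMap.add_apply, LinearMap.neg_apply,
    LinearMap.zero_apply, LinearMap.comp_apply, even_two, Even.neg_pow, one_pow] at h'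
  change (0 : ((nerve C).chainComplex (ModuleCat.of ℤ ℤ)).opcycles 1) =
    edgeClass (nerveEdge g) + -edgeClass (nerveEdge (f ≫ g)) + edgeClass (nerveEdge f) at h'
  rw [add_right_comm, eq_comm, add_neg_eq_zero] at h'
  rw [← h', add_comm]

theorem pOpcycles_nerveChain (c : (nerve C) _⦋1⦌ →₀ ℤ) :
    (((nerve C).chainComplex (ModuleCat.of ℤ ℤ)).pOpcycles 1).hom (nerveChain c) =
      c.sum fun e n => n • edgeClass e := by
  rw [nerveChain, Finsupp.sum, map_sum]
  refine Finset.sum_congr rfl fun e _ => ?_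
  change _ = (c e) • (((nerve C).chainComplex (ModuleCat.of ℤ ℤ)).pOpcycles 1).hom
    (((nerve C).ιChainComplex (R := ModuleCat.of ℤ ℤ) e).hom (1 : ℤ))
  rw [← map_zsmul, ← map_zsmul]
  simp

/-- The composite cycles → homology → chains modulo boundaries is also the composite through all
chains, where the cycle is known. -/
theorem IsClassOf.homologyι {c : (nerve C) _⦋1⦌ →₀ ℤ} {w : NerveH1 C} (h : IsClassOf c w) :
    (((nerve C).chainComplex (ModuleCat.of ℤ ℤ)).homologyι 1).hom w =
      c.sum fun e n => n • edgeClass e := by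
  obtain ⟨z, hz, rfl⟩ := h
  rw [← pOpcycles_nerveChain, ← hz]
  exact congrArg (fun φ => φ.hom z)
    (((nerve C).chainComplex (ModuleCat.of ℤ ℤ)).homology_π_ι 1)

/-- Two homology classes agree if all additive functions on edges agree on representatives. -/
theorem IsClassOf.eq_of_additive {c c' : (nerve C) _⦋1⦌ →₀ ℤ} {w w' : NerveH1 C}
    (h : IsClassOf c w) (h' : IsClassOf c' w')
    (H : ∀ (Q : Type) [AddCommGroup Q] (q : (nerve C) _⦋1⦌ → Q), IsAdditiveEdge q →
      (c.sum fun e n => n • q e) = c'.sum fun e n => n • q e) : w = w' := by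
  -- Homology is a subobject of the chains modulo boundaries, so `edgeClass` is the one additive
  -- function that has to be tested.
  have hinj : Function.Injective
      (((nerve C).chainComplex (ModuleCat.of ℤ ℤ)).homologyι 1).hom :=
    (ModuleCat.mono_iff_injective _).1 inferInstance
  apply hinj
  rw [h.homologyι, h'.homologyι]
  exact H _ _ isAdditiveEdge_edgeClass

theorem IsClassOf.eq_zero_of_additive {c : (nerve C) _⦋1⦌ →₀ ℤ} {w : NerveH1 C}
    (h : IsClassOf c w)
    (H : ∀ (Q : Type) [AddCommGroup Q] (q : (nerve C) _⦋1⦌ → Q), IsAdditiveEdge q →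
      (c.sum fun e n => n • q e) = 0) : w = 0 := by
  have h0 : IsClassOf (0 : (nerve C) _⦋1⦌ →₀ ℤ) (0 : NerveH1 C) :=
    ⟨0, by simp [nerveChain], by simp⟩
  exact h.eq_of_additive h0 fun Q _ q hq => by simpa using H Q q hq

theorem IsClassOf.map {D : Type} [Category.{0} D] (Φ : C ⥤ D) {c : (nerve C) _⦋1⦌ →₀ ℤ}
    {w : NerveH1 C} (h : IsClassOf c w) :
    IsClassOf (c.mapDomain ((nerveMap Φ).app _)) ((nerveH1Map Φ).hom w) := by
  obtain ⟨z, hz, rfl⟩ := h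
  refine ⟨(HomologicalComplex.cyclesMap
    (SSet.chainComplexMap (nerveMap Φ) (ModuleCat.of ℤ ℤ)) 1).hom z, ?_, ?_⟩
  · have e := congrArg (fun φ => φ.hom z) (HomologicalComplex.cyclesMap_i
      (SSet.chainComplexMap (nerveMap Φ) (ModuleCat.of ℤ ℤ)) 1)
    refine Eq.trans e ?_
    change ((SSet.chainComplexMap (nerveMap Φ) (ModuleCat.of ℤ ℤ)).f 1).hom
      ((((nerve C).chainComplex (ModuleCat.of ℤ ℤ)).iCycles 1).hom z) = _
    rw [hz, nerveChain, nerveChain, Finsupp.sum_mapDomain_index (by simp) (by simp), Finsupp.sum,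
      map_sum]
    refine Finset.sum_congr rfl fun e _ => ?_
    exact congrArg (fun φ => φ.hom (c e)) (SSet.ι_chainComplexMap_f (f := nerveMap Φ)
      (R := ModuleCat.of ℤ ℤ) (x := e))
  · exact (congrArg (fun φ => φ.hom z) (HomologicalComplex.homologyπ_naturality
      (SSet.chainComplexMap (nerveMap Φ) (ModuleCat.of ℤ ℤ)) 1)).symm

theorem IsClassOf.map_eq_zero {D : Type} [Category.{0} D] (Φ : C ⥤ D)
    {c : (nerve C) _⦋1⦌ →₀ ℤ} {w : NerveH1 C} (h : IsClassOf c w)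
    (H : ∀ (Q : Type) [AddCommGroup Q] (q : (nerve D) _⦋1⦌ → Q), IsAdditiveEdge q →
      (c.sum fun e n => n • q ((nerveMap Φ).app _ e)) = 0) : (nerveH1Map Φ).hom w = 0 := by
  refine (h.map Φ).eq_zero_of_additive fun Q _ q hq => ?_
  rw [← H Q q hq]
  exact Finsupp.sum_mapDomain_index (fun e => zero_smul ℤ (q e)) fun e => fun _ _ => add_smul ..

theorem nerveMap_nerveEdge {D : Type} [Category.{0} D] (Φ : C ⥤ D) {x y : C} (f : x ⟶ y) :
    (nerveMap Φ).app _ (nerveEdge f) = nerveEdge (Φ.map f) :=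
  nerveMap_app_mk₁ Φ f

end Homology


namespace RealArr

variable {κ V : Type} [AddCommGroup V] [Module ℝ V]

/-! ### Faces along a segment -/

theorem Face.ofPoint_eq {A : RealArr κ V} {F : A.Face} {v : V} (h : v ∈ F.carrier) :
    Face.ofPoint A v = F := Face.ext h

theorem eventually_sign_eq {g : ℝ → ℝ} (hg : Continuous g) (t₀ : ℝ) :
    ∀ᶠ t in nhds t₀, SignType.sign (g t₀) = 0 ∨ SignType.sign (g t₀) = SignType.sign (g t) := by
  rcases lt_trichotomy (g t₀) 0 with h | h | h
  · filter_upwards [hg.tendsto t₀ |>.eventually_lt_const h] with t ht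
    rw [sign_neg h, sign_neg ht]; exact Or.inr rfl
  · simp [h]
  · filter_upwards [hg.tendsto t₀ |>.eventually_const_lt h] with t ht
    rw [sign_pos h, sign_pos ht]; exact Or.inr rfl

theorem continuous_form_segment (f : V →ₗ[ℝ] ℝ) (c u : V) (a : ℝ) :
    Continuous fun t : ℝ => f (c + t • u) - a := by
  simp only [map_add, map_smul, smul_eq_mul]
  fun_prop

theorem eventually_ofPoint_le [Finite κ] (A : RealArr κ V) (c u : V) (t₀ : ℝ) :
    ∀ᶠ t in nhds t₀, Face.ofPoint A (c + t₀ • u) ≤ Face.ofPoint A (c + t • u) :=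
  Filter.eventually_all.2 fun k =>
    eventually_sign_eq (continuous_form_segment (A.form k) c u (A.level k)) t₀

/-- A function on faces that agrees on comparable faces is constant along segments. -/
theorem eq_of_segment [Finite κ] {α : Type} (A : RealArr κ V) (c d : V) (P : A.Face → Prop)
    (hP : ∀ t ∈ Set.Icc (0 : ℝ) 1, P (Face.ofPoint A (c + t • (d - c)))) (φ : A.Face → α)
    (hφ : ∀ F G, P F → P G → F ≤ G → φ F = φ G) :
    φ (Face.ofPoint A c) = φ (Face.ofPoint A d) := by
  -- Points of the segment close to a given one lie in faces above its face, so the function is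
  -- locally constant on a connected interval.
  have hlc : IsLocallyConstant fun t : unitInterval =>
      φ (Face.ofPoint A (c + (t : ℝ) • (d - c))) := by
    rw [IsLocallyConstant.iff_eventually_eq]
    intro t₀
    filter_upwards [continuous_subtype_val.tendsto t₀ |>.eventually
      (eventually_ofPoint_le A c (d - c) t₀)] with t ht
    exact (hφ _ _ (hP _ t₀.2) (hP _ t.2) ht).symm
  have := hlc.apply_eq_of_preconnectedSpace 0 1
  simpa using this

theorem sign_segment {a b : ℝ} (h : SignType.sign a = SignType.sign b) {t : ℝ}
    (ht : t ∈ Set.Icc (0 : ℝ) 1) : SignType.sign (a + t * (b - a)) = SignType.sign a := by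
  obtain ⟨h0, h1⟩ := ht
  rcases lt_trichotomy a 0 with ha | ha | ha
  · rw [sign_neg ha] at h ⊢
    have hb := sign_eq_neg_one_iff.1 h.symm
    refine sign_neg ?_
    rcases h0.lt_or_eq with h' | rfl
    · nlinarith
    · linarith
  · rw [ha, sign_zero] at h
    have hb := sign_eq_zero_iff.1 h.symm
    simp [ha, hb]
  · rw [sign_pos ha] at h ⊢
    have hb := sign_eq_one_iff.1 h.symm
    refine sign_pos ?_
    rcases h0.lt_or_eq with h' | rfl
    · nlinarith
    · linarith

/-! ### Loops in the Salvetti poset of a central arrangement -/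

namespace SalPoset

variable [Finite κ]

theorem proj_sgn {A : RealArr κ V} (F G : A.Face) (k : κ) :
    (F.proj G).sgn k = if G.sgn k = 0 then F.sgn k else G.sgn k := rfl

theorem proj_chamber {A : RealArr κ V} (F : A.Face) {C : A.Face} (hC : C.IsChamber) :
    F.proj C = C := by
  ext k
  rw [proj_sgn, if_neg (hC k)]

theorem vertex_chamber_le_ofProj {A : RealArr κ V} (K R S : A.Face) (hR : R.IsChamber)
    (hS : S.IsChamber) :
    vertex (ofProj K R hR).chamber (ofProj K R hR).isChamber ≤ ofProj K S hS :=
  ⟨(ofProj K R hR).le, proj_chamber _ (ofProj K R hR).isChamber⟩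

/-- The value of a function on the relations of the Salvetti poset on the loop `Ω` at the face `K`
with reference chambers `R` and `S`. -/
def loop {Q : Type} [AddCommGroup Q] {A : RealArr κ V}
    (r : ∀ x y : A.SalPoset, x ≤ y → Q) (K R S : A.Face) (hR : R.IsChamber)
    (hS : S.IsChamber) : Q :=
  r _ _ (vertex_chamber_le_ofProj K R R hR hR) - r _ _ (vertex_chamber_le_ofProj K S R hS hR)
    + r _ _ (vertex_chamber_le_ofProj K S S hS hS) - r _ _ (vertex_chamber_le_ofProj K R S hR hS)

variable {f : κ → V →ₗ[ℝ] ℝ}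

/-- The maximal element `[0, C]` of the Salvetti poset of a central arrangement. -/
def top (C : (central f).Face) (hC : C.IsChamber) : (central f).SalPoset where
  face := Face.ofPoint _ 0
  chamber := C
  isChamber := hC
  le k := Or.inl (by simp [Face.ofPoint, RealArr.sgn, central])

theorem le_top_iff {C : (central f).Face} {hC : C.IsChamber} {x : (central f).SalPoset} :
    x ≤ top C hC ↔ C.proj x.face = x.chamber :=
  ⟨fun h => h.2, fun h => ⟨fun k => Or.inl (by simp [top, Face.ofPoint, RealArr.sgn, central]), h⟩⟩

/-- C_D = D for a chamber D, so every vertex lies below every maximal element. This makes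
differences along two maximal elements available at all chambers. -/
theorem vertex_le_top {C D : (central f).Face} (hC : C.IsChamber) (hD : D.IsChamber) :
    vertex D hD ≤ top C hC := le_top_iff.2 (proj_chamber _ hD)

theorem ofProj_le_top {C : (central f).Face} (hC : C.IsChamber) (F : (central f).Face) :
    ofProj F C hC ≤ top C hC := le_top_iff.2 rfl

/-- For F ≤ G one has (C_F)_G = C_G. -/
theorem ofProj_mono {A : RealArr κ V} {F G : A.Face} (h : F ≤ G) (C : A.Face)
    (hC : C.IsChamber) : ofProj G C hC ≤ ofProj F C hC := by
  refine ⟨h, ?_⟩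
  ext k
  change (if G.sgn k = 0 then (if F.sgn k = 0 then C.sgn k else F.sgn k) else G.sgn k) =
    if G.sgn k = 0 then C.sgn k else G.sgn k
  split_ifs with h1 h2 <;> try rfl
  rcases h k with h3 | h3
  · exact absurd h3 h2
  · exact absurd (h3.trans h1) h2

section

variable {Q : Type} [AddCommGroup Q] {r : ∀ x y : (central f).SalPoset, x ≤ y → Q}

/-- Each of the four arrows is prolonged to [0, U] or [0, W], which lie above [K, R_K] and [K, S_K]
respectively. Both added arrows occur twice, with opposite signs, and cancel. -/
theorem loop_eq_sub (hr : ∀ x y z (h : x ≤ y) (h' : y ≤ z), r x z (h.trans h') = r x y h + r y z h')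
    {K R S U W : (central f).Face} (hR : R.IsChamber) (hS : S.IsChamber) (hU : U.IsChamber)
    (hW : W.IsChamber) (hRU : U.proj K = R.proj K) (hSW : W.proj K = S.proj K) :
    loop r K R S hR hS =
      (r _ _ (vertex_le_top hU (ofProj K R hR).isChamber) -
        r _ _ (vertex_le_top hW (ofProj K R hR).isChamber)) -
      (r _ _ (vertex_le_top hU (ofProj K S hS).isChamber) -
        r _ _ (vertex_le_top hW (ofProj K S hS).isChamber)) := by
  have h1 : ofProj K R hR ≤ top U hU := le_top_iff.2 hRU
  have h2 : ofProj K S hS ≤ top W hW := le_top_iff.2 hSW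
  rw [loop, hr _ _ _ (vertex_chamber_le_ofProj K R R hR hR) h1,
    hr _ _ _ (vertex_chamber_le_ofProj K R S hR hS) h2,
    hr _ _ _ (vertex_chamber_le_ofProj K S R hS hR) h1,
    hr _ _ _ (vertex_chamber_le_ofProj K S S hS hS) h2]
  abel

/-- A face F on no hyperplane of Z satisfies U_F = W_F, so [F, U_F] lies below both [0, U] and [0,
W]. The difference of the two values is the same for comparable such faces, as the arrows from the
larger face factor through the smaller one. A segment from C to D stays off Z. -/
theorem segment_sub_eq
    (hr : ∀ x y z (h : x ≤ y) (h' : y ≤ z), r x z (h.trans h') = r x y h + r y z h')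
    {Z : Set κ} {U W C D : (central f).Face} (hU : U.IsChamber) (hW : W.IsChamber)
    (hC : C.IsChamber) (hD : D.IsChamber) (hUW : ∀ k ∉ Z, U.sgn k = W.sgn k)
    (hCD : ∀ k ∈ Z, C.sgn k = D.sgn k) :
    r _ _ (vertex_le_top hU hC) - r _ _ (vertex_le_top hW hC) =
      r _ _ (vertex_le_top hU hD) - r _ _ (vertex_le_top hW hD) := by
  classical
  let P : (central f).Face → Prop := fun F => ∀ k ∈ Z, F.sgn k ≠ 0
  have key : ∀ F, P F → ofProj F U hU ≤ top W hW := fun F hF => le_top_iff.2 (by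
    ext k
    change (if F.sgn k = 0 then W.sgn k else F.sgn k) = if F.sgn k = 0 then U.sgn k else F.sgn k
    split_ifs with h
    · exact (hUW k fun hk => hF k hk h).symm
    · rfl)
  -- The value 0 is a dummy for faces on some hyperplane of Z; the segment does not meet them.
  let φ : (central f).Face → Q := fun F =>
    if h : P F then r _ _ (ofProj_le_top hU F) - r _ _ (key F h) else 0
  have hφ : ∀ F G, P F → P G → F ≤ G → φ F = φ G := by
    intro F G hF hG h
    simp only [φ, dif_pos hF, dif_pos hG]
    rw [hr _ _ _ (ofProj_mono h U hU) (ofProj_le_top hU F),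
      hr _ _ _ (ofProj_mono h U hU) (key F hF)]
    abel
  have hv : ∀ E (hE : E.IsChamber), φ E =
      r _ _ (vertex_le_top hU hE) - r _ _ (vertex_le_top hW hE) := by
    intro E hE
    have hPE : P E := fun k _ => hE k
    have e : ofProj E U hU = vertex E hE := SalPoset.ext rfl (proj_chamber _ hE)
    simp only [φ, dif_pos hPE]
    congr 1 <;> congr 1
  obtain ⟨c, hc⟩ := C.realized
  obtain ⟨d, hd⟩ := D.realized
  have := eq_of_segment (central f) c d P (fun t ht k hk => ?_) φ hφ
  · rw [Face.ofPoint_eq hc, Face.ofPoint_eq hd, hv C hC, hv D hD] at this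
    exact this
  -- C and D have the same nonzero sign on Z, hence so has every point between them.
  · have h1 := congrFun hc k
    have h2 := congrFun hd k
    have h3 : SignType.sign (f k c) = SignType.sign (f k d) := by
      have := h1.trans ((hCD k hk).trans h2.symm)
      simpa [RealArr.sgn, central] using this
    have h4 : SignType.sign (f k c) = C.sgn k := by
      simpa [RealArr.sgn, central] using h1
    have h5 := sign_segment h3 ht
    change SignType.sign (f k (c + t • (d - c)) - 0) ≠ 0
    rw [sub_zero, map_add, map_smul, map_sub, smul_eq_mul, h5, h4]
    exact hC k

/-- The value of an additive function on a loop depends only on the hyperplanes that contain the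
face at which the loop is taken. -/
theorem loop_eq_loop
    (hr : ∀ x y z (h : x ≤ y) (h' : y ≤ z), r x z (h.trans h') = r x y h + r y z h')
    {K K' R S : (central f).Face} (hR : R.IsChamber) (hS : S.IsChamber)
    (hZ : ∀ k, K.sgn k = 0 ↔ K'.sgn k = 0) :
    loop r K R S hR hS = loop r K' R S hR hS := by
  -- Both loops are compared with the maximal elements [0, R_K] and [0, S_K]. These chambers agree
  -- off the hyperplanes containing K, and on those they keep the signs of R and S, so their
  -- projections to K and to K' are those of R and S.
  have hU := (ofProj K R hR).isChamber
  have hW := (ofProj K S hS).isChamber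
  have hp : ∀ R : (central f).Face, (R.proj K).proj K = R.proj K := fun R => by
    ext k
    simp only [proj_sgn]
    split_ifs <;> rfl
  have hp' : ∀ R : (central f).Face, (R.proj K).proj K' = R.proj K' := fun R => by
    ext k
    simp only [proj_sgn]
    split_ifs with h1 h2
    · rfl
    · exact absurd ((hZ k).2 h1) h2
    · rfl
  rw [loop_eq_sub hr hR hS hU hW (hp R) (hp S), loop_eq_sub hr hR hS hU hW (hp' R) (hp' S)]
  have hUW : ∀ k ∉ {k | K.sgn k = 0}, (ofProj K R hR).chamber.sgn k =
      (ofProj K S hS).chamber.sgn k := fun k hk => by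
    replace hk : ¬ K.sgn k = 0 := hk
    change (R.proj K).sgn k = (S.proj K).sgn k
    rw [proj_sgn, proj_sgn, if_neg hk, if_neg hk]
  have hCD : ∀ R : (central f).Face, ∀ k ∈ {k | K.sgn k = 0}, (R.proj K).sgn k = (R.proj K').sgn k :=
    fun R k hk => by
      replace hk : K.sgn k = 0 := hk
      rw [proj_sgn, proj_sgn, if_pos hk, if_pos ((hZ k).1 hk)]
  rw [segment_sub_eq hr hU hW (ofProj K R hR).isChamber (ofProj K' R hR).isChamber hUW (hCD R),
    segment_sub_eq hr hU hW (ofProj K S hS).isChamber (ofProj K' S hS).isChamber hUW (hCD S)]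

end

end SalPoset

end RealArr


namespace RealArr

variable {κ V : Type} [AddCommGroup V] [Module ℝ V]

/-! ### Walls and minimal galleries -/

theorem exists_smul_of_ker_le {f g : V →ₗ[ℝ] ℝ} (h : LinearMap.ker f ≤ LinearMap.ker g)
    (hg : g ≠ 0) : ∃ c : ℝ, c ≠ 0 ∧ ∀ v, g v = c * f v := by
  have h' : (⨅ _ : Unit, LinearMap.ker f) ≤ LinearMap.ker g := by simpa using h
  have := mem_span_of_iInf_ker_le_ker h'
  rw [Set.range_const, Submodule.mem_span_singleton] at this
  obtain ⟨c, rfl⟩ := this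
  refine ⟨c, fun hc => hg (by simp [hc]), fun v => rfl⟩

variable {f : κ → V →ₗ[ℝ] ℝ}

theorem central_sgn (v : V) (k : κ) : (central f).sgn v k = SignType.sign (f k v) := by
  simp [RealArr.sgn, central]

theorem Face.sgn_eq_mul {F : (central f).Face} {k l : κ} {c : ℝ} (h : ∀ v, f l v = c * f k v) :
    F.sgn l = SignType.sign c * F.sgn k := by
  obtain ⟨v, hv⟩ := F.realized
  rw [← hv, central_sgn, central_sgn, h, sign_mul]

/-- The form f l is a multiple of f k, so its sign on a face is determined by that of f k. -/
theorem Face.sgn_ne_of_ker_le {C D : (central f).Face} {k l : κ} (hl : f l ≠ 0)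
    (h : LinearMap.ker (f k) ≤ LinearMap.ker (f l)) (hkl : C.sgn l ≠ D.sgn l) :
    C.sgn k ≠ D.sgn k := by
  obtain ⟨c, -, hcv⟩ := exists_smul_of_ker_le h hl
  intro e
  exact hkl (by rw [sgn_eq_mul hcv, sgn_eq_mul hcv, e])

/-- The wall lies in the kernel, and its span and the kernel both have codimension one. -/
theorem Face.span_eq_ker_of_isWall [FiniteDimensional ℝ V] {W C : (central f).Face}
    (hW : W.IsWall C) {k : κ} (hk : f k ≠ 0) (h : W.sgn k = 0) :
    Submodule.span ℝ W.carrier = LinearMap.ker (f k) := by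
  refine Submodule.eq_of_le_of_finrank_eq (Submodule.span_le.2 fun v hv => ?_) ?_
  · have := congrFun (show (central f).sgn v = W.sgn from hv) k
    rw [h, central_sgn, sign_eq_zero_iff] at this
    exact this
  · have h1 := hW.2
    have h2 := Module.Dual.finrank_ker_add_one_of_ne_zero hk
    omega

theorem Face.sgn_eq_zero_of_le_of_ne {A : RealArr κ V} {W C D : A.Face} (hC : W ≤ C) (hD : W ≤ D)
    {k : κ} (h : C.sgn k ≠ D.sgn k) : W.sgn k = 0 := by
  rcases hC k with h1 | h1
  · exact h1
  · rcases hD k with h2 | h2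
    · exact h2
    · exact absurd (h1.symm.trans h2) h

/-- The hyperplanes that separate two faces. -/
def sepKer (C D : (central f).Face) : Set (Submodule ℝ V) :=
  {X | ∃ k, C.sgn k ≠ D.sgn k ∧ LinearMap.ker (f k) = X}

theorem sepKer_finite [Finite κ] (C D : (central f).Face) : (sepKer C D).Finite :=
  (Set.finite_range fun k => LinearMap.ker (f k)).subset fun _ ⟨k, _, h⟩ => ⟨k, h⟩

/-- A point of a chamber in general position with respect to a point off the hyperplanes. -/
theorem exists_generic [Finite κ] (hf : ∀ k, f k ≠ 0) {C : (central f).Face} (hC : C.IsChamber)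
    {d : V} (hd : ∀ k, f k d ≠ 0) : ∃ c, (central f).sgn c = C.sgn ∧
      ∀ k l, f l d * f k c = f k d * f l c → LinearMap.ker (f k) = LinearMap.ker (f l) := by
  classical
  let g : κ × κ → Module.Dual ℝ V := fun p =>
    if LinearMap.ker (f p.1) = LinearMap.ker (f p.2) then f p.1
    else (f p.2 d) • f p.1 - (f p.1 d) • f p.2
  have hg : ∀ p, ∃ x, g p x ≠ 0 := by
    intro p
    have hp : g p ≠ 0 := by
      simp only [g]
      split_ifs with h
      · exact hf _
      · intro h0
        refine h ?_
        have e : ∀ v, f p.2 d * f p.1 v = f p.1 d * f p.2 v := fun v => by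
          have := LinearMap.congr_fun h0 v
          simp only [LinearMap.sub_apply, LinearMap.smul_apply, smul_eq_mul,
            LinearMap.zero_apply] at this
          linarith
        ext v
        rw [LinearMap.mem_ker, LinearMap.mem_ker]
        have := e v
        constructor
        · intro h1
          rw [h1, mul_zero, eq_comm, mul_eq_zero] at this
          exact this.resolve_left (hd _)
        · intro h1
          rw [h1, mul_zero, mul_eq_zero] at this
          exact this.resolve_left (hd _)
    by_contra hx
    push Not at hx
    exact hp (LinearMap.ext hx)
  obtain ⟨u, hu⟩ := Module.Dual.exists_forall_ne_zero_of_forall_exists g hg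
  obtain ⟨c₀, hc₀⟩ := C.realized
  -- A small move from c₀ towards u keeps the nonzero signs of all f k and makes every g p nonzero.
  obtain ⟨ε, -, -, h⟩ := perturb (fun s : κ ⊕ κ × κ => Sum.elim (fun k => f k c₀) (fun p => g p c₀) s)
    (fun s => Sum.elim (fun k => f k u) (fun p => g p u) s)
  refine ⟨(1 - ε) • c₀ + ε • u, funext fun k => ?_, fun k l e => ?_⟩
  · have h0 := congrFun hc₀ k
    rw [central_sgn] at h0
    have hne : f k c₀ ≠ 0 := fun hz => hC k (by rw [← h0, hz, sign_zero])
    have hk := (h (Sum.inl k)).trans (if_neg hne)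
    simp only [Sum.elim_inl] at hk
    rw [central_sgn, map_add, map_smul, map_smul, smul_eq_mul, smul_eq_mul, hk, h0]
  · by_contra hkl
    have hz : (1 - ε) * g (k, l) c₀ + ε * g (k, l) u = 0 := by
      rw [← smul_eq_mul, ← smul_eq_mul, ← map_smul, ← map_smul, ← map_add]
      simp only [g, if_neg hkl, LinearMap.sub_apply, LinearMap.smul_apply, smul_eq_mul]
      linarith
    have hk := h (Sum.inr (k, l))
    by_cases h1 : g (k, l) c₀ = 0
    · replace hk := hk.trans (if_pos h1)
      simp only [Sum.elim_inr, hz, sign_zero] at hk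
      exact hu _ (sign_eq_zero_iff.1 hk.symm)
    · replace hk := hk.trans (if_neg h1)
      simp only [Sum.elim_inr, hz, sign_zero] at hk
      exact h1 (sign_eq_zero_iff.1 hk.symm)

/-- All hyperplanes through W contain ker (f k), so a point of W can be moved a little in any
direction of this kernel without leaving W. Hence W spans the whole kernel. -/
theorem isWall_of_zero_iff [Finite κ] [FiniteDimensional ℝ V] {W C : (central f).Face}
    (hWC : W ≤ C) {k : κ} (hk : f k ≠ 0)
    (h : ∀ l, W.sgn l = 0 → LinearMap.ker (f k) ≤ LinearMap.ker (f l)) (h0 : W.sgn k = 0) :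
    W.IsWall C := by
  refine ⟨hWC, ?_⟩
  have e : Submodule.span ℝ W.carrier = LinearMap.ker (f k) := by
    refine le_antisymm (Submodule.span_le.2 fun v hv => ?_) fun v hv => ?_
    · have := congrFun (show (central f).sgn v = W.sgn from hv) k
      rw [h0, central_sgn, sign_eq_zero_iff] at this
      exact this
    · obtain ⟨w, hw⟩ := W.realized
      obtain ⟨ε, hε, -, hp⟩ := perturb (fun l => f l w) (fun l => f l (w + v))
      have hmem : w + ε • v ∈ W.carrier := by
        refine funext fun l => ?_
        have hl := hp l
        have hwl := congrFun hw l
        rw [central_sgn] at hwl ⊢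
        have e : f l (w + ε • v) = (1 - ε) * f l w + ε * f l (w + v) := by
          simp only [map_add, map_smul, smul_eq_mul]; ring
        rw [e, hl, ← hwl]
        split_ifs with hz
        · have : f l v = 0 := h l (by rw [← hwl, hz, sign_zero]) hv
          rw [map_add, hz, this, add_zero]
        · rfl
      have : v = ε⁻¹ • ((w + ε • v) - w) := by
        rw [add_sub_cancel_left, smul_smul, inv_mul_cancel₀ hε.ne', one_smul]
      rw [this]
      exact Submodule.smul_mem _ _ (Submodule.sub_mem _ (Submodule.subset_span hmem)
        (Submodule.subset_span hw))
  rw [e]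
  exact Module.Dual.finrank_ker_add_one_of_ne_zero hk

/-- If two chambers differ, then one can cross a wall of the first in the direction of the
second. -/
theorem exists_adjacent [Finite κ] [FiniteDimensional ℝ V] (hf : ∀ k, f k ≠ 0)
    {C D : (central f).Face} (hC : C.IsChamber) (hD : D.IsChamber) (hne : C ≠ D) :
    ∃ C' W : (central f).Face, C'.IsChamber ∧ W.IsWall C ∧ W.IsWall C' ∧
      sepKer C' D ⊂ sepKer C D := by
  obtain ⟨d, hd⟩ := D.realized
  have hd' : ∀ k, SignType.sign (f k d) = D.sgn k := fun k => by rw [← hd, central_sgn]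
  have hd0 : ∀ k, f k d ≠ 0 := fun k hz => hD k (by rw [← hd', hz, sign_zero])
  obtain ⟨c, hc, hgen⟩ := exists_generic hf hC hd0
  have hc' : ∀ k, SignType.sign (f k c) = C.sgn k := fun k => by rw [← hc, central_sgn]
  have hc0 : ∀ k, f k c ≠ 0 := fun k hz => hC k (by rw [← hc', hz, sign_zero])
  let Sep : Set κ := {k | C.sgn k ≠ D.sgn k}
  have hSep : Sep.Nonempty := by
    by_contra h
    rw [Set.not_nonempty_iff_eq_empty] at h
    refine hne (Face.ext (funext fun k => ?_))
    by_contra hk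
    exact (h ▸ (show k ∈ Sep from hk) : k ∈ (∅ : Set κ))
  -- The time at which the segment from c to d meets a separating hyperplane; k below is a
  -- hyperplane met first, and W the face of the meeting point.
  let τ : κ → ℝ := fun k => f k c / (f k c - f k d)
  obtain ⟨k, hkS, hkmin⟩ := Set.exists_min_image Sep τ (Set.toFinite _) hSep
  have hopp : ∀ l ∈ Sep, (f l c < 0 ∧ 0 < f l d) ∨ (0 < f l c ∧ f l d < 0) := by
    intro l hl
    have hl' : SignType.sign (f l c) ≠ SignType.sign (f l d) := by rw [hc', hd']; exact hl
    rcases (hc0 l).lt_or_gt with h1 | h1 <;> rcases (hd0 l).lt_or_gt with h2 | h2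
    · exact absurd (by rw [sign_neg h1, sign_neg h2]) hl'
    · exact Or.inl ⟨h1, h2⟩
    · exact Or.inr ⟨h1, h2⟩
    · exact absurd (by rw [sign_pos h1, sign_pos h2]) hl'
  have hτ : ∀ l ∈ Sep, 0 < τ l ∧ τ l < 1 := by
    intro l hl
    rcases hopp l hl with ⟨h1, h2⟩ | ⟨h1, h2⟩
    · have h3 : f l c - f l d < 0 := by linarith
      exact ⟨div_pos_of_neg_of_neg h1 h3, by rw [div_lt_one_of_neg h3]; linarith⟩
    · have h3 : 0 < f l c - f l d := by linarith
      exact ⟨div_pos h1 h3, by rw [div_lt_one h3]; linarith⟩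
  let w := c + τ k • (d - c)
  let W := Face.ofPoint (central f) w
  have hw : ∀ l, W.sgn l = SignType.sign (f l c + τ k * (f l d - f l c)) := fun l => by
    change (central f).sgn w l = _
    rw [central_sgn]
    simp only [w, map_add, map_smul, map_sub, smul_eq_mul]
  have hWn : ∀ l, l ∉ Sep → W.sgn l = C.sgn l := by
    intro l hl
    have hl' : C.sgn l = D.sgn l := not_not.1 hl
    rw [hw, sign_segment (by rw [hc', hd', hl']) ⟨(hτ k hkS).1.le, (hτ k hkS).2.le⟩, hc']
  have hWs : ∀ l ∈ Sep, (τ l = τ k ∧ W.sgn l = 0) ∨ W.sgn l = C.sgn l := by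
    intro l hl
    rw [hw, ← hc']
    have hle := hkmin l hl
    rcases hopp l hl with ⟨h1, h2⟩ | ⟨h1, h2⟩
    · have h3 : f l c - f l d ≠ 0 := by linarith
      have e : f l c + τ k * (f l d - f l c) = (τ l - τ k) * (f l c - f l d) := by
        simp only [τ]; field_simp; ring
      rw [e]
      rcases hle.lt_or_eq with h | h
      · right
        rw [sign_neg h1, sign_neg (mul_neg_of_pos_of_neg (by linarith) (by linarith))]
      · left; refine ⟨h.symm, by rw [h, sub_self, zero_mul, sign_zero]⟩
    · have h3 : f l c - f l d ≠ 0 := by linarith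
      have e : f l c + τ k * (f l d - f l c) = (τ l - τ k) * (f l c - f l d) := by
        simp only [τ]; field_simp; ring
      rw [e]
      rcases hle.lt_or_eq with h | h
      · right
        rw [sign_pos h1, sign_pos (mul_pos (by linarith) (by linarith))]
      · left; refine ⟨h.symm, by rw [h, sub_self, zero_mul, sign_zero]⟩
  have hWC : W ≤ C := fun l => by
    by_cases hl : l ∈ Sep
    · exact (hWs l hl).imp And.right id
    · exact Or.inr (hWn l hl)
  -- Hyperplanes met at the same time satisfy the equation excluded by the generic choice of c
  -- unless they coincide.
  have hzero : ∀ l, W.sgn l = 0 → LinearMap.ker (f k) = LinearMap.ker (f l) := by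
    intro l h0
    have hl : l ∈ Sep := by
      by_contra hl
      exact hC l ((hWn l hl).symm.trans h0)
    rcases hWs l hl with ⟨h, -⟩ | h
    · refine hgen k l ?_
      have h1 : f l c - f l d ≠ 0 := by rcases hopp l hl with ⟨_, _⟩ | ⟨_, _⟩ <;> linarith
      have h2 : f k c - f k d ≠ 0 := by rcases hopp k hkS with ⟨_, _⟩ | ⟨_, _⟩ <;> linarith
      simp only [τ] at h
      rw [div_eq_div_iff h1 h2] at h
      linarith
    · exact absurd (h.symm.trans h0) (hC l)
  have h0k : W.sgn k = 0 := by
    have h2 : f k c - f k d ≠ 0 := by rcases hopp k hkS with ⟨_, _⟩ | ⟨_, _⟩ <;> linarith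
    rw [hw, sign_eq_zero_iff]
    simp only [τ]
    field_simp
    ring
  have hC' := (SalPoset.ofProj W D hD).isChamber
  have hz : ∀ l, W.sgn l = 0 → LinearMap.ker (f k) ≤ LinearMap.ker (f l) :=
    fun l hl => (hzero l hl).le
  -- The chamber D_W has the sign of D on the hyperplane just met and the sign of C elsewhere.
  refine ⟨D.proj W, W, hC', isWall_of_zero_iff hWC (hf k) hz h0k,
    isWall_of_zero_iff (SalPoset.ofProj W D hD).le (hf k) hz h0k, ?_⟩
  have hl : ∀ l, (D.proj W).sgn l ≠ D.sgn l → W.sgn l ≠ 0 ∧ C.sgn l ≠ D.sgn l := by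
    intro l hl
    rw [SalPoset.proj_sgn] at hl
    split_ifs at hl with h
    · exact absurd rfl hl
    · exact ⟨h, by rwa [(hWC l).resolve_left h] at hl⟩
  refine ⟨fun X ⟨l, h1, h2⟩ => ⟨l, (hl l h1).2, h2⟩, fun hsub => ?_⟩
  obtain ⟨l, h1, h2⟩ := hsub ⟨k, hkS, rfl⟩
  have hkl : (D.proj W).sgn k ≠ D.sgn k := Face.sgn_ne_of_ker_le (hf l) h2.ge h1
  exact (hl k hkl).1 h0k

/-- Every crossing given by `exists_adjacent` removes a separating hyperplane, so their number
bounds the length. -/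
theorem exists_gallery [Finite κ] [FiniteDimensional ℝ V] (hf : ∀ k, f k ≠ 0) (n : ℕ) :
    ∀ (C D : (central f).Face), C.IsChamber → D.IsChamber → (sepKer C D).ncard ≤ n →
      ∃ k ≤ n, ∃ γ : Fin (k + 1) → (central f).Face, (central f).IsGallery k γ ∧ γ 0 = C ∧
        γ (Fin.last k) = D := by
  induction n with
  | zero =>
    intro C D hC hD h
    have hCD : C = D := by
      rw [Nat.le_zero, Set.ncard_eq_zero (sepKer_finite C D)] at h
      refine Face.ext (funext fun k => ?_)
      by_contra hk
      have hmem : LinearMap.ker (f k) ∈ sepKer C D := ⟨k, hk, rfl⟩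
      rw [h] at hmem
      exact hmem
    exact ⟨0, le_rfl, fun _ => C, ⟨fun _ => hC, fun i => i.elim0⟩, rfl, hCD⟩
  | succ n ih =>
    intro C D hC hD h
    by_cases hCD : C = D
    · exact ⟨0, Nat.zero_le _, fun _ => C, ⟨fun _ => hC, fun i => i.elim0⟩, rfl, hCD⟩
    obtain ⟨C', W, hC', hW, hW', hlt⟩ := exists_adjacent hf hC hD hCD
    have := Set.ncard_lt_ncard hlt (sepKer_finite C D)
    obtain ⟨k, hk, γ, hγ, h0, h1⟩ := ih C' D hC' hD (by omega)
    refine ⟨k + 1, by omega, Fin.cons C γ, ⟨fun i => ?_, fun i => ?_⟩, rfl, ?_⟩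
    · refine Fin.cases ?_ (fun i => ?_) i
      · exact hC
      · exact hγ.1 i
    · refine Fin.cases ?_ (fun i => ?_) i
      · refine ⟨W, hW, ?_⟩
        change W.IsWall (γ 0)
        rwa [h0]
      · exact hγ.2 i
    · exact h1

theorem exists_step_ne {α : Type} {k : ℕ} (a : Fin (k + 1) → α) {j : Fin (k + 1)} (h : a j ≠ a 0) :
    ∃ i : Fin k, a i.castSucc ≠ a i.succ := by
  by_contra hc
  push Not at hc
  refine h ?_
  induction j using Fin.induction with
  | zero => rfl
  | succ i ih =>
    by_cases hi : a i.castSucc = a 0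
    · rw [← hc i, hi]
    · exact absurd (ih hi) hi

/-- A minimal gallery does not cross the hyperplanes that do not separate its ends. -/
theorem IsMinimalGallery.sgn_eq [Finite κ] [FiniteDimensional ℝ V] (hf : ∀ k, f k ≠ 0) {k : ℕ}
    {γ : Fin (k + 1) → (central f).Face} (hγ : (central f).IsMinimalGallery k γ) {j : κ}
    (hj : (γ 0).sgn j = (γ (Fin.last k)).sgn j) (i : Fin (k + 1)) :
    (γ i).sgn j = (γ 0).sgn j := by
  by_contra hij
  choose W hW hW' using hγ.1.2
  -- A hyperplane on which the sign changes is spanned by one of the chosen common walls, so a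
  -- gallery of length k crosses at most k hyperplanes.
  have key : ∀ l, (∃ i, (γ i).sgn l ≠ (γ 0).sgn l) →
      LinearMap.ker (f l) ∈ Set.range fun i => Submodule.span ℝ (W i).carrier := by
    rintro l ⟨i, hi⟩
    obtain ⟨s, hs⟩ := exists_step_ne (fun i => (γ i).sgn l) hi
    exact ⟨s, Face.span_eq_ker_of_isWall (hW s) (hf l)
      (Face.sgn_eq_zero_of_le_of_ne (hW s).1 (hW' s).1 hs)⟩
  have hsub : insert (LinearMap.ker (f j)) (sepKer (γ 0) (γ (Fin.last k))) ⊆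
      Set.range fun i => Submodule.span ℝ (W i).carrier := by
    rw [Set.insert_subset_iff]
    refine ⟨key j ⟨i, hij⟩, ?_⟩
    rintro _ ⟨l, hl, rfl⟩
    exact key l ⟨_, hl.symm⟩
  have hnot : LinearMap.ker (f j) ∉ sepKer (γ 0) (γ (Fin.last k)) := by
    rintro ⟨l, hl, e⟩
    exact Face.sgn_ne_of_ker_le (hf l) e.ge hl hj
  have h1 := Set.ncard_le_ncard hsub (Set.finite_range _)
  rw [Set.ncard_insert_of_notMem hnot (sepKer_finite _ _)] at h1
  have h2 : (Set.range fun i => Submodule.span ℝ (W i).carrier).ncard ≤ k := by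
    rw [← Set.image_univ]
    refine (Set.ncard_image_le Set.finite_univ).trans ?_
    simp [Set.ncard_univ]
  -- The length k exceeds the number of separating hyperplanes, since one more is crossed; but a
  -- gallery no longer than that number exists.
  obtain ⟨k', hk', γ', hγ', h0, h3⟩ := exists_gallery hf _ (γ 0) (γ (Fin.last k)) (hγ.1.1 _)
    (hγ.1.1 _) le_rfl
  have := hγ.2 k' γ' hγ' h0 h3
  omega

end RealArr


/-! ### Characters, homomorphisms and coverings of tori -/

section Tori

variable {Λ : Type} [AddCommGroup Λ]

/-- The point of `Hom(Λ, ℝ)` given by an additive homomorphism. -/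
def RealSpace.ofHom (φ : Λ →+ ℝ) : RealSpace Λ := ⟨φ, map_add φ⟩

/-- A point of `Hom(Λ, ℝ)` as an additive homomorphism. -/
def RealSpace.toHom (v : RealSpace Λ) : Λ →+ ℝ := AddMonoidHom.mk' v.1 v.2

theorem Torus.mul_apply (s t : Torus Λ) (χ : Λ) : (s * t).1 χ = s.1 χ * t.1 χ := rfl

theorem expMap_apply (v : RealSpace Λ) (χ : Λ) :
    (expMap v).1 χ = Circle.toUnits (circ (v.1 χ)) := rfl

/-- A point of the torus as an additive homomorphism. -/
def Torus.toHom (t : Torus Λ) : Λ →+ Additive ℂˣ :=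
  AddMonoidHom.mk' (fun χ => Additive.ofMul (t.1 χ)) fun χ ψ => congrArg Additive.ofMul (t.2 χ ψ)

theorem Torus.zsmul_apply (t : Torus Λ) (n : ℤ) (χ : Λ) : t.1 (n • χ) = t.1 χ ^ n :=
  map_zsmul t.toHom n χ

theorem RealSpace.zsmul_apply (v : RealSpace Λ) (n : ℤ) (χ : Λ) : v.1 (n • χ) = n * v.1 χ := by
  have := map_zsmul v.toHom n χ
  rw [zsmul_eq_mul] at this
  exact this

theorem circ_eq_one_of_int {n : ℤ} {x : ℝ} (h : x = n) : circ x = 1 := h ▸ circ_int n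

theorem eq_zero_of_circ_mul {x : ℝ} (h : ∀ s : ℝ, circ (s * x) = 1) : x = 0 := by
  by_contra hx
  -- With s = 1/(2x) one half would have to be an integer.
  obtain ⟨n, hn⟩ := circ_eq_one (h (1 / (2 * x)))
  have h2 : (2 * n : ℝ) = 1 := by rw [← hn]; field_simp
  have h3 : 2 * n = 1 := by exact_mod_cast h2
  omega

theorem continuous_toUnits_circ : Continuous fun x : ℝ => Circle.toUnits (circ x) := by
  refine Units.continuous_iff.2 ⟨?_, ?_⟩
  · change Continuous fun x : ℝ => ((circ x : Circle) : ℂ)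
    unfold circ
    fun_prop
  · change Continuous fun x : ℝ => (((circ x)⁻¹ : Circle) : ℂ)
    unfold circ
    fun_prop

theorem continuous_expMap : Continuous (expMap : RealSpace Λ → Torus Λ) :=
  Continuous.subtype_mk (continuous_pi fun χ => continuous_toUnits_circ.comp
    ((continuous_apply χ).comp continuous_subtype_val)) _

theorem continuous_resTorus (S : AddSubgroup Λ) : Continuous (resTorus S) :=
  Continuous.subtype_mk (f := fun (t : Torus Λ) (χ : S) => t.1 χ) (continuous_pi fun χ =>
    (continuous_apply (χ : Λ)).comp continuous_subtype_val) _

theorem continuous_eval (χ : Λ) : Continuous fun t : Torus Λ => t.1 χ :=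
  (continuous_apply χ).comp continuous_subtype_val

theorem finiteDimensional_realSpace [Module.Finite ℤ Λ] : FiniteDimensional ℝ (RealSpace Λ) := by
  obtain ⟨s, hs⟩ := (Module.Finite.fg_top : (⊤ : Submodule ℤ Λ).FG)
  let φ : RealSpace Λ →ₗ[ℝ] (s → ℝ) := LinearMap.pi fun χ => evalForm (χ : Λ)
  refine FiniteDimensional.of_injective φ ((injective_iff_map_eq_zero φ).2 fun v hv => ?_)
  ext χ
  have hχ : χ ∈ Submodule.span ℤ (s : Set Λ) := hs ▸ Submodule.mem_top
  change v.toHom χ = 0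
  induction hχ using Submodule.span_induction with
  | mem x hx => exact congrFun hv ⟨x, hx⟩
  | zero => exact map_zero _
  | add x y _ _ hx hy => rw [map_add, hx, hy, add_zero]
  | smul n x _ hx => rw [map_zsmul, hx, smul_zero]

/-- The point of `Hom(Λ, ℝ)` given by an integral linear form. -/
def RealSpace.ofDual (φ : Module.Dual ℤ Λ) : RealSpace Λ :=
  RealSpace.ofHom ((Int.castAddHom ℝ).comp φ.toAddMonoidHom)

theorem RealSpace.ofDual_apply (φ : Module.Dual ℤ Λ) (χ : Λ) : (ofDual φ).1 χ = (φ χ : ℝ) := rfl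

theorem exists_dual_ne_zero [Module.Free ℤ Λ] {χ : Λ} (h : χ ≠ 0) :
    ∃ φ : Module.Dual ℤ Λ, φ χ ≠ 0 := by
  by_contra hc
  push Not at hc
  exact h ((Module.forall_dual_apply_eq_zero_iff ℤ χ).1 hc)

theorem evalForm_ne_zero [Module.Free ℤ Λ] {χ : Λ} (h : χ ≠ 0) : evalForm χ ≠ 0 := by
  obtain ⟨φ, hφ⟩ := exists_dual_ne_zero h
  intro h0
  have : (φ χ : ℝ) = 0 := LinearMap.congr_fun h0 (RealSpace.ofDual φ)
  exact hφ (by exact_mod_cast this)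

theorem eq_of_evalForm_eq [Module.Free ℤ Λ] {χ ψ : Λ}
    (h : ∀ v : RealSpace Λ, v.1 χ = v.1 ψ) : χ = ψ := by
  by_contra hne
  refine evalForm_ne_zero (sub_ne_zero.2 hne) (LinearMap.ext fun v => ?_)
  change v.toHom (χ - ψ) = 0
  rw [map_sub]
  exact sub_eq_zero.2 (h v)

/-- If a power of a character is constant on a connected set, then so is the character. -/
theorem chars_saturated {S : Set (Torus Λ)} (hS : IsPreconnected S) {n : ℤ} (hn : n ≠ 0) {χ : Λ}
    (h : n • χ ∈ ToricArr.chars S) : χ ∈ ToricArr.chars S := by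
  intro s hs t ht
  have hc : Continuous fun u : Torus Λ => u.1 χ / t.1 χ := (continuous_eval χ).div' continuous_const
  have hp := hS.image _ hc.continuousOn
  -- The quotients are |n|-th roots of unity, whereas a connected subset of ℂˣ with two points is
  -- infinite.
  have hfin : ((fun u : Torus Λ => u.1 χ / t.1 χ) '' S).Finite := by
    refine Set.Finite.subset (s := ((rootsOfUnity n.natAbs ℂ : Subgroup ℂˣ) : Set ℂˣ)) ?_ ?_
    · have : NeZero n.natAbs := ⟨Int.natAbs_ne_zero.2 hn⟩
      exact inferInstanceAs (Finite (rootsOfUnity n.natAbs ℂ))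
    · rintro _ ⟨u, hu, rfl⟩
      have e := h u hu t ht
      rw [Torus.zsmul_apply, Torus.zsmul_apply] at e
      have e' : (u.1 χ / t.1 χ) ^ n = 1 := by rw [div_zpow, e, div_self']
      rw [SetLike.mem_coe, mem_rootsOfUnity]
      rcases Int.natAbs_eq n with h' | h'
      · rw [h', zpow_natCast] at e'
        exact e'
      · rw [h', zpow_neg, zpow_natCast, inv_eq_one] at e'
        exact e'
  by_contra hne
  refine hp.infinite_of_nontrivial ⟨_, ⟨s, hs, rfl⟩, _, ⟨t, ht, rfl⟩, fun e => hne ?_⟩ hfin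
  simpa [div_eq_one] using e

/-- The point of the circle with a given coordinate of modulus one. -/
def circleOfNorm (z : ℂ) (hz : ‖z‖ = 1) : Circle := ⟨z, mem_sphere_zero_iff_norm.2 hz⟩

/-- The point is a homomorphism from Λ to the circle, and it lifts through ℝ → S¹ because the free
group Λ is projective. -/
theorem exists_expMap_eq [Module.Free ℤ Λ] {t : Torus Λ} (ht : ∀ χ, ‖(t.1 χ : ℂ)‖ = 1) :
    ∃ x : RealSpace Λ, expMap x = t := by
  let u₀ : Λ →+ Additive Circle := AddMonoidHom.mk'
    (fun χ => Additive.ofMul (circleOfNorm (t.1 χ) (ht χ)))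
    (fun χ ψ => congrArg Additive.ofMul (Subtype.ext (congrArg Units.val (t.2 χ ψ)) :
      circleOfNorm _ (ht (χ + ψ)) = circleOfNorm _ (ht χ) * circleOfNorm _ (ht ψ)))
  have hs : Function.Surjective Circle.expHom.toIntLinearMap := fun z => by
    obtain ⟨x, hx⟩ := Circle.exp_surjective z.toMul
    exact ⟨x, congrArg Additive.ofMul hx⟩
  obtain ⟨φ, hφ⟩ := Module.projective_lifting_property Circle.expHom.toIntLinearMap
    u₀.toIntLinearMap hs
  refine ⟨(2 * Real.pi)⁻¹ • RealSpace.ofHom φ.toAddMonoidHom, ?_⟩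
  ext χ
  have h1 : Circle.exp (φ χ) = circleOfNorm (t.1 χ) (ht χ) :=
    LinearMap.congr_fun hφ χ
  change ((Circle.exp (2 * Real.pi * ((2 * Real.pi)⁻¹ * φ χ)) : Circle) : ℂ) = _
  rw [mul_inv_cancel_left₀ (by positivity), h1]
  rfl

/-- The positive real part of a point of the torus, raised to a real power. -/
def absPow (t : Torus Λ) (s : ℝ) : Torus Λ :=
  ⟨fun χ => Units.map Complex.ofRealHom.toMonoidHom
    (Units.mk0 (Real.exp (s * Real.log ‖(t.1 χ : ℂ)‖)) (Real.exp_ne_zero _)), fun χ ψ => by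
      ext
      change ((Real.exp _ : ℝ) : ℂ) = (Real.exp _ : ℝ) * (Real.exp _ : ℝ)
      rw [t.2 χ ψ, Units.val_mul, norm_mul, Real.log_mul (by simp) (by simp), mul_add,
        Real.exp_add, Complex.ofReal_mul]⟩

theorem absPow_val (t : Torus Λ) (s : ℝ) (χ : Λ) :
    (((absPow t s).1 χ : ℂˣ) : ℂ) = (Real.exp (s * Real.log ‖(t.1 χ : ℂ)‖) : ℝ) := rfl

theorem continuous_absPow (t : Torus Λ) : Continuous (absPow t) := by
  refine Continuous.subtype_mk (continuous_pi fun χ => ?_) _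
  refine Units.continuous_iff.2 ⟨?_, ?_⟩
  · change Continuous fun s : ℝ => ((Real.exp (s * Real.log ‖(t.1 χ : ℂ)‖) : ℝ) : ℂ)
    fun_prop
  · change Continuous fun s : ℝ => (((Real.exp (s * Real.log ‖(t.1 χ : ℂ)‖))⁻¹ : ℝ) : ℂ)
    simp only [← Real.exp_neg]
    fun_prop

end Tori

/-! ### Saturated subgroups and primitive elements of lattices -/

section Lattices

variable {Λ : Type} [AddCommGroup Λ] [Module.Finite ℤ Λ]

theorem free_quotient_of_saturated {S : AddSubgroup Λ}
    (hS : ∀ (n : ℤ) (χ : Λ), n ≠ 0 → n • χ ∈ S → χ ∈ S) :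
    Module.Free ℤ (Λ ⧸ AddSubgroup.toIntSubmodule S) := by
  have : Module.IsTorsionFree ℤ (Λ ⧸ AddSubgroup.toIntSubmodule S) := by
    refine Module.IsTorsionFree.of_smul_eq_zero fun n m h => ?_
    obtain ⟨χ, rfl⟩ := Submodule.Quotient.mk_surjective _ m
    rw [← Submodule.Quotient.mk_smul, Submodule.Quotient.mk_eq_zero] at h
    by_cases hn : n = 0
    · exact Or.inl hn
    · exact Or.inr ((Submodule.Quotient.mk_eq_zero _).2 (hS n χ hn h))
  exact Module.free_of_finite_type_torsion_free'

/-- A saturated subgroup of a lattice is a direct summand. -/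
theorem exists_retraction {S : AddSubgroup Λ}
    (hS : ∀ (n : ℤ) (χ : Λ), n ≠ 0 → n • χ ∈ S → χ ∈ S) :
    ∃ r : Λ →+ S, ∀ χ : S, r χ = χ := by
  have := free_quotient_of_saturated hS
  -- A section s of the projection to the free quotient gives the retraction χ ↦ χ − s[χ].
  obtain ⟨s, hs⟩ := Module.projective_lifting_property (AddSubgroup.toIntSubmodule S).mkQ
    LinearMap.id (Submodule.mkQ_surjective _)
  have hmem : ∀ χ, χ - s ((AddSubgroup.toIntSubmodule S).mkQ χ) ∈ S := fun χ => by
    refine (Submodule.Quotient.mk_eq_zero (AddSubgroup.toIntSubmodule S)).1 ?_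
    have := LinearMap.congr_fun hs ((AddSubgroup.toIntSubmodule S).mkQ χ)
    simp only [LinearMap.comp_apply, LinearMap.id_apply] at this
    rw [Submodule.Quotient.mk_sub]
    exact sub_eq_zero.2 this.symm
  refine ⟨AddMonoidHom.mk' (fun χ => ⟨χ - s ((AddSubgroup.toIntSubmodule S).mkQ χ), hmem χ⟩)
    fun χ ψ => ?_, fun χ => ?_⟩
  · ext
    simp only [map_add, AddSubgroup.coe_add]
    abel
  · ext
    have h0 : (AddSubgroup.toIntSubmodule S).mkQ (χ : Λ) = 0 :=
      (Submodule.Quotient.mk_eq_zero _).2 χ.2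
    change (χ : Λ) - s ((AddSubgroup.toIntSubmodule S).mkQ (χ : Λ)) = χ
    rw [h0, map_zero, sub_zero]

/-- A character that vanishes on the common kernel of a family of characters has a multiple in the
subgroup generated by the family. -/
theorem exists_zsmul_mem {S : AddSubgroup Λ} {χ : Λ}
    (h : ∀ v : RealSpace Λ, (∀ ψ ∈ S, v.1 ψ = 0) → v.1 χ = 0) :
    ∃ n : ℤ, n ≠ 0 ∧ n • χ ∈ S := by
  -- The saturation of S. Its quotient is free, so a χ outside it is detected by an integral form
  -- that vanishes on S'; seen as a point of Hom(Λ, ℝ), this form contradicts the hypothesis.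
  let S' : AddSubgroup Λ :=
    { carrier := {χ | ∃ n : ℤ, n ≠ 0 ∧ n • χ ∈ S}
      add_mem' := by
        rintro χ ψ ⟨n, hn, h⟩ ⟨m, hm, h'⟩
        refine ⟨n * m, mul_ne_zero hn hm, ?_⟩
        rw [smul_add, mul_comm n m, mul_smul, mul_comm m n, mul_smul]
        exact S.add_mem (S.zsmul_mem h m) (S.zsmul_mem h' n)
      zero_mem' := ⟨1, one_ne_zero, by simp⟩
      neg_mem' := by
        rintro χ ⟨n, hn, h⟩
        exact ⟨n, hn, by rw [smul_neg]; exact S.neg_mem h⟩ }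
  have hS' : ∀ (n : ℤ) (χ : Λ), n ≠ 0 → n • χ ∈ S' → χ ∈ S' := by
    rintro n χ hn ⟨m, hm, h⟩
    exact ⟨m * n, mul_ne_zero hm hn, by rwa [mul_smul]⟩
  have := free_quotient_of_saturated hS'
  by_contra hχ
  have hne : (AddSubgroup.toIntSubmodule S').mkQ χ ≠ 0 := fun h0 =>
    hχ ((Submodule.Quotient.mk_eq_zero (AddSubgroup.toIntSubmodule S')).1 h0)
  obtain ⟨φ, hφ⟩ := exists_dual_ne_zero hne
  refine hφ ?_
  have := h (RealSpace.ofDual (φ ∘ₗ (AddSubgroup.toIntSubmodule S').mkQ)) fun ψ hψ => ?_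
  · exact Int.cast_eq_zero.1 this
  · have hψ' : (AddSubgroup.toIntSubmodule S').mkQ ψ = 0 :=
      (Submodule.Quotient.mk_eq_zero _).2 ⟨1, one_ne_zero, by simpa using hψ⟩
    rw [RealSpace.ofDual_apply, LinearMap.comp_apply, hψ', map_zero, Int.cast_zero]

theorem finite_addSubgroup (S : AddSubgroup Λ) : Module.Finite ℤ S :=
  inferInstanceAs (Module.Finite ℤ (AddSubgroup.toIntSubmodule S))

theorem free_addSubgroup [Module.Free ℤ Λ] (S : AddSubgroup Λ) : Module.Free ℤ S :=
  inferInstanceAs (Module.Free ℤ (AddSubgroup.toIntSubmodule S))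

/-- A nonzero element of a lattice is a multiple of an element on which some integral form has
value one. -/
theorem exists_primitive [Module.Free ℤ Λ] {χ : Λ} (hχ : χ ≠ 0) :
    ∃ (k : ℤ) (ψ : Λ) (φ : Module.Dual ℤ Λ), k ≠ 0 ∧ χ = k • ψ ∧ φ ψ = 1 := by
  -- k generates the ideal of values of integral forms on χ. It divides all coordinates of χ, and
  -- the form attaining k takes the value one on χ/k.
  obtain ⟨k, hk⟩ := (IsPrincipalIdealRing.principal
    (LinearMap.range (Module.Dual.eval ℤ Λ χ))).principal
  have hmem : ∀ φ : Module.Dual ℤ Λ, k ∣ φ χ := fun φ => by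
    have : φ χ ∈ LinearMap.range (Module.Dual.eval ℤ Λ χ) := ⟨φ, rfl⟩
    rw [hk] at this
    exact Ideal.mem_span_singleton.1 this
  obtain ⟨φ, hφ⟩ : k ∈ LinearMap.range (Module.Dual.eval ℤ Λ χ) := by
    rw [hk]; exact Submodule.mem_span_singleton_self k
  replace hφ : φ χ = k := hφ
  have hk0 : k ≠ 0 := by
    rintro rfl
    obtain ⟨φ', h'⟩ := exists_dual_ne_zero hχ
    exact h' (zero_dvd_iff.1 (hmem φ'))
  let b := Module.Free.chooseBasis ℤ Λ
  choose m hm using fun i => hmem (b.coord i)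
  have e : χ = k • ∑ i, m i • b i := by
    conv_lhs => rw [← b.sum_repr χ]
    rw [Finset.smul_sum]
    refine Finset.sum_congr rfl fun i _ => ?_
    rw [← mul_smul, ← hm]
    rfl
  refine ⟨k, _, φ, hk0, e, ?_⟩
  rw [e, map_smul, smul_eq_mul] at hφ
  exact mul_left_cancel₀ hk0 (hφ.trans (mul_one k).symm)

end Lattices


namespace ToricArr

variable {Λ ι : Type} [AddCommGroup Λ] {A : ToricArr Λ ι}

/-! ### Layers and members -/

theorem IsLayer.isPreconnected {S : Set (Torus Λ)} (h : A.IsLayer S) : IsPreconnected S := by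
  obtain ⟨s, t, -, rfl⟩ := h
  exact isPreconnected_connectedComponentIn

/-- A connected set that meets a layer and is contained in the members defining it lies in the
layer. -/
theorem subset_component {s : Set ι} {t u : Torus Λ} {S : Set (Torus Λ)} (hS : IsPreconnected S)
    (hs : ∀ i ∈ s, S ⊆ A.hyp i) (hu : u ∈ S)
    (hu' : u ∈ connectedComponentIn (⋂ i ∈ s, A.hyp i) t) :
    S ⊆ connectedComponentIn (⋂ i ∈ s, A.hyp i) t := by
  rw [connectedComponentIn_eq hu']
  exact hS.subset_connectedComponentIn hu (Set.subset_iInter₂ hs)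

theorem mul_expMap_mem_hyp {t : Torus Λ} {v : RealSpace Λ} {i : ι} (ht : t ∈ A.hyp i)
    (h : circ (v.1 (A.char i)) = 1) : t * expMap v ∈ A.hyp i := by
  change (t * expMap v).1 (A.char i) = _
  rw [Torus.mul_apply, expMap_apply, h, map_one, mul_one]
  exact ht

theorem circ_eq_one_of_mul_mem_hyp {t : Torus Λ} {v : RealSpace Λ} {i : ι} (ht : t ∈ A.hyp i)
    (h : t * expMap v ∈ A.hyp i) : circ (v.1 (A.char i)) = 1 := by
  have h1 : t.1 (A.char i) * Circle.toUnits (circ (v.1 (A.char i))) = Circle.toUnits (A.val i) := h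
  rw [show t.1 (A.char i) = Circle.toUnits (A.val i) from ht, mul_eq_left] at h1
  exact toUnits_injective (h1.trans (map_one _).symm)

/-- For v in the first kernel, translation by exp(sv) preserves H_i for all real s, so points of H_i
stay in H_j and v vanishes on the second character. -/
theorem ker_le_of_hyp_subset {i j : ι} (h : A.hyp i ⊆ A.hyp j) (hne : (A.hyp i).Nonempty) :
    LinearMap.ker (evalForm (A.char i)) ≤ LinearMap.ker (evalForm (A.char j)) := by
  obtain ⟨t, ht⟩ := hne
  intro v hv
  refine eq_zero_of_circ_mul fun s => ?_
  refine circ_eq_one_of_mul_mem_hyp (v := s • v) (h ht) (h (mul_expMap_mem_hyp ht ?_))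
  have hv' : v.1 (A.char i) = 0 := hv
  refine circ_eq_one_of_int (n := 0) ?_
  change s * v.1 (A.char i) = _
  simp [hv']

theorem mem_tangent {S : Set (Torus Λ)} {v : RealSpace Λ} :
    v ∈ A.tangent S ↔ ∀ i, S ⊆ A.hyp i → v.1 (A.char i) = 0 := by
  simp only [tangent, Submodule.mem_iInf, Subtype.forall]
  rfl

/-- The path c ↦ t exp(cv) stays in all members containing the layer and is connected, so it does
not leave the component. -/
theorem IsLayer.mul_expMap_mem {S : Set (Torus Λ)} (hS : A.IsLayer S) {t : Torus Λ} (ht : t ∈ S)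
    {v : RealSpace Λ} (hv : v ∈ A.tangent S) : t * expMap v ∈ S := by
  obtain ⟨s, t₀, ht₀, rfl⟩ := hS
  have hsub := connectedComponentIn_subset (⋂ i ∈ s, A.hyp i) t₀
  have hc : Continuous fun c : ℝ => t * expMap (c • v) :=
    continuous_const.mul (continuous_expMap.comp (continuous_id.smul continuous_const))
  have h0 : t * expMap ((0 : ℝ) • v) = t := by
    ext χ
    rw [Torus.mul_apply, expMap_apply, circ_eq_one_of_int (n := 0) (by simp)]
    simp
  refine subset_component (isPreconnected_range hc) (fun i hi => ?_) ⟨0, rfl⟩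
    (by dsimp only; rwa [h0]) ⟨1, by simp⟩
  rintro _ ⟨c, rfl⟩
  have hi' : connectedComponentIn (⋂ i ∈ s, A.hyp i) t₀ ⊆ A.hyp i :=
    hsub.trans (Set.iInter₂_subset i hi)
  refine mul_expMap_mem_hyp (hi' ht) (circ_eq_one_of_int (n := 0) ?_)
  change c * v.1 (A.char i) = _
  rw [mem_tangent.1 hv i hi']
  simp

/-- Translations by exp(sv) preserve L for all real s, while χ is constant on L. -/
theorem Layer.apply_eq_zero_of_mem_chars (L : A.Layer) {χ : Λ} (hχ : χ ∈ chars L.carrier)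
    {v : RealSpace Λ} (hv : v ∈ A.tangent L.carrier) : v.1 χ = 0 := by
  obtain ⟨t, ht⟩ := L.nonempty
  refine eq_zero_of_circ_mul fun s => ?_
  have h1 := hχ _ (L.isLayer.mul_expMap_mem ht (Submodule.smul_mem _ s hv)) _ ht
  rw [Torus.mul_apply, expMap_apply, mul_eq_left] at h1
  exact toUnits_injective (h1.trans (map_one _).symm)

theorem char_mem_chars {S : Set (Torus Λ)} {i : ι} (h : S ⊆ A.hyp i) : A.char i ∈ chars S :=
  fun _ hs _ ht => (h hs).trans (h ht).symm

theorem Layer.chars_saturated (L : A.Layer) (n : ℤ) (χ : Λ) (hn : n ≠ 0)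
    (h : n • χ ∈ chars L.carrier) : χ ∈ chars L.carrier :=
  _root_.chars_saturated L.isLayer.isPreconnected hn h

/-- Characters that are constant on a layer are constant on the layers parallel to a part of it. -/
theorem Layer.chars_le [Module.Finite ℤ Λ] {L M : A.Layer}
    (h : A.tangent M.carrier ≤ A.tangent L.carrier) : chars L.carrier ≤ chars M.carrier := by
  intro χ hχ
  -- A vector on which all of `chars M` vanishes lies in X_M, hence in X_L, where χ vanishes. So a
  -- multiple of χ is constant on M, and saturation removes the factor.
  obtain ⟨n, hn, hmem⟩ := exists_zsmul_mem (S := chars M.carrier) (χ := χ) fun v hv =>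
    L.apply_eq_zero_of_mem_chars hχ (h (mem_tangent.2 fun i hi => hv _ (char_mem_chars hi)))
  exact M.chars_saturated n χ hn hmem

theorem Layer.exists_retraction [Module.Finite ℤ Λ] (L : A.Layer) :
    ∃ r : Λ →+ chars L.carrier, ∀ χ : chars L.carrier, r χ = χ :=
  _root_.exists_retraction L.chars_saturated

/-- `chars L` is a direct summand of Λ, so a homomorphism on it extends through the retraction. -/
theorem resTorus_surjective [Module.Finite ℤ Λ] (L : A.Layer) :
    Function.Surjective (resTorus (chars L.carrier)) := by
  obtain ⟨r, hr⟩ := L.exists_retraction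
  intro t
  refine ⟨⟨fun χ => t.1 (r χ), fun χ ψ => by dsimp only; rw [map_add, t.2]⟩, ?_⟩
  ext χ
  exact congrArg (fun χ => ((t.1 χ : ℂˣ) : ℂ)) (hr χ)

theorem resReal_surjective [Module.Finite ℤ Λ] (L : A.Layer) :
    Function.Surjective (resReal (chars L.carrier)) := by
  obtain ⟨r, hr⟩ := L.exists_retraction
  intro v
  refine ⟨⟨fun χ => v.1 (r χ), fun χ ψ => by dsimp only; rw [map_add, v.2]⟩, ?_⟩
  ext χ
  exact congrArg v.1 (hr χ)

/-- The absolute values are divided out along a path t·|t|^c from c = 0 to c = −1. It stays in the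
defining members because their characters have modulus one at t. -/
theorem exists_expMap_mem_layer [Module.Free ℤ Λ] (L : A.Layer) :
    ∃ x : RealSpace Λ, expMap x ∈ L.carrier := by
  obtain ⟨s, t, ht, hL⟩ := L.isLayer
  have hmem : t * absPow t (-1) ∈ L.carrier := by
    rw [hL]
    have hc : Continuous fun c : ℝ => t * absPow t c := continuous_const.mul (continuous_absPow t)
    have h0 : t * absPow t 0 = t := by
      ext χ
      rw [Torus.mul_apply, Units.val_mul, absPow_val]
      simp
    refine subset_component (isPreconnected_range hc) (fun i hi => ?_) ⟨0, rfl⟩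
      (by dsimp only; rw [h0]; exact mem_connectedComponentIn ht) ⟨-1, rfl⟩
    rintro _ ⟨c, rfl⟩
    have hti : t.1 (A.char i) = Circle.toUnits (A.val i) := Set.mem_iInter₂.1 ht i hi
    change (t * absPow t c).1 (A.char i) = _
    rw [← hti]
    ext
    have hnorm : ‖((t.1 (A.char i) : ℂˣ) : ℂ)‖ = 1 := by
      rw [hti]; exact Circle.norm_coe (A.val i)
    rw [Torus.mul_apply, Units.val_mul, absPow_val, hnorm]
    simp
  obtain ⟨x, hx⟩ := exists_expMap_eq (t := t * absPow t (-1)) fun χ => by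
    rw [Torus.mul_apply, Units.val_mul, norm_mul, absPow_val, Complex.norm_real, Real.norm_eq_abs,
      Real.abs_exp, neg_one_mul, Real.exp_neg, Real.exp_log (by simp)]
    exact mul_inv_cancel₀ (by simp)
  exact ⟨x, hx ▸ hmem⟩

/-! ### Faces of the compact torus -/

theorem convex_carrier (a : A.LFace) : Convex ℝ a.carrier := by
  intro x hx y hy s t hs ht hst
  refine funext fun p => ?_
  have h1 := congrFun (show A.lifted.sgn x = a.sgn from hx) p
  have h2 := congrFun (show A.lifted.sgn y = a.sgn from hy) p
  have h3 := RealArr.sign_segment (h1.trans h2.symm) (t := t) ⟨ht, by linarith⟩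
  rw [← h1]
  refine Eq.trans ?_ h3
  change SignType.sign ((s * x.1 _ + t * y.1 _) - p.1.2) = SignType.sign
    (x.1 _ - p.1.2 + t * (y.1 _ - p.1.2 - (x.1 _ - p.1.2)))
  congr 1
  obtain rfl : s = 1 - t := by linarith
  ring

theorem TFace.isPreconnected (F : A.TFace) : IsPreconnected F.carrier := by
  obtain ⟨a, ha⟩ := F.exists_lift
  rw [← ha]
  exact (convex_carrier a).isPreconnected.image _ continuous_expMap.continuousOn

theorem TFace.nonempty (F : A.TFace) : F.carrier.Nonempty := by
  obtain ⟨a, ha⟩ := F.exists_lift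
  obtain ⟨x, hx⟩ := a.realized
  exact ha ▸ ⟨_, x, hx, rfl⟩

/-- The face of the compact torus that contains the image of a point. -/
def TFace.ofPoint (A : ToricArr Λ ι) (x : RealSpace Λ) : A.TFace :=
  ⟨LFace.image (RealArr.Face.ofPoint A.lifted x), _, rfl⟩

theorem TFace.mem_ofPoint (A : ToricArr Λ ι) (x : RealSpace Λ) :
    expMap x ∈ (TFace.ofPoint A x).carrier := ⟨x, rfl, rfl⟩

theorem TFace.eq_of_mem {F G : A.TFace} {t : Torus Λ} (hF : t ∈ F.carrier) (hG : t ∈ G.carrier) :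
    F = G := by
  obtain ⟨a, ha⟩ := F.exists_lift
  obtain ⟨b, hb⟩ := G.exists_lift
  rw [← ha] at hF
  rw [← hb] at hG
  obtain ⟨x, hx, rfl⟩ := hF
  obtain ⟨y, hy, e⟩ := hG
  have h1 := mem_vadd (l := ⟨x - y, sub_mem_deck e.symm⟩) hy
  have h2 : a = (⟨x - y, sub_mem_deck e.symm⟩ : deck Λ) +ᵥ b :=
    ToricArr.eq_of_mem hx (by simpa using h1)
  exact TFace.ext (by rw [← ha, ← hb, h2, image_vadd])

theorem TFace.exists_point (F : A.TFace) : ∃ x, expMap x ∈ F.carrier ∧ F = TFace.ofPoint A x := by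
  obtain ⟨a, ha⟩ := F.exists_lift
  obtain ⟨x, hx⟩ := a.realized
  have : expMap x ∈ F.carrier := ha ▸ ⟨x, hx, rfl⟩
  exact ⟨x, this, TFace.eq_of_mem this (TFace.mem_ofPoint A x)⟩

theorem TFace.ofPoint_subset_hyp {x : RealSpace Λ} {i : ι}
    (h : circ (x.1 (A.char i)) = A.val i) : (TFace.ofPoint A x).carrier ⊆ A.hyp i :=
  subset_hyp_of_sgn_zero (a := RealArr.Face.ofPoint A.lifted x) rfl ⟨(i, x.1 (A.char i)), h⟩
    (by simp [RealArr.Face.ofPoint, RealArr.sgn, lifted])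

theorem TFace.subset_hyp_of_mem {F : A.TFace} {t : Torus Λ} {i : ι} (ht : t ∈ F.carrier)
    (hi : t ∈ A.hyp i) : F.carrier ⊆ A.hyp i := by
  obtain ⟨a, ha⟩ := F.exists_lift
  rw [← ha] at ht
  obtain ⟨x, hx, rfl⟩ := ht
  have h : circ (x.1 (A.char i)) = A.val i := toUnits_injective hi
  refine subset_hyp_of_sgn_zero ha ⟨(i, x.1 (A.char i)), h⟩ ?_
  rw [sgn_of_mem hx]
  simp

theorem TFace.subset_layer {F : A.TFace} {S : Set (Torus Λ)} (hS : A.IsLayer S) {t : Torus Λ}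
    (ht : t ∈ F.carrier) (htS : t ∈ S) : F.carrier ⊆ S := by
  obtain ⟨s, t₀, ht₀, rfl⟩ := hS
  exact subset_component F.isPreconnected (fun i hi => TFace.subset_hyp_of_mem ht
    (Set.mem_iInter₂.1 (connectedComponentIn_subset _ _ htS) i hi)) ht htS

/-- The morphism of the face category given by a pair of points in comparable faces. -/
def homOfPoints {x y : RealSpace Λ}
    (h : RealArr.Face.ofPoint A.lifted x ≤ RealArr.Face.ofPoint A.lifted y) :
    TFace.ofPoint A x ⟶ TFace.ofPoint A y :=
  FaceHom.mk (AddAction.orbit (deck Λ)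
    (RealArr.Face.ofPoint A.lifted x, RealArr.Face.ofPoint A.lifted y)) ⟨_, _, rfl, rfl, h, rfl⟩

/-! ### Supports -/

/-- The component through F of a member containing F is a layer; conversely, a layer containing F is
a component of an intersection of members that contain F. So minimality among layers reduces to
minimality among members, and a member that is a support must be connected. -/
theorem isSupport_hyp_iff {F : A.TFace} {i : ι} : IsSupport F (A.hyp i) ↔
    IsPreconnected (A.hyp i) ∧ F.carrier ⊆ A.hyp i ∧
      ∀ j, F.carrier ⊆ A.hyp j → A.hyp i ⊆ A.hyp j := by
  obtain ⟨t, ht⟩ := F.nonempty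
  constructor
  · rintro ⟨h1, h2, h3⟩
    refine ⟨h1.isPreconnected, h2, fun j hj => ?_⟩
    have htj : t ∈ ⋂ k ∈ ({j} : Set ι), A.hyp k := by simpa using hj ht
    have hl : A.IsLayer (connectedComponentIn (⋂ k ∈ ({j} : Set ι), A.hyp k) t) := ⟨_, t, htj, rfl⟩
    refine (h3 _ hl (TFace.subset_layer hl ht (mem_connectedComponentIn htj))).trans ?_
    refine (connectedComponentIn_subset _ _).trans ?_
    simp
  · rintro ⟨h1, h2, h3⟩
    refine ⟨⟨{i}, t, by simpa using h2 ht, ?_⟩, h2, ?_⟩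
    · have e : ⋂ k ∈ ({i} : Set ι), A.hyp k = A.hyp i := by simp
      rw [e, h1.connectedComponentIn (h2 ht)]
    · rintro _ ⟨s, t₀, ht₀, rfl⟩ hF
      refine subset_component h1 (fun j hj => h3 j ?_) (h2 ht) (hF ht)
      exact hF.trans ((connectedComponentIn_subset _ _).trans (Set.iInter₂_subset j hj))

/-- Write χ = kψ with φ(ψ) = 1. By saturation ψ is constant on the connected H, but translation by
exp(φ/k) preserves H and multiplies ψ by exp(2πi/k). Thus 1/k is an integer and k = ±1. -/
theorem exists_dual_char_eq_one [Module.Free ℤ Λ] [Module.Finite ℤ Λ] {i : ι}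
    (h : IsPreconnected (A.hyp i)) (hne : (A.hyp i).Nonempty) :
    ∃ φ : Module.Dual ℤ Λ, φ (A.char i) = 1 := by
  obtain ⟨k, ψ, φ, hk, hχ, hφ⟩ := exists_primitive (A.char_ne i)
  have hk' : (k : ℝ) ≠ 0 := Int.cast_ne_zero.2 hk
  have hψ : ψ ∈ chars (A.hyp i) := chars_saturated h hk (hχ ▸ char_mem_chars subset_rfl)
  obtain ⟨t, ht⟩ := hne
  have hmem : t * expMap ((k : ℝ)⁻¹ • RealSpace.ofDual φ) ∈ A.hyp i := by
    refine mul_expMap_mem_hyp ht (circ_eq_one_of_int (n := 1) ?_)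
    change (k : ℝ)⁻¹ * (φ (A.char i) : ℝ) = _
    rw [hχ, map_smul, hφ]
    simp [hk']
  have h1 := hψ _ hmem _ ht
  rw [Torus.mul_apply, expMap_apply, mul_eq_left] at h1
  obtain ⟨n, hn⟩ := circ_eq_one (toUnits_injective (h1.trans (map_one _).symm))
  replace hn : (k : ℝ)⁻¹ * (φ ψ : ℝ) = n := hn
  rw [hφ, Int.cast_one, mul_one] at hn
  have hkn : k * n = 1 := by
    have : (k : ℝ) * n = 1 := by rw [← hn, mul_inv_cancel₀ hk']
    exact_mod_cast this
  refine ⟨n • φ, ?_⟩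
  rw [hχ, map_smul, LinearMap.smul_apply, hφ, smul_eq_mul, smul_eq_mul, mul_one, hkn]

/-- Members parallel to a connected member contain it or are disjoint from it. -/
theorem hyp_subset_of_ker_le [Module.Free ℤ Λ] [Module.Finite ℤ Λ] {i j : ι}
    (h : IsPreconnected (A.hyp i)) {t : Torus Λ} (hi : t ∈ A.hyp i) (hj : t ∈ A.hyp j)
    (hker : LinearMap.ker (evalForm (A.char i)) ≤ LinearMap.ker (evalForm (A.char j))) :
    A.hyp i ⊆ A.hyp j := by
  obtain ⟨φ, hφ⟩ := exists_dual_char_eq_one h ⟨t, hi⟩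
  obtain ⟨c, -, hc⟩ := RealArr.exists_smul_of_ker_le hker (evalForm_ne_zero (A.char_ne j))
  have hcφ : c = (φ (A.char j) : ℝ) := by
    have := hc (RealSpace.ofDual φ)
    simp only [evalForm_apply, RealSpace.ofDual_apply, hφ, Int.cast_one, mul_one] at this
    exact this.symm
  -- As φ is one on χ_i, the factor of proportionality is the integer φ(χ_j). So χ_j is a multiple
  -- of χ_i and is constant on H_i.
  have e : A.char j = φ (A.char j) • A.char i := eq_of_evalForm_eq fun v => by
    rw [RealSpace.zsmul_apply, ← hcφ]
    exact hc v
  intro s hs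
  have hs' : s.1 (A.char i) = t.1 (A.char i) :=
    (show s.1 (A.char i) = _ from hs).trans (show t.1 (A.char i) = _ from hi).symm
  change s.1 (A.char j) = _
  rw [e, Torus.zsmul_apply, hs', ← Torus.zsmul_apply, ← e]
  exact hj

/-! ### Faces along a segment in the universal covering -/

/-- The lifted arrangement is infinite, but the levels of one member form a translate of ℤ. It
suffices to stay below ⌊g t₀⌋ + 1 and above ⌈g t₀⌉ − 1. -/
theorem eventually_ofPoint_lifted_le [Finite ι] (c u : RealSpace Λ) (t₀ : ℝ) :
    ∀ᶠ t in nhds t₀, RealArr.Face.ofPoint A.lifted (c + t₀ • u) ≤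
      RealArr.Face.ofPoint A.lifted (c + t • u) := by
  have key : ∀ i, ∀ᶠ t in nhds t₀, ∀ θ : ℝ, circ θ = A.val i →
      SignType.sign ((c + t₀ • u).1 (A.char i) - θ) = 0 ∨
      SignType.sign ((c + t₀ • u).1 (A.char i) - θ) =
        SignType.sign ((c + t • u).1 (A.char i) - θ) := by
    intro i
    obtain ⟨θ₀, hθ₀⟩ := A.exists_level i
    have hg : Continuous fun t : ℝ => (c + t • u).1 (A.char i) - θ₀ :=
      RealArr.continuous_form_segment (evalForm (A.char i)) c u θ₀
    set g := fun t : ℝ => (c + t • u).1 (A.char i) - θ₀ with hgdef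
    have hnear : ∀ᶠ t in nhds t₀, ∀ n : ℤ, g t₀ = n ∨ (g t₀ < n ∧ g t < n) ∨ (n < g t₀ ∧ n < g t) := by
      filter_upwards [(hg.tendsto t₀).eventually_lt_const (Int.lt_floor_add_one (g t₀)),
        (hg.tendsto t₀).eventually_const_lt
          (sub_lt_iff_lt_add.2 (Int.ceil_lt_add_one (g t₀)))] with t h1 h2 n
      rcases lt_trichotomy (g t₀) n with h | h | h
      · refine Or.inr (Or.inl ⟨h, h1.trans_le ?_⟩)
        exact_mod_cast Int.floor_lt.2 h
      · exact Or.inl h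
      · refine Or.inr (Or.inr ⟨h, lt_of_le_of_lt ?_ h2⟩)
        rw [le_sub_iff_add_le]
        exact_mod_cast Int.lt_ceil.2 h
    filter_upwards [hnear] with t ht θ hθ
    have h1 : circ (θ - θ₀) = 1 := by rw [circ_sub, hθ, hθ₀, div_self']
    obtain ⟨n, hn⟩ := circ_eq_one h1
    have e : ∀ s, (c + s • u).1 (A.char i) - θ = g s - n := fun s => by
      rw [← hn, hgdef]; ring
    rw [e, e]
    rcases ht n with h | ⟨h, h'⟩ | ⟨h, h'⟩
    · left; rw [h, sub_self, sign_zero]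
    · right; rw [sign_neg (sub_neg.2 h), sign_neg (sub_neg.2 h')]
    · right; rw [sign_pos (sub_pos.2 h), sign_pos (sub_pos.2 h')]
  filter_upwards [Filter.eventually_all.2 key] with t ht p
  exact ht p.1.1 p.1.2 p.2

end ToricArr


namespace ToricArr

variable {Λ ι : Type} [AddCommGroup Λ] {A : ToricArr Λ ι}

/-! ### Endomorphisms and equalities of morphisms -/

/-- The deck transformation shifts each character by an integer. If it were nonzero, some lifted
hyperplane off x would be reached or crossed on the way from x to x + l, contrary to the order
relation. -/
theorem vadd_eq_of_le {l : deck Λ} {a : A.LFace} (h : a ≤ l +ᵥ a) : l +ᵥ a = a := by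
  obtain ⟨x, hx⟩ := a.realized
  have key : ∀ (i : ι) (θ : ℝ), circ θ = A.val i → SignType.sign (x.1 (A.char i) - θ) = 0 ∨
      SignType.sign (x.1 (A.char i) - θ) =
        SignType.sign (x.1 (A.char i) + l.1.1 (A.char i) - θ) := fun i θ hθ => by
    have := h ⟨(i, θ), hθ⟩
    rwa [sgn_of_mem hx, sgn_of_mem (mem_vadd hx)] at this
  have hz : ∀ i, l.1.1 (A.char i) = 0 := by
    intro i
    obtain ⟨n, hn⟩ := circ_eq_one (l.2 (A.char i))
    obtain ⟨θ, hθ⟩ := A.exists_level i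
    have hth : ∀ k : ℤ, circ (θ + k) = A.val i := fun k => by
      rw [circ_add, circ_int, mul_one, hθ]
    rw [hn]
    rcases lt_trichotomy n 0 with h0 | h0 | h0
    · have h0' : (n : ℝ) ≤ -1 := by exact_mod_cast Int.le_sub_one_of_lt h0
      have h1 := Int.le_ceil (x.1 (A.char i) - θ)
      have h2 := Int.ceil_lt_add_one (x.1 (A.char i) - θ)
      -- This level is strictly below the value at x but not below the value at x + l.
      have e := key i _ (hth (⌈x.1 (A.char i) - θ⌉ - 1))
      push_cast at e
      rw [sign_pos (by linarith)] at e
      have := sign_eq_one_iff.1 (e.resolve_left (by decide)).symm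
      linarith
    · exact_mod_cast h0
    · have h0' : (1 : ℝ) ≤ n := by exact_mod_cast h0
      have h1 := Int.floor_le (x.1 (A.char i) - θ)
      have h2 := Int.lt_floor_add_one (x.1 (A.char i) - θ)
      have e := key i _ (hth (⌊x.1 (A.char i) - θ⌋ + 1))
      push_cast at e
      rw [sign_neg (by linarith)] at e
      have := sign_eq_neg_one_iff.1 (e.resolve_left (by decide)).symm
      linarith
  ext p
  change a.sgn ⟨(p.1.1, p.1.2 - l.1.1 _), _⟩ = a.sgn p
  congr 1
  ext
  · rfl
  · dsimp only; rw [hz, sub_zero]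

/-- The two lifts differ by a deck transformation, which fixes the face by `vadd_eq_of_le`. -/
theorem faceHom_endo {F : A.TFace} (m : F ⟶ F) : m = 𝟙 F := by
  obtain ⟨a, b, hab⟩ := exists_mem_rel m
  obtain ⟨ha, hb, hle, -⟩ := rel_spec m hab
  obtain ⟨l, rfl⟩ := exists_vadd (ha.trans hb.symm)
  rw [vadd_eq_of_le hle] at hab
  exact hom_ext_of_mem hab (mem_id_rel ha)

variable [Finite ι]

/-! ### Morphisms of the Salvetti category -/

namespace Sal

theorem preorder_hom_eq {P : Type} [Preorder P] {x y : P} (f g : x ⟶ y) : f = g :=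
  Subsingleton.elim f g

theorem hom_ext {x y : A.Sal} {f g : x ⟶ y} (h : f.base = g.base) : f = g :=
  Grothendieck.ext f g h (preorder_hom_eq (P := (loc y.1.unop).SalPoset) _ _)

/-- Once the ends are identified, the base is an endomorphism in the face category, hence trivial,
and the fibres are posets. This is how arrows collapsed by Φ_L disappear from homology. -/
theorem eq_eqToHom {x y : A.Sal} (f : x ⟶ y) (h : x = y) : f = eqToHom h := by
  subst h
  refine hom_ext ?_
  have := faceHom_endo (F := x.1.unop) f.base.unop
  exact congrArg Quiver.Hom.op this

theorem nerveEdge_homOfLE_congr {F : A.TFace} {x x' y y' : (loc F).SalPoset} (hx : x = x')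
    (hy : y = y') (h : x ≤ y) (h' : x' ≤ y') :
    nerveEdge (Sal.homOfLE F h) = nerveEdge (Sal.homOfLE F h') := by
  subst hx
  subst hy
  rfl

theorem homOfLE_comp {F : A.TFace} {x y z : (loc F).SalPoset} (h : x ≤ y) (h' : y ≤ z) :
    Sal.homOfLE F h ≫ Sal.homOfLE F h' = Sal.homOfLE F (h.trans h') :=
  hom_ext (Category.comp_id (𝟙 (op F)))

/-- The morphism `(G, x) ⟶ (F, salMap m x)` defined by `m : F ⟶ G`. -/
def transport {F G : A.TFace} (m : F ⟶ G) (x : (loc G).SalPoset) :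
    Sal.mk G x ⟶ Sal.mk F (salMap m x) where
  base := m.op
  fiber := CategoryTheory.homOfLE (X := (loc F).SalPoset) (le_refl (salMap m x))

theorem transport_naturality {F G : A.TFace} (m : F ⟶ G) {x y : (loc G).SalPoset} (h : x ≤ y) :
    Sal.homOfLE G h ≫ transport m y = transport m x ≫ Sal.homOfLE F ((salMap m).monotone h) :=
  hom_ext ((Category.id_comp m.op).trans (Category.comp_id m.op).symm)

end Sal

/-! ### Independence of the classes `ω̂` -/

/-- The value of a function on edges on the 1-chain `[Ω^(m)]`. -/
def omegaVal {Q : Type} [AddCommGroup Q] (q : (nerve A.Sal) _⦋1⦌ → Q) {F G : A.TFace} (m : F ⟶ G)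
    (R : A.zero.Face) (hR : R.IsChamber) : Q :=
  RealArr.SalPoset.loop (A := loc F) (fun _ _ h => q (nerveEdge (Sal.homOfLE F h))) (dir m)
    (restr F R) (restr F (negZero R)) (restr_isChamber F hR)
    (restr_isChamber F (negZero_isChamber hR))

theorem omegaChain_sum {Q : Type} [AddCommGroup Q] (q : (nerve A.Sal) _⦋1⦌ → Q) {F G : A.TFace}
    (m : F ⟶ G) (R : A.zero.Face) (hR : R.IsChamber) :
    ((omegaChain m R hR).sum fun e n => n • q e) = omegaVal q m R hR := by
  change Finsupp.linearCombination ℤ q (omegaChain m R hR) = _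
  simp only [omegaChain, map_sub, map_add, Finsupp.linearCombination_single, one_smul]
  rfl

theorem omegaVal_def {Q : Type} [AddCommGroup Q] (q : (nerve A.Sal) _⦋1⦌ → Q) {F G : A.TFace}
    (m : F ⟶ G) (R : A.zero.Face) (hR : R.IsChamber) : omegaVal q m R hR =
    q (nerveEdge (Sal.homOfLE F (omega_le m R R hR hR))) -
    q (nerveEdge (Sal.homOfLE F (omega_le m (negZero R) R (negZero_isChamber hR) hR))) +
    q (nerveEdge (Sal.homOfLE F (omega_le m (negZero R) (negZero R) (negZero_isChamber hR)
      (negZero_isChamber hR)))) -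
    q (nerveEdge (Sal.homOfLE F (omega_le m R (negZero R) hR (negZero_isChamber hR)))) := rfl

/-- F_id is the zero face of A[G], and i_m fills in the signs of F_m on the other members. So Ω^(m)
is the image of Ω^(id_G) in the fibre over F. -/
theorem salMap_omegaE {F G : A.TFace} (m : F ⟶ G) (R : A.zero.Face) (hR : R.IsChamber) :
    salMap m (omegaE (𝟙 G) R hR) = omegaE m R hR := by
  have hdir : ∀ i, (dir (𝟙 G)).sgn i = 0 := fun i => (dir_eq_zero (𝟙 G) i).2 i.2
  refine RealArr.SalPoset.ext (RealArr.Face.ext (funext fun i => ?_))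
    (RealArr.Face.ext (funext fun i => ?_))
  · change (iMap m (dir (𝟙 G))).sgn i = (dir m).sgn i
    by_cases h : G.carrier ⊆ A.hyp i.1
    · rw [iMap_sgn_pos _ _ _ h, hdir, (dir_eq_zero m i).2 h]
    · rw [iMap_sgn_neg _ _ _ h]
  · change (iMap m ((restr G R).proj (dir (𝟙 G)))).sgn i =
      if (dir m).sgn i = 0 then (restr F R).sgn i else (dir m).sgn i
    by_cases h : G.carrier ⊆ A.hyp i.1
    · rw [iMap_sgn_pos _ _ _ h, if_pos ((dir_eq_zero m i).2 h), RealArr.SalPoset.proj_sgn,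
        if_pos (hdir _)]
      rfl
    · rw [iMap_sgn_neg _ _ _ h, if_neg fun h' => h ((dir_eq_zero m i).1 h')]

theorem salMap_omegaV {F G : A.TFace} (m : F ⟶ G) (R : A.zero.Face) (hR : R.IsChamber) :
    salMap m (omegaV (𝟙 G) R hR) = omegaV m R hR := by
  have := congrArg RealArr.SalPoset.chamber (salMap_omegaE m R hR)
  exact RealArr.SalPoset.ext this this

section

variable {Q : Type} [AddCommGroup Q] {q : (nerve A.Sal) _⦋1⦌ → Q}

/-- Naturality of the transport arrows changes the value of each arrow by a difference of terms at
its ends, and these cancel around the loop. -/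
theorem omegaVal_eq_id (hq : IsAdditiveEdge q) {F G : A.TFace} (m : F ⟶ G) (R : A.zero.Face)
    (hR : R.IsChamber) : omegaVal q m R hR = omegaVal q (𝟙 G) R hR := by
  have key : ∀ {x y : (loc G).SalPoset} {x' y' : (loc F).SalPoset} (hx : salMap m x = x')
      (hy : salMap m y = y') (h : x ≤ y) (h' : x' ≤ y'), q (nerveEdge (Sal.homOfLE F h')) =
        q (nerveEdge (Sal.homOfLE G h)) + q (nerveEdge (Sal.transport m y)) -
          q (nerveEdge (Sal.transport m x)) := by
    intro x y x' y' hx hy h h'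
    subst hx
    subst hy
    have e : q (nerveEdge (Sal.homOfLE G h ≫ Sal.transport m y)) =
        q (nerveEdge (Sal.transport m x ≫ Sal.homOfLE F ((salMap m).monotone h))) := by
      rw [Sal.transport_naturality]
    rw [hq, hq] at e
    rw [e]
    exact (add_sub_cancel_left _ _).symm
  have hR' := negZero_isChamber hR
  have hV := salMap_omegaV m R hR
  have hV' := salMap_omegaV m (negZero R) hR'
  have hE := salMap_omegaE m R hR
  have hE' := salMap_omegaE m (negZero R) hR'
  rw [omegaVal_def, omegaVal_def, key hV hE (omega_le (𝟙 G) R R hR hR),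
    key hV' hE (omega_le (𝟙 G) (negZero R) R hR' hR),
    key hV' hE' (omega_le (𝟙 G) (negZero R) (negZero R) hR' hR'),
    key hV hE' (omega_le (𝟙 G) R (negZero R) hR hR')]
  abel

/-- F_m and F_m' lie on the same hyperplanes of A[F], those of the members containing H, so
`loop_eq_loop` applies. -/
theorem omegaVal_eq_of_support (hq : IsAdditiveEdge q) {F G G' : A.TFace} (m : F ⟶ G) (m' : F ⟶ G')
    {i : ι} (hG : IsSupport G (A.hyp i)) (hG' : IsSupport G' (A.hyp i)) (R : A.zero.Face)
    (hR : R.IsChamber) : omegaVal q m R hR = omegaVal q m' R hR := by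
  refine RealArr.SalPoset.loop_eq_loop (f := fun i : LocIdx F => evalForm (A.char i.1))
    (fun x y z h h' => ?_) _ _ fun k => ?_
  · refine Eq.trans ?_ (hq (Sal.homOfLE F h) (Sal.homOfLE F h'))
    exact congrArg (fun f => q (nerveEdge f)) (Sal.homOfLE_comp (F := F) h h').symm
  · rw [dir_eq_zero, dir_eq_zero]
    rw [isSupport_hyp_iff] at hG hG'
    exact ⟨fun h => hG'.2.1.trans (hG.2.2 _ h), fun h => hG.2.1.trans (hG'.2.2 _ h)⟩

/-- A short step from x inside H, in a direction off every kernel not containing that of H, leads to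
a face above that of x. The members containing it are parallel to H and meet it, so they contain the
connected H. -/
theorem exists_hom_support [Module.Free ℤ Λ] [Module.Finite ℤ Λ] {i : ι}
    (h : IsPreconnected (A.hyp i)) {x : RealSpace Λ} (hx : expMap x ∈ A.hyp i) :
    ∃ (G : A.TFace) (_ : TFace.ofPoint A x ⟶ G), IsSupport G (A.hyp i) := by
  classical
  let g : ι → Module.Dual ℝ (RealSpace Λ) := fun j => evalForm (A.char j)
  let J := {j : ι // ¬ LinearMap.ker (evalForm (A.char i)) ≤ LinearMap.ker (evalForm (A.char j))}
  obtain ⟨u, hu, hne⟩ := Module.Dual.exists_forall_mem_ne_zero_of_forall_exists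
    (LinearMap.ker (evalForm (A.char i))) (fun j : J => g j.1) fun j => by
      obtain ⟨v, hv, hv'⟩ := SetLike.not_le_iff_exists.1 j.2
      exact ⟨v, hv, hv'⟩
  have hev : ∀ᶠ t : ℝ in nhdsWithin 0 (Set.Ioi 0), RealArr.Face.ofPoint A.lifted x ≤
      RealArr.Face.ofPoint A.lifted (x + t • u) := by
    have := eventually_ofPoint_lifted_le (A := A) x u 0
    rw [zero_smul, add_zero] at this
    exact this.filter_mono nhdsWithin_le_nhds
  obtain ⟨t, hle, ht⟩ := (hev.and self_mem_nhdsWithin).exists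
  replace ht : 0 < t := ht
  have hxi : circ (x.1 (A.char i)) = A.val i := toUnits_injective hx
  refine ⟨TFace.ofPoint A (x + t • u), homOfPoints hle, isSupport_hyp_iff.2 ⟨h, ?_, ?_⟩⟩
  · refine TFace.ofPoint_subset_hyp ?_
    have hu' : u.1 (A.char i) = 0 := hu
    change circ (x.1 (A.char i) + t * u.1 (A.char i)) = _
    rw [hu', mul_zero, add_zero, hxi]
  · intro j hj
    have hxj := subset_of_hom (homOfPoints hle) hj
    refine hyp_subset_of_ker_le h hx (hxj (TFace.mem_ofPoint A x)) ?_
    by_contra hker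
    have hp : circ ((x + t • u).1 (A.char j)) = A.val j :=
      toUnits_injective (hj (TFace.mem_ofPoint A _))
    let p : A.LiftIdx := ⟨(j, (x + t • u).1 (A.char j)), hp⟩
    have h1 : (RealArr.Face.ofPoint A.lifted (x + t • u)).sgn p = 0 := by
      simp [RealArr.Face.ofPoint, RealArr.sgn, lifted, p]
    have h2 : (RealArr.Face.ofPoint A.lifted x).sgn p = 0 := by
      rcases hle p with h' | h'
      · exact h'
      · exact h'.trans h1
    have h3 : x.1 (A.char j) = x.1 (A.char j) + t * u.1 (A.char j) :=
      eq_of_sgn_zero (a := RealArr.Face.ofPoint A.lifted x) rfl p h2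
    have h4 : t * u.1 (A.char j) = 0 := left_eq_add.1 h3
    exact hne ⟨j, hker⟩ ((mul_eq_zero.1 h4).resolve_left ht.ne')

/-- Lifts of points of G and G' are joined by a segment in one lift of H. At each time a morphism
into a face with support H is chosen; its value is locally constant in time and agrees at the ends
with those of G and G'. -/
theorem omegaVal_id_eq [Module.Free ℤ Λ] [Module.Finite ℤ Λ] (hq : IsAdditiveEdge q)
    {G G' : A.TFace} {i : ι} (hG : IsSupport G (A.hyp i)) (hG' : IsSupport G' (A.hyp i))
    (R : A.zero.Face) (hR : R.IsChamber) :
    omegaVal q (𝟙 G) R hR = omegaVal q (𝟙 G') R hR := by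
  obtain ⟨hconn, hGi, -⟩ := isSupport_hyp_iff.1 hG
  obtain ⟨-, hGi', -⟩ := isSupport_hyp_iff.1 hG'
  obtain ⟨x, hx, eG⟩ := G.exists_point
  obtain ⟨y₀, hy₀, -⟩ := G'.exists_point
  obtain ⟨φ, hφ⟩ := exists_dual_char_eq_one hconn ⟨_, hGi hx⟩
  have hxi : circ (x.1 (A.char i)) = A.val i := toUnits_injective (hGi hx)
  have hyi : circ (y₀.1 (A.char i)) = A.val i := toUnits_injective (hGi' hy₀)
  obtain ⟨n, hn⟩ := circ_eq_one (x := x.1 (A.char i) - y₀.1 (A.char i)) (by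
    rw [circ_sub, hxi, hyi, div_self'])
  -- Since φ is one on χ_i, this translation carries y₀ to the lifted hyperplane of H that contains
  -- x.
  let l : deck Λ := ⟨RealSpace.ofDual (n • φ), fun χ => circ_int _⟩
  let y := y₀ + l.1
  have hy : expMap y ∈ G'.carrier := by rw [expMap_add_deck]; exact hy₀
  have eG' : G' = TFace.ofPoint A y := TFace.eq_of_mem hy (TFace.mem_ofPoint A y)
  have hxy : y.1 (A.char i) = x.1 (A.char i) := by
    change y₀.1 (A.char i) + ((n • φ) (A.char i) : ℤ) = _
    rw [LinearMap.smul_apply, hφ, smul_eq_mul, mul_one, ← hn]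
    ring
  have hmem : ∀ t : ℝ, expMap (x + t • (y - x)) ∈ A.hyp i := by
    intro t
    change Circle.toUnits (circ (x.1 (A.char i) + t * (y.1 (A.char i) - x.1 (A.char i)))) = _
    rw [hxy, sub_self, mul_zero, add_zero, hxi]
  choose K m hK using fun t => exists_hom_support hconn (hmem t)
  have hlc : IsLocallyConstant fun t : ℝ => omegaVal q (m t) R hR := by
    rw [IsLocallyConstant.iff_eventually_eq]
    intro t₀
    filter_upwards [eventually_ofPoint_lifted_le (A := A) x (y - x) t₀] with t ht
    -- Near t₀ the face at t₀ lies below the face at t, so m t extends to a morphism out of the face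
    -- at t₀, where it can be compared with m t₀.
    rw [omegaVal_eq_id hq (m t), ← omegaVal_eq_id hq (homOfPoints ht ≫ m t)]
    exact omegaVal_eq_of_support hq _ _ (hK t) (hK t₀) R hR
  have hconst : omegaVal q (m 0) R hR = omegaVal q (m 1) R hR :=
    hlc.apply_eq_of_preconnectedSpace 0 1
  have hend : ∀ (t : ℝ) (P : A.TFace), IsSupport P (A.hyp i) →
      expMap (x + t • (y - x)) ∈ P.carrier → omegaVal q (m t) R hR = omegaVal q (𝟙 P) R hR := by
    intro t P hP hPt
    obtain rfl := TFace.eq_of_mem hPt (TFace.mem_ofPoint A _)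
    exact omegaVal_eq_of_support hq _ _ (hK t) hP R hR
  rw [← hend 0 G hG (by simpa using hx), ← hend 1 G' hG' (by simpa using hy), hconst]

end

/-- The class `ω̂` of a member does not depend on the morphism by which it is defined. -/
theorem IsOmegaHat.unique [Module.Free ℤ Λ] [Module.Finite ℤ Λ] {i : ι} {R : A.zero.Face}
    {hR : R.IsChamber} {w w' : NerveH1 A.Sal} (h : IsOmegaHat i R hR w)
    (h' : IsOmegaHat i R hR w') : w = w' := by
  obtain ⟨F, G, m, hG, hw⟩ := h
  obtain ⟨F', G', m', hG', hw'⟩ := h'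
  refine hw.eq_of_additive hw' fun Q _ q hq => ?_
  rw [omegaChain_sum, omegaChain_sum, omegaVal_eq_id hq m, omegaVal_eq_id hq m']
  exact omegaVal_id_eq hq hG hG' R hR

end ToricArr


namespace ToricArr

variable {Λ ι : Type} [AddCommGroup Λ] {A : ToricArr Λ ι}

/-! ### The subcategories `S_{Y,F₀}` -/

/-- The image of Y is connected and lies in the members that define `piLayer`, so it lies in the
chosen component, which contains every face that it meets. -/
theorem piFace_subset_piLayer (L Y : A.Layer) {F : A.TFace} (hF : F.carrier ⊆ Y.carrier) :
    (piFace L F).carrier ⊆ (piLayer L Y).carrier := by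
  obtain ⟨t, ht⟩ := F.nonempty
  have hY : resTorus (chars L.carrier) '' Y.carrier ⊆ (piLayer L Y).carrier := by
    refine subset_component (A := A.quot L)
      (Y.isLayer.isPreconnected.image _ (continuous_resTorus _).continuousOn)
      (fun i hi => hi) ⟨_, Y.nonempty.some_mem, rfl⟩ (mem_connectedComponentIn ?_)
    exact Set.mem_iInter₂.2 fun i hi =>
      (show resTorus (chars L.carrier) '' Y.carrier ⊆ (A.quot L).hyp i from hi)
        ⟨_, Y.nonempty.some_mem, rfl⟩
  exact TFace.subset_layer (piLayer L Y).isLayer (resTorus_mem_piFace L ht) (hY ⟨t, hF ht, rfl⟩)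

/-- Forgetting signs preserves chambers and the order and commutes with C_G, so π_L(C) witnesses
membership. -/
theorem Phi_mapsTo_subSal [Finite ι] (L Y : A.Layer) (F₀ : A.zero.Face) :
    Set.MapsTo (Phi L).obj (subSal Y F₀) (subSal (piLayer L Y) (piZero L F₀)) := by
  rintro x ⟨hx, C, hC, hle, hch⟩
  refine ⟨piFace_subset_piLayer L Y hx, piLoc L (Sal.base x) C, fun k => hC _,
    fun k => hle (locIdx L _ k), ?_⟩
  change piLoc L (Sal.base x) (Sal.elt x).chamber = _
  rw [hch]
  rfl

/-! ### One-dimensional layers -/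

/-- Comparing signs member by member avoids transport along the equality of faces. -/
theorem Sal.mk_congr [Finite ι] {F G : A.TFace} (h : F = G) {x : (loc F).SalPoset} {y : (loc G).SalPoset}
    (hf : ∀ i (hF : F.carrier ⊆ A.hyp i) (hG : G.carrier ⊆ A.hyp i),
      x.face.sgn ⟨i, hF⟩ = y.face.sgn ⟨i, hG⟩)
    (hc : ∀ i (hF : F.carrier ⊆ A.hyp i) (hG : G.carrier ⊆ A.hyp i),
      x.chamber.sgn ⟨i, hF⟩ = y.chamber.sgn ⟨i, hG⟩) : Sal.mk F x = Sal.mk G y := by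
  subst h
  congr 1
  exact RealArr.SalPoset.ext (RealArr.Face.ext (funext fun i => hf i.1 i.2 i.2))
    (RealArr.Face.ext (funext fun i => hc i.1 i.2 i.2))

theorem lambdaSet_nonempty [Module.Free ℤ Λ] [Finite ι] {M : A.Layer} (γ : GalleryChoice M) (B : A.zero.Face) :
    (lambdaSet γ B).Nonempty := by
  obtain ⟨x, hx⟩ := exists_expMap_mem_layer M
  exact ⟨Sal.mk (TFace.ofPoint A x) (RealArr.SalPoset.vertex (restr _ (γ.gallery 0))
    (restr_isChamber _ (γ.minimal.1.1 0))),
    TFace.subset_layer M.isLayer (TFace.mem_ofPoint A x) hx, Or.inl ⟨0, rfl, rfl⟩⟩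

section Lambda

variable [Module.Free ℤ Λ] [Module.Finite ℤ Λ] [Finite ι] {L M : A.Layer}

/-- The chamber opposite to −R_M differs from −R_M, hence agrees with R_M, on the hyperplanes
containing X_M. These do not separate the ends, so a minimal gallery does not cross them. -/
theorem GalleryChoice.sgn_eq (γ : GalleryChoice M) {i : ι}
    (hi : A.tangent M.carrier ≤ LinearMap.ker (evalForm (A.char i))) (j : Fin (γ.length + 1)) :
    (γ.gallery j).sgn i = (γ.gallery 0).sgn i := by
  have := finiteDimensional_realSpace (Λ := Λ)
  refine RealArr.IsMinimalGallery.sgn_eq (f := fun i => evalForm (A.char i))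
    (fun k => evalForm_ne_zero (A.char_ne k)) γ.minimal ?_ j
  have h1 : - (γ.gallery 0).sgn i ≠ (γ.gallery (Fin.last γ.length)).sgn i :=
    (γ.last.2.2.2 i).2 hi
  have h2 := γ.minimal.1.1 0 i
  have h3 := γ.minimal.1.1 (Fin.last γ.length) i
  revert h1 h2 h3
  generalize (γ.gallery 0).sgn i = a
  generalize (γ.gallery (Fin.last γ.length)).sgn i = b
  revert a b
  decide

/-- On the members containing `L`, the walls crossed by the gallery have the signs of its
chambers. -/
theorem IsCrossing.sgn_eq (γ : GalleryChoice M) {F : A.TFace} {j : Fin γ.length}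
    {W : (loc F).Face} (hW : IsCrossing γ F j W) (i : LocIdx F)
    (hi : A.tangent M.carrier ≤ LinearMap.ker (evalForm (A.char i.1))) :
    W.sgn i = (γ.gallery 0).sgn i.1 := by
  have := finiteDimensional_realSpace (Λ := Λ)
  obtain ⟨hne, h1, h2⟩ := hW
  -- If W lay on the hyperplane of i, this would be the span of W and hence the hyperplane crossed
  -- in step j; but the gallery does not cross it.
  rcases h1.1 i with h0 | h0
  · exfalso
    obtain ⟨k, hk⟩ : ∃ k, (restr F (γ.gallery j.castSucc)).sgn k ≠
        (restr F (γ.gallery j.succ)).sgn k := by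
      by_contra hc
      push Not at hc
      exact hne (RealArr.Face.ext (funext hc))
    have hk0 := RealArr.Face.sgn_eq_zero_of_le_of_ne h1.1 h2.1 hk
    have e1 := RealArr.Face.span_eq_ker_of_isWall (f := fun i : LocIdx F => evalForm (A.char i.1))
      h1 (evalForm_ne_zero (A.char_ne i.1)) h0
    have e2 := RealArr.Face.span_eq_ker_of_isWall (f := fun i : LocIdx F => evalForm (A.char i.1))
      h1 (evalForm_ne_zero (A.char_ne k.1)) hk0
    have hik := RealArr.Face.sgn_ne_of_ker_le (f := fun i : LocIdx F => evalForm (A.char i.1))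
      (k := i) (l := k) (evalForm_ne_zero (A.char_ne k.1)) (e1.symm.trans e2).le hk
    exact hik ((γ.sgn_eq hi _).trans (γ.sgn_eq hi _).symm)
  · exact h0.trans (γ.sgn_eq hi _)

/-- All of M lies over one point of T/L₀, so the base faces have the same image. On the members
containing L, all chambers and crossed walls of the gallery have the signs of the first chamber,
independently of B. -/
theorem Phi_obj_eq (hM : A.tangent M.carrier ≤ A.tangent L.carrier) (γ : GalleryChoice M)
    {B : A.zero.Face} {x y : A.Sal} (hx : x ∈ lambdaSet γ B)
    (hy : y ∈ lambdaSet γ B) : (Phi L).obj x = (Phi L).obj y := by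
  have hker : ∀ i : A.QIdx L, A.tangent M.carrier ≤ LinearMap.ker (evalForm (A.char i.1)) :=
    fun i v hv => mem_tangent.1 (hM hv) i.1 i.2
  have hface : ∀ z ∈ lambdaSet γ B, ∀ i : LocIdx (piFace L (Sal.base z)),
      (bMap L (Sal.base z) (Sal.elt z)).face.sgn i = (γ.gallery 0).sgn i.1.1 := by
    rintro z ⟨-, ⟨j, h1, -⟩ | ⟨j, h1, -⟩⟩ i
    · change (Sal.elt z).face.sgn (locIdx L _ i) = _
      rw [h1]
      exact γ.sgn_eq (hker i.1) j
    · exact h1.sgn_eq γ (locIdx L _ i) (hker i.1)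
  have hch : ∀ z ∈ lambdaSet γ B, ∀ i : LocIdx (piFace L (Sal.base z)),
      (bMap L (Sal.base z) (Sal.elt z)).chamber.sgn i = (γ.gallery 0).sgn i.1.1 := by
    intro z hz i
    rw [← hface z hz i]
    -- The image of the face already has no zero signs, so the chamber above it equals it.
    refine (((bMap L (Sal.base z) (Sal.elt z)).le i).resolve_left ?_).symm
    rw [hface z hz i]
    exact γ.minimal.1.1 0 i.1.1
  refine Sal.mk_congr (F := piFace L (Sal.base x)) (G := piFace L (Sal.base y))
    (x := bMap L _ (Sal.elt x)) (y := bMap L _ (Sal.elt y)) ?_ ?_ ?_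
  · obtain ⟨s, hs⟩ := (Sal.base x).nonempty
    obtain ⟨t, ht⟩ := (Sal.base y).nonempty
    have e : resTorus (chars L.carrier) s = resTorus (chars L.carrier) t := by
      ext χ
      exact congrArg Units.val (Layer.chars_le hM χ.2 s (hx.1 hs) t (hy.1 ht))
    exact TFace.eq_of_mem (resTorus_mem_piFace L hs) (e ▸ resTorus_mem_piFace L ht)
  · intro i hF hG
    rw [hface x hx, hface y hy]
  · intro i hF hG
    rw [hch x hx, hch y hy]

theorem Phi_lambdaSet (hM : A.tangent M.carrier ≤ A.tangent L.carrier) (γ : GalleryChoice M)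
    (B : A.zero.Face) : ∃ w : (A.quot L).Sal, (Phi L).obj '' lambdaSet γ B = {w} := by
  obtain ⟨x, hx⟩ := lambdaSet_nonempty γ B
  refine ⟨(Phi L).obj x, Set.Subset.antisymm ?_ (by rintro _ rfl; exact ⟨x, hx, rfl⟩)⟩
  rintro _ ⟨y, hy, rfl⟩
  exact Phi_obj_eq hM γ hy hx

/-- Every arrow in the support of the cycle goes to an identity, so the coefficients play no role.
-/
theorem Phi_lambdaHat (hM : A.tangent M.carrier ≤ A.tangent L.carrier) (γ : GalleryChoice M)
    (B : A.zero.Face) {w : NerveH1 A.Sal} (hw : IsLambdaHat γ B w) :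
    (nerveH1Map (Phi L)).hom w = 0 := by
  obtain ⟨c, hc, -, hcw⟩ := hw
  refine hcw.map_eq_zero (Phi L) fun Q _ q hq => ?_
  refine Finset.sum_eq_zero fun e he => ?_
  obtain ⟨x, y, f, hf, rfl⟩ := hc e he
  dsimp only
  rw [nerveMap_nerveEdge, Sal.eq_eqToHom ((Phi L).map f) (Phi_obj_eq hM γ hf.1 hf.2.1),
    hq.map_eqToHom, smul_zero]

end Lambda

/-! ### Members -/

theorem negZero_sgn_eq {L : A.Layer} {i : A.QIdx L} {R : A.zero.Face}
    {R' : (A.quot L).zero.Face} (hs : R'.sgn i = R.sgn i.1) :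
    (negZero R').sgn i = (negZero R).sgn i.1 :=
  congrArg Neg.neg hs

theorem Phi_map_homOfLE [Finite ι] (L : A.Layer) (F : A.TFace) {x y : (loc F).SalPoset} (h : x ≤ y) :
    (Phi L).map (Sal.homOfLE F h) = Sal.homOfLE (piFace L F) ((bMap L F).monotone h) := by
  refine Sal.hom_ext ?_
  change (piHom L (𝟙 F)).op = _
  exact congrArg Quiver.Hom.op ((piFunctor L).map_id F)

section Omega

variable [Module.Finite ℤ Λ]

theorem hyp_quot_eq_image (L : A.Layer) (i : A.QIdx L) :
    (A.quot L).hyp i = resTorus (chars L.carrier) '' A.hyp i.1 := by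
  ext t
  constructor
  · intro ht
    obtain ⟨s, rfl⟩ := resTorus_surjective L t
    exact ⟨s, ht, rfl⟩
  · rintro ⟨s, hs, rfl⟩
    exact hs

/-- The members of the quotient are images of members containing L, so connectedness and inclusions
pass to them. -/
theorem isSupport_piFace (L : A.Layer) {G : A.TFace} {i : A.QIdx L}
    (hG : IsSupport G (A.hyp i.1)) : IsSupport (piFace L G) ((A.quot L).hyp i) := by
  rw [isSupport_hyp_iff] at hG ⊢
  refine ⟨?_, piFace_subset L hG.2.1, fun j hj => ?_⟩
  · rw [hyp_quot_eq_image]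
    exact hG.1.image _ (continuous_resTorus _).continuousOn
  · rw [hyp_quot_eq_image, hyp_quot_eq_image]
    exact Set.image_mono (hG.2.2 _ (subset_of_piFace L hj))

variable [Module.Free ℤ Λ]

/-- Reference chambers on the same side of a member are on the same side of the members
containing it. -/
theorem sgn_eq_of_hyp_subset (L : A.Layer) {i j : A.QIdx L} (h : A.hyp i.1 ⊆ A.hyp j.1)
    (hne : (A.hyp i.1).Nonempty) {R : A.zero.Face} {R' : (A.quot L).zero.Face}
    (hR : R'.sgn i = R.sgn i.1) : R'.sgn j = R.sgn j.1 := by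
  obtain ⟨c, -, hc⟩ := RealArr.exists_smul_of_ker_le (ker_le_of_hyp_subset h hne)
    (evalForm_ne_zero (A.char_ne j.1))
  have h1 := RealArr.Face.sgn_eq_mul (f := fun i => evalForm (A.char i)) (F := R) (k := i.1)
    (l := j.1) hc
  -- The same factor c works in the quotient because `resReal` is onto.
  have h2 := RealArr.Face.sgn_eq_mul (f := fun i => evalForm ((A.quot L).char i)) (F := R')
    (k := i) (l := j) (c := c) fun v => by
      obtain ⟨u, rfl⟩ := resReal_surjective L v
      exact hc u
  rw [h1, h2, hR]

variable [Finite ι]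

/-- The reference chamber enters only where F_m has sign 0, i.e. on members containing H. There the
side of H decides, so R' need not be the image of R. -/
theorem bMap_omegaE (L : A.Layer) {F G : A.TFace} (m : F ⟶ G) {i : A.QIdx L}
    (hG : IsSupport G (A.hyp i.1)) {R : A.zero.Face} {R' : (A.quot L).zero.Face}
    (hR : R.IsChamber) (hR' : R'.IsChamber) (hs : R'.sgn i = R.sgn i.1) :
    bMap L F (omegaE m R hR) = omegaE (piHom L m) R' hR' := by
  obtain ⟨-, hGi, hmin⟩ := isSupport_hyp_iff.1 hG
  refine RealArr.SalPoset.ext (piLoc_dir L m) (RealArr.Face.ext (funext fun j => ?_))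
  change (if (dir m).sgn (locIdx L F j) = 0 then R.sgn j.1.1 else (dir m).sgn (locIdx L F j)) =
    if (dir (piHom L m)).sgn j = 0 then R'.sgn j.1 else (dir (piHom L m)).sgn j
  have e : (dir m).sgn (locIdx L F j) = (dir (piHom L m)).sgn j := by rw [← piLoc_dir]; rfl
  rw [← e]
  split_ifs with h
  · exact (sgn_eq_of_hyp_subset L (hmin _ ((dir_eq_zero m _).1 h))
      (G.nonempty.mono hGi) hs).symm
  · rfl

theorem bMap_omegaV (L : A.Layer) {F G : A.TFace} (m : F ⟶ G) {i : A.QIdx L}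
    (hG : IsSupport G (A.hyp i.1)) {R : A.zero.Face} {R' : (A.quot L).zero.Face}
    (hR : R.IsChamber) (hR' : R'.IsChamber) (hs : R'.sgn i = R.sgn i.1) :
    bMap L F (omegaV m R hR) = omegaV (piHom L m) R' hR' := by
  have := congrArg RealArr.SalPoset.chamber (bMap_omegaE L m hG hR hR' hs)
  exact RealArr.SalPoset.ext this this

theorem Phi_omegaSet (L : A.Layer) {G : A.TFace} {i : A.QIdx L} (hG : IsSupport G (A.hyp i.1))
    {R : A.zero.Face} {R' : (A.quot L).zero.Face} (hR : R.IsChamber) (hR' : R'.IsChamber)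
    (hs : R'.sgn i = R.sgn i.1) :
    (Phi L).obj '' omegaSet (𝟙 G) R hR = omegaSet (𝟙 (piFace L G)) R' hR' := by
  have hid : piHom L (𝟙 G) = 𝟙 (piFace L G) := (piFunctor L).map_id G
  have hn := negZero_isChamber hR
  have hn' := negZero_isChamber hR'
  rw [omegaSet, omegaSet, Set.image_insert_eq, Set.image_insert_eq, Set.image_insert_eq,
    Set.image_singleton, Phi_obj_mk, Phi_obj_mk, Phi_obj_mk, Phi_obj_mk,
    bMap_omegaE L (𝟙 G) hG hR hR' hs, bMap_omegaV L (𝟙 G) hG hR hR' hs,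
    bMap_omegaE L (𝟙 G) hG hn hn' (negZero_sgn_eq hs),
    bMap_omegaV L (𝟙 G) hG hn hn' (negZero_sgn_eq hs), hid]

theorem mapDomain_omegaChain (L : A.Layer) {F G : A.TFace} (m : F ⟶ G) {i : A.QIdx L}
    (hG : IsSupport G (A.hyp i.1)) {R : A.zero.Face} {R' : (A.quot L).zero.Face}
    (hR : R.IsChamber) (hR' : R'.IsChamber) (hs : R'.sgn i = R.sgn i.1) :
    (omegaChain m R hR).mapDomain ((nerveMap (Phi L)).app _) =
      omegaChain (piHom L m) R' hR' := by
  have hn := negZero_isChamber hR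
  have hn' := negZero_isChamber hR'
  have key : ∀ {x y : (loc F).SalPoset} {x' y' : (loc (piFace L F)).SalPoset} (h : x ≤ y)
      (h' : x' ≤ y'), bMap L F x = x' → bMap L F y = y' →
      (nerveMap (Phi L)).app _ (nerveEdge (Sal.homOfLE F h)) =
        nerveEdge (Sal.homOfLE (piFace L F) h') := by
    intro x y x' y' h h' hx hy
    rw [nerveMap_nerveEdge, Phi_map_homOfLE]
    exact Sal.nerveEdge_homOfLE_congr hx hy _ _
  have hE := bMap_omegaE L m hG hR hR' hs
  have hV := bMap_omegaV L m hG hR hR' hs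
  have hE' := bMap_omegaE L m hG hn hn' (negZero_sgn_eq hs)
  have hV' := bMap_omegaV L m hG hn hn' (negZero_sgn_eq hs)
  change Finsupp.mapDomain.addMonoidHom _ _ = _
  rw [omegaChain, map_sub, map_add, map_sub]
  simp only [Finsupp.mapDomain.addMonoidHom_apply, Finsupp.mapDomain_single]
  rw [key _ (omega_le (piHom L m) R' R' hR' hR') hV hE,
    key _ (omega_le (piHom L m) (negZero R') R' hn' hR') hV' hE,
    key _ (omega_le (piHom L m) (negZero R') (negZero R') hn' hn') hV' hE',
    key _ (omega_le (piHom L m) R' (negZero R') hR' hn') hV hE']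
  rfl

theorem IsOmegaHat.map (L : A.Layer) {i : A.QIdx L} {R : A.zero.Face}
    {R' : (A.quot L).zero.Face} {hR : R.IsChamber} (hR' : R'.IsChamber)
    (hs : R'.sgn i = R.sgn i.1) {w : NerveH1 A.Sal} (h : IsOmegaHat i.1 R hR w) :
    IsOmegaHat i R' hR' ((nerveH1Map (Phi L)).hom w) := by
  obtain ⟨F, G, m, hG, hw⟩ := h
  refine ⟨_, _, piHom L m, isSupport_piFace L hG, ?_⟩
  rw [← mapDomain_omegaChain L m hG hR hR' hs]
  exact hw.map (Phi L)

end Omega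

/-- F_m lies only on members that contain H, hence equal it as sets, and these do not contain L. So
F_m projects to a chamber, and the four objects of Ω^(m) have the same image. -/
theorem IsOmegaHat.map_eq_zero [Finite ι] (L : A.Layer) {i : ι} {R : A.zero.Face} {hR : R.IsChamber}
    (hL : ¬ L.carrier ⊆ A.hyp i) (hmax : ∀ j, A.hyp i ⊆ A.hyp j → A.hyp j = A.hyp i)
    {w : NerveH1 A.Sal} (h : IsOmegaHat i R hR w) : (nerveH1Map (Phi L)).hom w = 0 := by
  obtain ⟨F, G, m, hG, hw⟩ := h
  obtain ⟨-, -, hmin⟩ := isSupport_hyp_iff.1 hG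
  have hdir : ∀ j : LocIdx (piFace L F), (dir m).sgn (locIdx L F j) ≠ 0 := by
    intro j hj
    have hj' := hmax _ (hmin _ ((dir_eq_zero m _).1 hj))
    exact hL (hj' ▸ j.1.2)
  have hE : ∀ (S : A.zero.Face) (hS : S.IsChamber),
      (bMap L F (omegaE m S hS)).face = piLoc L F (dir m) ∧
      (bMap L F (omegaE m S hS)).chamber = piLoc L F (dir m) := by
    refine fun S hS => ⟨rfl, RealArr.Face.ext (funext fun j => ?_)⟩
    exact if_neg (hdir j)
  have hV : ∀ (S S' : A.zero.Face) (hS : S.IsChamber) (hS' : S'.IsChamber),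
      bMap L F (omegaV m S hS) = bMap L F (omegaE m S' hS') := fun S S' hS hS' =>
    RealArr.SalPoset.ext ((hE S hS).2.trans (hE S' hS').1.symm)
      ((hE S hS).2.trans (hE S' hS').2.symm)
  refine hw.map_eq_zero (Phi L) fun Q _ q hq => ?_
  rw [omegaChain_sum (fun e => q ((nerveMap (Phi L)).app _ e)), omegaVal_def]
  have key : ∀ (S S' : A.zero.Face) (hS : S.IsChamber) (hS' : S'.IsChamber),
      q ((nerveMap (Phi L)).app _ (nerveEdge (Sal.homOfLE F (omega_le m S S' hS hS')))) = 0 := by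
    intro S S' hS hS'
    have e : (Phi L).obj (Sal.mk F (omegaV m S hS)) = (Phi L).obj (Sal.mk F (omegaE m S' hS')) := by
      rw [Phi_obj_mk, Phi_obj_mk, hV S S' hS hS']
    rw [nerveMap_nerveEdge, Sal.eq_eqToHom ((Phi L).map _) e, hq.map_eqToHom]
  simp only [key, sub_zero, add_zero]

end ToricArr

end

theorem mainTheorem7 {Λ ι : Type} [AddCommGroup Λ] [Module.Free ℤ Λ] [Module.Finite ℤ Λ]
    [Finite ι] (A : ToricArr Λ ι) (hA : A.IsEssential) (L : A.Layer) :
    -- the classes of the one-dimensional layers parallel to `L` are killed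
    (∀ (M : A.Layer), Module.finrank ℝ (A.tangent M.carrier) = 1 →
      A.tangent M.carrier ≤ A.tangent L.carrier →
      ∀ (γ : ToricArr.GalleryChoice M) (B : A.zero.Face), B.IsChamber →
        (∃ w : (A.quot L).Sal, (ToricArr.Phi L).obj '' ToricArr.lambdaSet γ B = {w}) ∧
        (∀ x ∈ ToricArr.lambdaSet γ B, ∀ y ∈ ToricArr.lambdaSet γ B, ∀ f : x ⟶ y,
          ∃ h : (ToricArr.Phi L).obj x = (ToricArr.Phi L).obj y,
            (ToricArr.Phi L).map f = eqToHom h) ∧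
        (∀ w : NerveH1 A.Sal, ToricArr.IsLambdaHat γ B w →
          (nerveH1Map (ToricArr.Phi L)).hom w = 0)) ∧
    -- loops around members of the arrangement
    (∀ (i : ι) (R : A.zero.Face) (hR : R.IsChamber),
      (∀ (h : L.carrier ⊆ A.hyp i) (R' : (A.quot L).zero.Face) (hR' : R'.IsChamber),
        R'.sgn ⟨i, h⟩ = R.sgn i →
        (∀ G : A.TFace, ToricArr.IsSupport G (A.hyp i) →
          ToricArr.IsSupport (ToricArr.piFace L G) ((A.quot L).hyp ⟨i, h⟩) ∧
          (ToricArr.Phi L).obj '' ToricArr.omegaSet (𝟙 G) R hR =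
            ToricArr.omegaSet (𝟙 (ToricArr.piFace L G)) R' hR') ∧
        (∀ w : NerveH1 A.Sal, ToricArr.IsOmegaHat i R hR w →
          ∀ w' : NerveH1 (A.quot L).Sal,
            ToricArr.IsOmegaHat ⟨i, h⟩ R' hR' w' ↔
              w' = (nerveH1Map (ToricArr.Phi L)).hom w)) ∧
      (¬ L.carrier ⊆ A.hyp i → (∀ j, A.hyp i ⊆ A.hyp j → A.hyp j = A.hyp i) →
        ∀ w : NerveH1 A.Sal, ToricArr.IsOmegaHat i R hR w →
          (nerveH1Map (ToricArr.Phi L)).hom w = 0)) ∧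
    -- the subcategories `S_{Y,F₀}`
    (∀ (Y : A.Layer) (F₀ : A.zero.Face),
      Set.MapsTo (ToricArr.Phi L).obj (ToricArr.subSal Y F₀)
        (ToricArr.subSal (ToricArr.piLayer L Y) (ToricArr.piZero L F₀))) := by
  have := free_addSubgroup (ToricArr.chars L.carrier)
  have := finite_addSubgroup (ToricArr.chars L.carrier)
  refine ⟨fun M _ hM γ B _ => ⟨ToricArr.Phi_lambdaSet hM γ B, fun x hx y hy f => ?_,
    fun w hw => ToricArr.Phi_lambdaHat hM γ B hw⟩, fun i R hR => ⟨fun h R' hR' hs => ⟨fun G hG =>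
    ⟨ToricArr.isSupport_piFace L (i := ⟨i, h⟩) hG, ToricArr.Phi_omegaSet L (i := ⟨i, h⟩) hG hR hR' hs⟩,
    fun w hw w' => ⟨fun hw' => ?_, ?_⟩⟩, fun hL hmax w hw => hw.map_eq_zero L hL hmax⟩,
    ToricArr.Phi_mapsTo_subSal L⟩
  · exact ⟨ToricArr.Phi_obj_eq hM γ hx hy, ToricArr.Sal.eq_eqToHom _ _⟩
  -- The image represents the class in the quotient, and independence of the defining morphism there
  -- leaves no other.
  · exact hw'.unique (ToricArr.IsOmegaHat.map L (i := ⟨i, h⟩) hR' hs hw)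
  · rintro rfl
    exact ToricArr.IsOmegaHat.map L (i := ⟨i, h⟩) hR' hs hw
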